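/- **Theorem.** Let $A$ be an associative unital ring and let $S\subset A[t]$ be a multiplicative set of monic central polynomials with $t\in S$. For $p\in S$ of degree $d$ put $\tilde p(t)=t^d p(t^{-1})$, and let $T=\{\tilde p\mid p\in S\}$, a multiplicative set of central polynomials; let $A[t]_S$ and $A[t]_T$ be the localizations. For a ring $R$ let $P(R)$ be the category of finitely generated projective right $R$-modules; for a category $\mathcal C$ with cofibrations (the injections with projective cokernel, on underlying modules) and with the isomorphisms as weak equivalences, let $K(\mathcal C)=\Omega|iS_\bullet\mathcal C|$ be its algebraic $K$-theory space, and write $K(R)=K(P(R))$. Let $\mathrm{End}_A^S$ be the category of pairs $(P,f)$ with $P\in P(A)$ and $f$ an endomorphism of $P$ such that $p(f)=0$ for some $p\in S$, and $\mathrm{Aut}_R$ the category of pairs $(Q,\alpha)$ with $Q\in P(R)$ and $\alpha$ an automorphism of $Q$. Write $LX$ for the free loop space of $X$, and let $c\colon K(\mathrm{Aut}_R)\to LK(R)$ be the coassembly map, which is a map over $K(R)$, that is, the loop $c(x)$ is based at the image of $x$ under the forgetful functor. Write $P[t]_S=P\otimes_A A[t]_S$ and $P[t]_T=P\otimes_A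 A[t]_T$. Define * $\tau(t)\colon K(\mathrm{End}_A^S)\to LK(A[t]_S)$ as $c$ composed with the map induced by $(P,f)\mapsto(P[t]_S,\,t-f)$; * $\zeta(t)\colon K(\mathrm{End}_A^S)\to LK(A[t]_T)$ as $c$ composed with the map induced by $(P,f)\mapsto(P[t]_T,\,(1-ft)^{-1})$; * $\zeta(t^{-1})\colon K(\mathrm{End}_A^S)\to LK(A[t]_S)$ as $\zeta(t)$ followed by the map that is induced by the ring homomorphism $A[t]_T\to A[t]_S$ over $A$, $t\mapsto t^{-1}$, where the basepoints of the loops are moved to those of $\tau(t)$ along the paths in $K(A[t]_S)$ that are given by the canonical natural isomorphism $P[t]_T\otimes_{A[t]_T}A[t]_S\cong P[t]_S$; * $t\colon K(\mathrm{End}_A^S)\to K(A)\to LK(A[t]_S)$ as the forgetful map, the map induced by $P\mapsto (P[t]_S,\,\text{multiplication by }t)$, and $c$. All three maps $\zeta(t^{-1})$, $\tau(t)$ and $t$ lie over the map $b\colon K(\mathrm{End}_A^S)\to K(A)\to K(A[t]_S)$, $(P,f)\mapsto P[t]_S$. Let $\zeta(t^{-1})\ast\tau(t)$ be their loop product, the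 concatenation of loops with the same basepoint. Then: 1. $\zeta(t^{-1})\ast\tau(t)$ is homotopic to $t$ as a map over $K(A[t]_S)$: there is a homotopy $H\colon [0,1]\times K(\mathrm{End}_A^S)\to LK(A[t]_S)$ from $\zeta(t^{-1})\ast\tau(t)$ to $t$ such that the loop $H(s,z)$ is based at $b(z)$ for all $s$ and $z$. 2. After projection from free loops to based loops (by translation in the loop space $K(A[t]_S)$) the identity $\zeta(t^{-1})\cdot\tau(t)=t$ holds in $K_1(A[t]_S)=\pi_1K(A[t]_S)$ at every point of $K(\mathrm{End}_A^S)$, hence for the induced maps $K_0(\mathrm{End}_A^S)\to K_1(A[t]_S)$. On the class of an object $(P,f)$ the values of $\zeta(t^{-1})$, $\tau(t)$ and $t$ are the classes in $K_1(A[t]_S)$ of the automorphisms $(1-ft^{-1})^{-1}$, $t-f$ and $t$ of $P[t]_S$. 3. If $A$ is commutative and $(P,f)$ is an object of $\mathrm{End}_A^S$ with $P$ free of rank $\chi$, then the determinants $\zeta_f(t^{-1})=\det\bigl((1-ft^{-1})^{-1}\bigr)$ and $\tau_f(t)=\det(t-f)$ over $A[t]_S$ satisfy Milnor's identity $\zeta_f(t^{-1})\,\tau_f(t)=t^{\chi}$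 in $A[t]_S$. -/

import Mathlib

open CategoryTheory Opposite
open scoped unitInterval

universe w u

namespace KT

section realization

open scoped Simplicial MonoidalCategory

/-- The point of the realization `|X|` with coordinates `u` in the simplex `x`. -/
noncomputable def pt {X : SSet.{w}} {n : SimplexCategory} (x : X.obj (op n)) :
    C(stdSimplex ℝ (Fin (n.len + 1)), |X|) :=
  (SSet.toTop.obj X).toSSetObjEquiv (op n) ((sSetTopAdj.unit.app X).app (op n) x)

lemma pt_map {X : SSet.{w}} {m n : SimplexCategory} (θ : m ⟶ n) (x : X.obj (op n))
    (u : stdSimplex ℝ (Fin (m.len + 1))) :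
    pt (X.map θ.op x) u = pt x (stdSimplex.map θ u) := by
  have h := NatTrans.naturality_apply (sSetTopAdj.unit.app X) θ.op x
  have h3 := TopCat.toSSetObjEquiv_naturality_apply θ ((sSetTopAdj.unit.app X).app (op n) x) u
  exact (congr_arg (fun k => (SSet.toTop.obj X).toSSetObjEquiv (op m) k u) h).trans h3

lemma map_pt {X Y : SSet.{w}} (f : X ⟶ Y) {n : SimplexCategory} (x : X.obj (op n))
    (u : stdSimplex ℝ (Fin (n.len + 1))) :
    (SSet.toTop.map f) (pt x u) = pt (f.app (op n) x) u := by
  have h := congr_arg (fun k => k.app (op n) x) (sSetTopAdj.unit.naturality f)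
  unfold pt
  have h2 : (sSetTopAdj.unit.app Y).app (op n) (f.app (op n) x) =
    (TopCat.toSSet.map (SSet.toTop.map f)).app (op n) ((sSetTopAdj.unit.app X).app (op n) x) := h
  rw [h2]
  rfl

/-- A map out of a realization from a compatible family of maps out of the simplices. -/
noncomputable def desc {X : SSet.{w}} {Z : Type w} [TopologicalSpace Z]
    (g : ∀ n : SimplexCategory, X.obj (op n) → C(stdSimplex ℝ (Fin (n.len + 1)), Z))
    (hg : ∀ (m n : SimplexCategory) (θ : m ⟶ n) (x : X.obj (op n)) u,
      g m (X.map θ.op x) u = g n x (stdSimplex.map θ u)) : C(|X|, Z) :=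
  ((sSetTopAdj.homEquiv X (TopCat.of Z)).symm
    { app := fun n => TypeCat.ofHom fun x =>
        ((TopCat.of Z).toSSetObjEquiv n).symm (g n.unop x)
      naturality := fun n m θ => by
        ext x
        apply ((TopCat.of Z).toSSetObjEquiv m).injective
        ext u
        exact hg m.unop n.unop θ.unop x u }).hom

lemma desc_pt {X : SSet.{w}} {Z : Type w} [TopologicalSpace Z]
    (g : ∀ n : SimplexCategory, X.obj (op n) → C(stdSimplex ℝ (Fin (n.len + 1)), Z))
    (hg : ∀ (m n : SimplexCategory) (θ : m ⟶ n) (x : X.obj (op n)) u,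
      g m (X.map θ.op x) u = g n x (stdSimplex.map θ u))
    {n : SimplexCategory} (x : X.obj (op n)) (u : stdSimplex ℝ (Fin (n.len + 1))) :
    desc g hg (pt x u) = g n x u := by
  let φ : X ⟶ TopCat.toSSet.obj (TopCat.of Z) :=
    { app := fun n => TypeCat.ofHom fun x =>
        ((TopCat.of Z).toSSetObjEquiv n).symm (g n.unop x)
      naturality := fun n m θ => by
        ext x
        apply ((TopCat.of Z).toSSetObjEquiv m).injective
        ext u
        exact hg m.unop n.unop θ.unop x u }
  have h : (sSetTopAdj.homEquiv X (TopCat.of Z)) ((sSetTopAdj.homEquiv X (TopCat.of Z)).symm φ)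
      = φ := Equiv.apply_symm_apply _ _
  rw [Adjunction.homEquiv_unit] at h
  have h2 := congr_arg (fun k => (TopCat.of Z).toSSetObjEquiv (op n) (k.app (op n) x) u) h
  exact h2

/-- Maps out of a realization are determined by their values on the simplices. -/
lemma realization_ext {X : SSet.{w}} {Z : Type w} [TopologicalSpace Z] {f g : C(|X|, Z)}
    (h : ∀ (n : SimplexCategory) (x : X.obj (op n)) u, f (pt x u) = g (pt x u)) : f = g := by
  have h1 : TopCat.ofHom f = TopCat.ofHom g := by
    apply (sSetTopAdj.homEquiv X (TopCat.of Z)).injective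
    ext n x
    apply ((TopCat.of Z).toSSetObjEquiv n).injective
    ext u
    rw [Adjunction.homEquiv_unit, Adjunction.homEquiv_unit]
    exact h n.unop x u
  exact congr_arg (fun k => k.hom) h1

/-! ### Paths from simplicial homotopies -/

/-- A simplicial map `X × Δ[1] ⟶ Y`. -/
structure SHomotopy (X Y : SSet.{w}) where
  app : ∀ n : SimplexCategory, X.obj (op n) → (n ⟶ ⦋1⦌) → Y.obj (op n)
  nat : ∀ (m n : SimplexCategory) (θ : m ⟶ n) (x : X.obj (op n)) (χ : n ⟶ ⦋1⦌),
    app m (X.map θ.op x) (θ ≫ χ) = Y.map θ.op (app n x χ)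

section prism

variable {k : ℕ}

/-- The mass of the initial segment `{j | j < i}` under `u`. -/
noncomputable def cum (u : stdSimplex ℝ (Fin (k + 1))) (i : ℕ) : ℝ :=
  ∑ j : Fin (k + 1), if j.val < i then u j else 0

/-- The part of the mass of `j` that lies among the first `r` units of mass. -/
noncomputable def low (u : stdSimplex ℝ (Fin (k + 1))) (r : ℝ) (j : Fin (k + 1)) : ℝ :=
  min r (cum u (j.val + 1)) - min r (cum u j.val)

lemma cum_zero (u : stdSimplex ℝ (Fin (k + 1))) : cum u 0 = 0 := by simp [cum]

lemma cum_last (u : stdSimplex ℝ (Fin (k + 1))) : cum u (k + 1) = 1 := by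
  rw [← stdSimplex.sum_eq_one u]
  exact Finset.sum_congr rfl fun j _ => if_pos j.isLt

lemma cum_succ (u : stdSimplex ℝ (Fin (k + 1))) (j : Fin (k + 1)) :
    cum u (j.val + 1) = cum u j.val + u j := by
  have h : u j = ∑ i : Fin (k + 1), if i = j then u i else 0 := by simp
  rw [cum, cum, h, ← Finset.sum_add_distrib]
  refine Finset.sum_congr rfl fun i _ => ?_
  by_cases h1 : i = j
  · subst h1; simp
  · have : i.val ≠ j.val := fun h => h1 (Fin.ext h)
    by_cases h2 : i.val < j.val
    · simp [h1, h2, Nat.lt_succ_of_lt h2]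
    · have : ¬ i.val < j.val + 1 := by omega
      simp [h1, h2, this]

lemma cum_mono (u : stdSimplex ℝ (Fin (k + 1))) : Monotone (cum u) := by
  intro a b hab
  refine Finset.sum_le_sum fun j _ => ?_
  have := stdSimplex.zero_le u j
  split_ifs with h1 h2 h2
  · exact le_rfl
  · exact absurd (lt_of_lt_of_le h1 hab) h2
  · exact this
  · exact le_rfl

lemma low_nonneg (u : stdSimplex ℝ (Fin (k + 1))) (r : ℝ) (j) : 0 ≤ low u r j :=
  sub_nonneg.2 (min_le_min_left r (cum_mono u (Nat.le_succ _)))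

lemma low_le (u : stdSimplex ℝ (Fin (k + 1))) (r : ℝ) (j) : low u r j ≤ u j := by
  have h := cum_succ u j
  have h0 := stdSimplex.zero_le u j
  unfold low
  rcases min_cases r (cum u (j.val + 1)) with h1 | h1 <;>
    rcases min_cases r (cum u j.val) with h2 | h2 <;> linarith

/-- The point of the prism `Δᵏ × I` over `u` at height `s`, in the coordinates of any simplex
`0 ≤ ⋯ ≤ i ≤ i ≤ ⋯ ≤ k` of the prism that contains it. -/
noncomputable def prism (u : stdSimplex ℝ (Fin (k + 1))) (s : I) :
    stdSimplex ℝ (Fin (k + 1 + 1)) :=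
  ⟨fun l => ∑ j : Fin (k + 1), ((if l = j.castSucc then low u (1 - s) j else 0) +
      (if l = j.succ then u j - low u (1 - s) j else 0)), by
    constructor
    · intro l
      refine Finset.sum_nonneg fun j _ => add_nonneg ?_ ?_
      · split_ifs
        · exact low_nonneg _ _ _
        · exact le_rfl
      · split_ifs
        · exact sub_nonneg.2 (low_le _ _ _)
        · exact le_rfl
    · rw [Finset.sum_comm, ← stdSimplex.sum_eq_one u]
      refine Finset.sum_congr rfl fun j _ => ?_
      rw [Finset.sum_add_distrib]
      simp⟩

lemma continuous_cum (i : ℕ) : Continuous fun u : stdSimplex ℝ (Fin (k + 1)) => cum u i := by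
  unfold cum
  refine continuous_finsetSum _ fun j _ => ?_
  split_ifs
  · exact (continuous_apply j).comp continuous_subtype_val
  · exact continuous_const

lemma continuous_prism : Continuous fun p : stdSimplex ℝ (Fin (k + 1)) × I => prism p.1 p.2 := by
  refine Continuous.subtype_mk (continuous_pi fun l => continuous_finsetSum _ fun j _ => ?_) _
  have hl : Continuous fun p : stdSimplex ℝ (Fin (k + 1)) × I => low p.1 (1 - p.2) j := by
    unfold low
    have h1 : Continuous fun p : stdSimplex ℝ (Fin (k + 1)) × I => (1 : ℝ) - p.2 := by fun_prop
    exact (h1.min ((continuous_cum _).comp continuous_fst)).sub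
      (h1.min ((continuous_cum _).comp continuous_fst))
  have hu : Continuous fun p : stdSimplex ℝ (Fin (k + 1)) × I => p.1 j :=
    (continuous_apply j).comp (continuous_subtype_val.comp continuous_fst)
  refine Continuous.add ?_ ?_
  · split_ifs
    · exact hl
    · exact continuous_const
  · split_ifs
    · exact hu.sub hl
    · exact continuous_const

/-- Height `s` over `u` lies in the `i`-th simplex of the prism. -/
def InPrism (u : stdSimplex ℝ (Fin (k + 1))) (s : I) (i : Fin (k + 1)) : Prop :=
  cum u i.val ≤ 1 - s ∧ (1 : ℝ) - s ≤ cum u (i.val + 1)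

lemma exists_inPrism (u : stdSimplex ℝ (Fin (k + 1))) (s : I) : ∃ i, InPrism u s i := by
  have h : ∃ i : ℕ, (1 : ℝ) - s ≤ cum u (i + 1) :=
    ⟨k, by rw [cum_last]; linarith [s.2.1]⟩
  classical
  have hle : Nat.find h ≤ k := Nat.find_min' h (by rw [cum_last]; linarith [s.2.1])
  refine ⟨⟨Nat.find h, Nat.lt_succ_of_le hle⟩, ?_, Nat.find_spec h⟩
  show cum u (Nat.find h) ≤ 1 - s
  rcases Nat.eq_zero_or_pos (Nat.find h) with h0 | h0
  · rw [h0, cum_zero]; linarith [s.2.2]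
  · have h1 := Nat.find_min h (Nat.sub_lt h0 one_pos)
    rw [Nat.sub_add_cancel (m := 1) h0] at h1
    exact (not_le.1 h1).le

lemma map_apply {a b : ℕ} (f : Fin (a + 1) → Fin (b + 1)) (u : stdSimplex ℝ (Fin (a + 1)))
    (l : Fin (b + 1)) : stdSimplex.map f u l = ∑ j, if f j = l then u j else 0 := by
  have h : stdSimplex.map f u l = FunOnFinite.linearMap ℝ ℝ f (u : Fin (a + 1) → ℝ) l :=
    congr_fun (stdSimplex.map_coe f u) l
  rw [h, FunOnFinite.linearMap_apply_apply, Finset.sum_filter]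

lemma low_eq_self {u : stdSimplex ℝ (Fin (k + 1))} {r : ℝ} {j : Fin (k + 1)}
    (h : cum u (j.val + 1) ≤ r) : low u r j = u j := by
  have h1 := cum_succ u j
  have h2 := cum_mono u (Nat.le_succ j.val)
  rw [low, min_eq_right h, min_eq_right (h2.trans h)]
  linarith

lemma low_eq_zero {u : stdSimplex ℝ (Fin (k + 1))} {r : ℝ} {j : Fin (k + 1)}
    (h : r ≤ cum u j.val) : low u r j = 0 := by
  have h2 := cum_mono u (Nat.le_succ j.val)
  rw [low, min_eq_left h, min_eq_left (h.trans h2), sub_self]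

lemma sum_single_ite {α : Type*} [Fintype α] [DecidableEq α] (P : α → Prop) [DecidablePred P]
    (b : α) (c : ℝ) :
    (∑ a, if P a then (if a = b then c else 0) else 0) = if P b then c else 0 := by
  rw [Finset.sum_eq_single b]
  · simp
  · intro a _ h; simp [h]
  · intro h; exact absurd (Finset.mem_univ b) h

lemma prism_face (u : stdSimplex ℝ (Fin (k + 1))) (s : I) (c : Fin (k + 1 + 1))
    (hs : (1 : ℝ) - s = cum u c.val) : prism u s = stdSimplex.map c.succAbove u := by
  apply stdSimplex.ext
  funext l
  rw [map_apply]
  show (∑ j : Fin (k + 1), ((if l = j.castSucc then low u (1 - s) j else 0) +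
      (if l = j.succ then u j - low u (1 - s) j else 0))) = _
  refine Finset.sum_congr rfl fun j _ => ?_
  by_cases h : j.val < c.val
  · have h1 : low u (1 - s) j = u j := low_eq_self (hs ▸ cum_mono u (by omega))
    have h2 : c.succAbove j = j.castSucc := Fin.succAbove_of_castSucc_lt _ _ h
    rw [h1, h2]; simp [eq_comm]
  · have h1 : low u (1 - s) j = 0 := low_eq_zero (hs ▸ cum_mono u (by omega))
    have h2 : c.succAbove j = j.succ := Fin.succAbove_of_le_castSucc _ _ (not_lt.1 h)
    rw [h1, h2]; simp [eq_comm]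

lemma sum_low (u : stdSimplex ℝ (Fin (k + 1))) {r : ℝ} (hr : 0 ≤ r) (a : ℕ) (ha : a ≤ k + 1) :
    (∑ j : Fin (k + 1), if j.val < a then low u r j else 0) = min r (cum u a) := by
  induction a with
  | zero => simp [cum_zero, hr]
  | succ a ih =>
    have h1 : ∀ j : Fin (k + 1), (if j.val < a + 1 then low u r j else 0) =
        (if j.val < a then low u r j else 0) +
          (if j = ⟨a, ha⟩ then low u r j else 0) := by
      intro j
      by_cases hj : j.val = a
      · have : j = ⟨a, ha⟩ := Fin.ext hj
        simp [this]
      · have h3 : j ≠ ⟨a, ha⟩ := fun h => hj (congr_arg Fin.val h)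
        by_cases h2 : j.val < a
        · simp [h2, h3, Nat.lt_succ_of_lt h2]
        · have : ¬ j.val < a + 1 := by omega
          simp [h2, h3, this]
    rw [Finset.sum_congr rfl fun j _ => h1 j, Finset.sum_add_distrib, ih (by omega)]
    simp [low]

lemma exists_initial {k b : ℕ} (f : Fin (k + 1) → Fin (b + 1)) (hf : Monotone f) (c : ℕ) :
    ∃ a, a ≤ k + 1 ∧ ∀ j, (f j).val < c ↔ j.val < a := by
  classical
  by_cases h : ∃ a : ℕ, ∃ ha : a < k + 1, ¬ (f ⟨a, ha⟩).val < c
  · obtain ⟨ha, hn⟩ := Nat.find_spec h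
    refine ⟨Nat.find h, ha.le, fun j => ⟨fun hj => ?_, fun hj => ?_⟩⟩
    · by_contra hlt
      have : f ⟨Nat.find h, ha⟩ ≤ f j := hf (not_lt.1 hlt)
      exact hn (lt_of_le_of_lt this hj)
    · by_contra hlt
      exact Nat.find_min h hj ⟨j.isLt, hlt⟩
  · push Not at h
    exact ⟨k + 1, le_rfl, fun j => ⟨fun _ => j.isLt, fun _ => h j.val j.isLt⟩⟩

lemma cum_map {b : ℕ} (f : Fin (k + 1) → Fin (b + 1)) (u : stdSimplex ℝ (Fin (k + 1))) (c : ℕ) :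
    cum (stdSimplex.map f u) c = ∑ j, if (f j).val < c then u j else 0 := by
  simp only [cum, map_apply]
  have h : ∀ l : Fin (b + 1), (if l.val < c then (∑ j, if f j = l then u j else 0) else 0) =
      ∑ j, if f j = l then (if (f j).val < c then u j else 0) else 0 := by
    intro l
    split_ifs with h1
    · refine Finset.sum_congr rfl fun j _ => ?_
      split_ifs with h2 h3 h3
      · rfl
      · exact absurd (h2 ▸ h1) h3
      · rfl
    · refine (Finset.sum_eq_zero fun j _ => ?_).symm
      split_ifs with h2 h3
      · exact absurd (h2 ▸ h3) h1
      · rfl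
      · rfl
  rw [Finset.sum_congr rfl fun l _ => h l, Finset.sum_comm]
  simp

lemma min_cum_map {b : ℕ} (f : Fin (k + 1) → Fin (b + 1)) (hf : Monotone f)
    (u : stdSimplex ℝ (Fin (k + 1))) {r : ℝ} (hr : 0 ≤ r) (c : ℕ) :
    min r (cum (stdSimplex.map f u) c) = ∑ j, if (f j).val < c then low u r j else 0 := by
  obtain ⟨a, ha, hj⟩ := exists_initial f hf c
  rw [cum_map]
  simp only [hj]
  rw [sum_low u hr a ha]
  rfl

lemma low_map {b : ℕ} (f : Fin (k + 1) → Fin (b + 1)) (hf : Monotone f)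
    (u : stdSimplex ℝ (Fin (k + 1))) {r : ℝ} (hr : 0 ≤ r) (l : Fin (b + 1)) :
    low (stdSimplex.map f u) r l = ∑ j, if f j = l then low u r j else 0 := by
  rw [low, min_cum_map f hf u hr, min_cum_map f hf u hr, ← Finset.sum_sub_distrib]
  refine Finset.sum_congr rfl fun j _ => ?_
  by_cases h : f j = l
  · simp [h]
  · have h' : (f j).val ≠ l.val := fun h1 => h (Fin.ext h1)
    by_cases h2 : (f j).val < l.val
    · simp [h, h2, Nat.lt_succ_of_lt h2]
    · have : ¬ (f j).val < l.val + 1 := by omega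
      simp [h, h2, this]

/-- The map of prisms over `f`, on the `i`-th simplex. -/
def prismMap {b : ℕ} (f : Fin (k + 1) → Fin (b + 1)) (i : Fin (k + 1)) (l : Fin (k + 1 + 1)) :
    Fin (b + 1 + 1) :=
  if h : l.val ≤ i.val then (f ⟨l.val, by omega⟩).castSucc
  else (f ⟨l.val - 1, by omega⟩).succ

lemma prismMap_mono {b : ℕ} {f : Fin (k + 1) → Fin (b + 1)} (hf : Monotone f) (i : Fin (k + 1)) :
    Monotone (prismMap f i) := by
  intro x y hxy
  have hxy' : x.val ≤ y.val := hxy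
  unfold prismMap
  split_ifs with h1 h2 h2
  · exact Fin.castSucc_le_castSucc_iff.2 (hf hxy')
  · refine le_trans ?_ (Fin.castSucc_lt_succ).le
    refine Fin.castSucc_le_castSucc_iff.2 (hf ?_)
    show x.val ≤ y.val - 1
    omega
  · omega
  · refine Fin.succ_le_succ_iff.2 (hf ?_)
    show x.val - 1 ≤ y.val - 1
    omega

lemma predAbove_prismMap {b : ℕ} {f : Fin (k + 1) → Fin (b + 1)} (hf : Monotone f)
    (i : Fin (k + 1)) (l : Fin (k + 1 + 1)) :
    (f i).predAbove (prismMap f i l) = f (i.predAbove l) := by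
  by_cases hl : l.val ≤ i.val
  · have e1 : i.predAbove l = ⟨l.val, by omega⟩ := by
      rw [Fin.predAbove_of_le_castSucc _ _ hl]; rfl
    have e2 : prismMap f i l = (f ⟨l.val, by omega⟩).castSucc := dif_pos hl
    have e3 : f ⟨l.val, by omega⟩ ≤ f i := hf hl
    rw [e1, e2, Fin.predAbove_castSucc_of_le _ _ e3]
  · have e1 : i.predAbove l = ⟨l.val - 1, by omega⟩ := by
      rw [Fin.predAbove_of_castSucc_lt _ _ (not_le.1 hl)]; rfl
    have e2 : prismMap f i l = (f ⟨l.val - 1, by omega⟩).succ := dif_neg hl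
    have e3 : f i ≤ f ⟨l.val - 1, by omega⟩ := hf (by show i.val ≤ l.val - 1; omega)
    rw [e1, e2, Fin.predAbove_succ_of_le _ _ e3]

lemma prismMap_lt_iff {b : ℕ} {f : Fin (k + 1) → Fin (b + 1)} (hf : Monotone f)
    (i : Fin (k + 1)) (l : Fin (k + 1 + 1)) :
    (prismMap f i l).val < (f i).val + 1 ↔ l.val < i.val + 1 := by
  by_cases hl : l.val ≤ i.val
  · have e2 : prismMap f i l = (f ⟨l.val, by omega⟩).castSucc := dif_pos hl
    have e3 : f ⟨l.val, by omega⟩ ≤ f i := hf hl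
    rw [e2]
    exact ⟨fun _ => Nat.lt_succ_of_le hl, fun _ => Nat.lt_succ_of_le e3⟩
  · have e2 : prismMap f i l = (f ⟨l.val - 1, by omega⟩).succ := dif_neg hl
    have e3 : f i ≤ f ⟨l.val - 1, by omega⟩ := hf (by show i.val ≤ l.val - 1; omega)
    have e4 : (f i).val ≤ (f ⟨l.val - 1, by omega⟩).val := e3
    rw [e2, Fin.val_succ]
    exact ⟨fun h => by omega, fun h => by omega⟩

lemma map_prism {b : ℕ} {f : Fin (k + 1) → Fin (b + 1)} (hf : Monotone f)
    (u : stdSimplex ℝ (Fin (k + 1))) (s : I) {i : Fin (k + 1)} (hi : InPrism u s i) :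
    stdSimplex.map (prismMap f i) (prism u s) = prism (stdSimplex.map f u) s := by
  have hr : (0 : ℝ) ≤ 1 - s := by linarith [s.2.2]
  apply stdSimplex.ext
  funext l
  rw [map_apply]
  have hL : ∀ a, prism u s a = ∑ j : Fin (k + 1),
      ((if a = j.castSucc then low u (1 - s) j else 0) +
      (if a = j.succ then u j - low u (1 - s) j else 0)) := fun _ => rfl
  have hR : prism (stdSimplex.map f u) s l = ∑ j : Fin (b + 1),
      ((if l = j.castSucc then low (stdSimplex.map f u) (1 - s) j else 0) +
      (if l = j.succ then stdSimplex.map f u j - low (stdSimplex.map f u) (1 - s) j else 0)) := rfl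
  have h1 : (∑ a, if prismMap f i a = l then prism u s a else 0) = ∑ j : Fin (k + 1),
      ((if prismMap f i j.castSucc = l then low u (1 - s) j else 0) +
      (if prismMap f i j.succ = l then u j - low u (1 - s) j else 0)) := by
    have e : ∀ a, (if prismMap f i a = l then prism u s a else 0) = ∑ j : Fin (k + 1),
        ((if prismMap f i a = l then (if a = j.castSucc then low u (1 - s) j else 0) else 0) +
        (if prismMap f i a = l then (if a = j.succ then u j - low u (1 - s) j else 0) else 0)) := by
      intro a
      by_cases h : prismMap f i a = l <;> simp [h, hL]
    rw [Finset.sum_congr rfl fun a _ => e a, Finset.sum_comm]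
    refine Finset.sum_congr rfl fun j _ => ?_
    rw [Finset.sum_add_distrib, sum_single_ite, sum_single_ite]
  have h2 : prism (stdSimplex.map f u) s l = ∑ j : Fin (k + 1),
      ((if l = (f j).castSucc then low u (1 - s) j else 0) +
      (if l = (f j).succ then u j - low u (1 - s) j else 0)) := by
    have e : ∀ c : Fin (b + 1),
        ((if l = c.castSucc then low (stdSimplex.map f u) (1 - s) c else 0) +
        (if l = c.succ then stdSimplex.map f u c - low (stdSimplex.map f u) (1 - s) c else 0)) =
        ∑ j : Fin (k + 1), ((if l = c.castSucc then (if c = f j then low u (1 - s) j else 0) else 0)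
        + (if l = c.succ then (if c = f j then u j - low u (1 - s) j else 0) else 0)) := by
      intro c
      rw [low_map f hf u hr, map_apply, ← Finset.sum_sub_distrib, Finset.sum_add_distrib]
      congr 1
      · by_cases h : l = c.castSucc <;> simp [h, eq_comm]
      · by_cases h : l = c.succ
        · simp only [h, if_true]
          refine Finset.sum_congr rfl fun j _ => ?_
          by_cases h3 : f j = c
          · simp [h3]
          · simp [h3, Ne.symm h3]
        · simp [h]
    rw [hR, Finset.sum_congr rfl fun c _ => e c, Finset.sum_comm]
    refine Finset.sum_congr rfl fun j _ => ?_
    rw [Finset.sum_add_distrib, sum_single_ite, sum_single_ite]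
  rw [h1, h2]
  refine Finset.sum_congr rfl fun j _ => ?_
  have hA : low u (1 - s) j = 0 ∨ prismMap f i j.castSucc = (f j).castSucc := by
    by_cases h : j.val ≤ i.val
    · right
      simp [prismMap, h]
    · left
      exact low_eq_zero (hi.2.trans (cum_mono u (by omega)))
  have hB : u j - low u (1 - s) j = 0 ∨ prismMap f i j.succ = (f j).succ := by
    by_cases h : j.val < i.val
    · left
      rw [low_eq_self ((cum_mono u (by omega)).trans hi.1), sub_self]
    · right
      have : ¬ (j.val + 1 ≤ i.val) := by omega
      simp [prismMap, this]
  congr 1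
  · rcases hA with h | h
    · simp [h]
    · rw [h]; simp [eq_comm]
  · rcases hB with h | h
    · simp [h]
    · rw [h]; simp [eq_comm]

end prism

/-- The map `⦋k⦌ ⟶ ⦋1⦌` sending `l < c` to `0` and `l ≥ c` to `1`. -/
def cutHom (k : ℕ) (c : ℕ) : (⦋k⦌ : SimplexCategory) ⟶ ⦋1⦌ :=
  SimplexCategory.Hom.mk
    { toFun := fun l => if l.val < c then 0 else 1
      monotone' := fun a b hab => by
        have hab' : a.val ≤ b.val := hab
        dsimp only
        split_ifs with h1 h2 h2
        · exact le_rfl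
        · exact Fin.zero_le _
        · exact absurd (lt_of_le_of_lt hab' h2) h1
        · exact le_rfl }

namespace SHomotopy

variable {X Y : SSet.{w}} (h : SHomotopy X Y)

/-- The map given by the homotopy on the `i`-th simplex of the prism over `x`. -/
noncomputable def piece {n : ℕ} (x : X.obj (op ⦋n⦌)) (i : Fin (n + 1))
    (p : stdSimplex ℝ (Fin (n + 1)) × I) : |Y| :=
  pt (h.app ⦋n + 1⦌ (X.map (SimplexCategory.σ i).op x) (cutHom (n + 1) (i.val + 1))) (prism p.1 p.2)

lemma continuous_piece {n : ℕ} (x : X.obj (op ⦋n⦌)) (i : Fin (n + 1)) :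
    Continuous (h.piece x i) :=
  (ContinuousMap.continuous _).comp continuous_prism

lemma piece_face {n : ℕ} (x : X.obj (op ⦋n⦌)) {i : Fin (n + 1)}
    {u : stdSimplex ℝ (Fin (n + 1))} {s : I} (c : Fin (n + 2)) (hc : c = i.castSucc ∨ c = i.succ)
    (hs : (1 : ℝ) - s = cum u c.val) :
    h.piece x i (u, s) = pt (h.app ⦋n⦌ x (cutHom n c.val)) u := by
  have h1 : SimplexCategory.δ c ≫ SimplexCategory.σ i = 𝟙 _ := by
    rcases hc with rfl | rfl
    · exact SimplexCategory.δ_comp_σ_self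
    · exact SimplexCategory.δ_comp_σ_succ
  have h2 : SimplexCategory.δ c ≫ cutHom (n + 1) (i.val + 1) = cutHom n c.val := by
    ext j : 3
    have hj : (c.succAbove j).val < i.val + 1 ↔ j.val < c.val := by
      by_cases hjc : j.val < c.val
      · rw [Fin.succAbove_of_castSucc_lt _ _ hjc]
        rcases hc with rfl | rfl <;> simp at hjc ⊢ <;> omega
      · rw [Fin.succAbove_of_le_castSucc _ _ (not_lt.1 hjc)]
        rcases hc with rfl | rfl <;> simp at hjc ⊢ <;> omega
    show (if (c.succAbove j).val < i.val + 1 then (0 : Fin 2) else 1) =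
      if j.val < c.val then 0 else 1
    simp only [hj]
  have h3 := h.nat _ _ (SimplexCategory.δ c) (X.map (SimplexCategory.σ i).op x)
    (cutHom (n + 1) (i.val + 1))
  have h4 : X.map (SimplexCategory.δ c).op (X.map (SimplexCategory.σ i).op x) = x := by
    rw [← Functor.map_comp_apply, ← op_comp, h1, op_id, Functor.map_id_apply]
  rw [h4, h2] at h3
  rw [h3, pt_map]
  unfold piece
  congr 1
  exact prism_face u s c hs

lemma piece_congr {n : ℕ} (x : X.obj (op ⦋n⦌)) {u : stdSimplex ℝ (Fin (n + 1))} {s : I} :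
    ∀ (d : ℕ) {i j : Fin (n + 1)}, j.val = i.val + d → InPrism u s i → InPrism u s j →
      h.piece x i (u, s) = h.piece x j (u, s) := by
  intro d
  induction d with
  | zero => intro i j hij _ _; rw [Fin.ext hij]
  | succ d ih =>
    intro i j hij hi hj
    have hlt : i.val + 1 < n + 1 := by omega
    have h1 : (1 : ℝ) - s = cum u (i.val + 1) :=
      le_antisymm hi.2 ((cum_mono u (by omega)).trans hj.1)
    have h2 : InPrism u s ⟨i.val + 1, hlt⟩ :=
      ⟨h1.symm.le, h1.le.trans (cum_mono u (Nat.le_succ _))⟩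
    rw [← ih (i := ⟨i.val + 1, hlt⟩) (by show j.val = i.val + 1 + d; omega) h2 hj,
      h.piece_face x (i := i) i.succ (Or.inr rfl) h1,
      h.piece_face x (i := ⟨i.val + 1, hlt⟩) i.succ (Or.inl rfl) h1]

lemma piece_eq {n : ℕ} (x : X.obj (op ⦋n⦌)) {u : stdSimplex ℝ (Fin (n + 1))} {s : I}
    {i j : Fin (n + 1)} (hi : InPrism u s i) (hj : InPrism u s j) :
    h.piece x i (u, s) = h.piece x j (u, s) := by
  rcases le_total i.val j.val with hij | hij
  · exact h.piece_congr x (j.val - i.val) (by omega) hi hj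
  · exact (h.piece_congr x (i.val - j.val) (by omega) hj hi).symm

/-- The map `Δⁿ × I → |Y|` given by the homotopy on a simplex `x`. -/
noncomputable def cell {n : ℕ} (x : X.obj (op ⦋n⦌)) : C(stdSimplex ℝ (Fin (n + 1)) × I, |Y|) where
  toFun p := h.piece x (exists_inPrism p.1 p.2).choose p
  continuous_toFun := by
    have hr : Continuous fun p : stdSimplex ℝ (Fin (n + 1)) × I => (1 : ℝ) - p.2 := by fun_prop
    refine LocallyFinite.continuous
      (f := fun i : Fin (n + 1) =>
        Set.ofPred fun p : stdSimplex ℝ (Fin (n + 1)) × I => InPrism p.1 p.2 i)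
      (locallyFinite_of_finite _) ?_ ?_ ?_
    · rw [Set.eq_univ_iff_forall]
      intro p
      obtain ⟨i, hi⟩ := exists_inPrism p.1 p.2
      exact Set.mem_iUnion.2 ⟨i, hi⟩
    · intro i
      exact (isClosed_le ((continuous_cum _).comp continuous_fst) hr).inter
        (isClosed_le hr ((continuous_cum _).comp continuous_fst))
    · intro i
      refine (h.continuous_piece x i).continuousOn.congr fun p hp => ?_
      exact h.piece_eq x (exists_inPrism p.1 p.2).choose_spec hp

lemma cell_eq {n : ℕ} (x : X.obj (op ⦋n⦌)) {u : stdSimplex ℝ (Fin (n + 1))} {s : I}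
    {i : Fin (n + 1)} (hi : InPrism u s i) : h.cell x (u, s) = h.piece x i (u, s) :=
  h.piece_eq x (exists_inPrism u s).choose_spec hi

lemma cell_map {m n : ℕ} (θ : (⦋m⦌ : SimplexCategory) ⟶ ⦋n⦌) (x : X.obj (op ⦋n⦌))
    (u : stdSimplex ℝ (Fin (m + 1))) (s : I) :
    h.cell (X.map θ.op x) (u, s) = h.cell x (stdSimplex.map θ u, s) := by
  obtain ⟨i, hi⟩ := exists_inPrism u s
  have hθ : Monotone θ := θ.toOrderHom.monotone
  have hi' : InPrism (stdSimplex.map θ u) s (θ i) := by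
    constructor
    · refine le_trans ?_ hi.1
      rw [cum_map]
      refine Finset.sum_le_sum fun j _ => ?_
      have h0 := stdSimplex.zero_le u j
      split_ifs with h1 h2 h2
      · exact le_rfl
      · exact absurd (hθ (not_lt.1 h2)) (not_le.2 h1)
      · exact h0
      · exact le_rfl
    · refine hi.2.trans ?_
      rw [cum_map]
      refine Finset.sum_le_sum fun j _ => ?_
      have h0 := stdSimplex.zero_le u j
      split_ifs with h1 h2 h2
      · exact le_rfl
      · exact absurd (Nat.lt_succ_of_le (hθ (Nat.le_of_lt_succ h1))) h2
      · exact h0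
      · exact le_rfl
  rw [h.cell_eq _ hi, h.cell_eq _ hi']
  let T : (⦋m + 1⦌ : SimplexCategory) ⟶ ⦋n + 1⦌ :=
    SimplexCategory.Hom.mk ⟨prismMap θ i, prismMap_mono hθ i⟩
  have h1 : SimplexCategory.σ i ≫ θ = T ≫ SimplexCategory.σ (θ i) := by
    ext l : 3
    exact (predAbove_prismMap hθ i l).symm
  have h2 : T ≫ cutHom (n + 1) ((θ i).val + 1) = cutHom (m + 1) (i.val + 1) := by
    ext l : 3
    have hl := prismMap_lt_iff hθ i l
    show (if (prismMap θ i l).val < (θ i).val + 1 then (0 : Fin 2) else 1) =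
      if l.val < i.val + 1 then 0 else 1
    simp only [hl]
  have h3 := h.nat _ _ T (X.map (SimplexCategory.σ (θ i)).op x) (cutHom (n + 1) ((θ i).val + 1))
  have h4 : X.map T.op (X.map (SimplexCategory.σ (θ i)).op x) =
      X.map (SimplexCategory.σ i).op (X.map θ.op x) := by
    rw [← Functor.map_comp_apply, ← op_comp, ← h1, op_comp,
      Functor.map_comp_apply]
  rw [h4, h2] at h3
  unfold piece
  rw [h3, pt_map]
  congr 1
  exact map_prism hθ u s hi

/-- The map `|X| → C(I, |Y|)` adjoint to the homotopy `|X| × I → |Y|`. -/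
noncomputable def toPaths : C(|X|, C(I, |Y|)) :=
  desc (fun _ x => (h.cell x).curry) fun _ _ θ x u => by
    ext s
    exact h.cell_map θ x u s

lemma toPaths_pt {n : SimplexCategory} (x : X.obj (op n)) (u : stdSimplex ℝ (Fin (n.len + 1)))
    (s : I) : h.toPaths (pt x u) s = h.cell (n := n.len) x (u, s) := by
  unfold toPaths
  rw [desc_pt]
  rfl

/-- The constant map to the vertex `b`. -/
def constHom (n : SimplexCategory) (b : Fin 2) : n ⟶ ⦋1⦌ :=
  SimplexCategory.Hom.mk ⟨fun _ => b, fun _ _ _ => le_rfl⟩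

lemma toPaths_zero {n : SimplexCategory} (x : X.obj (op n)) (u : stdSimplex ℝ (Fin (n.len + 1))) :
    h.toPaths (pt x u) 0 = pt (h.app n x (constHom n 0)) u := by
  have hs : (1 : ℝ) - (0 : I) = cum u (Fin.last (n.len + 1)).val := by
    rw [Fin.val_last, cum_last]; simp
  have hi : InPrism u 0 (Fin.last n.len) :=
    ⟨by rw [hs]; exact cum_mono u (by simp), hs.le⟩
  rw [toPaths_pt, h.cell_eq _ hi, h.piece_face (n := n.len) x _ (Or.inr rfl) hs]
  have hc : cutHom n.len (Fin.last (n.len + 1)).val = constHom n 0 := by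
    ext l : 3
    exact if_pos l.isLt
  exact congr_arg (fun c => pt (h.app n x c) u) hc

lemma toPaths_one {n : SimplexCategory} (x : X.obj (op n)) (u : stdSimplex ℝ (Fin (n.len + 1))) :
    h.toPaths (pt x u) 1 = pt (h.app n x (constHom n 1)) u := by
  have hs : (1 : ℝ) - (1 : I) = cum u (0 : Fin (n.len + 2)).val := by
    rw [Fin.val_zero, cum_zero]; simp
  have hi : InPrism u 1 (0 : Fin (n.len + 1)) :=
    ⟨hs.symm.le, by rw [hs]; exact cum_mono u (by simp)⟩
  rw [toPaths_pt, h.cell_eq _ hi, h.piece_face (n := n.len) x _ (Or.inl rfl) hs]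
  congr 2

/-- On a vertex whose cylinder is degenerate the homotopy is constant. -/
lemma toPaths_vertex (x : X.obj (op ⦋0⦌)) (y : Y.obj (op ⦋0⦌))
    (hxy : ∀ χ, h.app ⦋1⦌ (X.map (SimplexCategory.σ 0).op x) χ =
      Y.map (SimplexCategory.σ 0).op y) (u : stdSimplex ℝ (Fin 1)) (s : I) :
    h.toPaths (pt x u) s = pt y u := by
  obtain ⟨i, hi⟩ := exists_inPrism u s
  obtain rfl : i = 0 := Fin.ext (by have := i.isLt; omega)
  rw [toPaths_pt, h.cell_eq (n := 0) x hi]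
  unfold piece
  rw [hxy, pt_map]
  congr 1
  have : Subsingleton (stdSimplex ℝ (Fin 1)) := inferInstance
  exact this.elim _ _

end SHomotopy

end realization

section construction

/-! ### Based and free loops -/

section loops

variable {X Y Z : Type w} [TopologicalSpace X] [TopologicalSpace Y] [TopologicalSpace Z]

/-- The map of based loop spaces `ΩX → ΩY` induced by a based map. -/
def loopMap (f : C(X, Y)) {x : X} {y : Y} (h : f x = y) : C(Path x x, Path y y) where
  toFun γ := (γ.map f.continuous).cast h.symm h.symm
  continuous_toFun := by
    refine continuous_induced_rng.2 ?_
    exact (ContinuousMap.continuous_postcomp f).comp continuous_induced_dom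

/-- The free loop space `LX`. -/
abbrev FreeLoop (X : Type w) [TopologicalSpace X] : Type w := {γ : C(I, X) // γ 0 = γ 1}

namespace FreeLoop

/-- Evaluation of free loops at the basepoint of the circle. -/
def ev : C(FreeLoop X, X) where
  toFun γ := γ.1 0
  continuous_toFun := (continuous_eval_const (0 : I)).comp continuous_subtype_val

/-- A free loop as a path from its basepoint to its basepoint. -/
def path (γ : FreeLoop X) : Path (ev γ) (ev γ) where
  toContinuousMap := γ.1
  source' := rfl
  target' := γ.2.symm

/-- The map `LX → LY` induced by `X → Y`. -/
def map (f : C(X, Y)) : C(FreeLoop X, FreeLoop Y) where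
  toFun γ := ⟨f.comp γ.1, congr_arg f γ.2⟩
  continuous_toFun :=
    ((ContinuousMap.continuous_postcomp f).comp continuous_subtype_val).subtype_mk _

/-- A continuous family of closed paths is a map to the free loop space. -/
def ofFamily {a : Z → X} (γ : ∀ z, Path (a z) (a z)) (h : Continuous ↿γ) : C(Z, FreeLoop X) where
  toFun z := ⟨(γ z).toContinuousMap, (γ z).source.trans (γ z).target.symm⟩
  continuous_toFun := by
    refine Continuous.subtype_mk ?_ _
    exact ContinuousMap.continuous_of_continuous_uncurry _ h

lemma continuous_path (f : C(Z, FreeLoop X)) : Continuous ↿fun z => (f z).path := by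
  have h : Continuous fun p : Z × I => (f p.1).1 p.2 := by fun_prop
  exact h

/-- The product `f ∗ g` of two families of free loops with the same basepoints, by concatenating
loops, first `f` and then `g`. -/
noncomputable def mul (f g : C(Z, FreeLoop X)) (h : ∀ z, ev (f z) = ev (g z)) :
    C(Z, FreeLoop X) :=
  ofFamily (fun z => (f z).path.trans ((g z).path.cast (h z) (h z)))
    (Path.trans_continuous_family _ (continuous_path f) _ (continuous_path g))

/-- Transport of a family of free loops `f` along paths `p z` from the basepoint of `f z`
to new basepoints: the family of loops `p⁻¹ · f · p`. -/
noncomputable def transport (f : C(Z, FreeLoop X)) (p : C(Z, C(I, X)))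
    (h : ∀ z, p z 0 = ev (f z)) : C(Z, FreeLoop X) :=
  let q : ∀ z, Path (ev (f z)) (p z 1) := fun z => ⟨p z, h z, rfl⟩
  have hq : Continuous ↿q := by
    have h : Continuous fun x : Z × I => p x.1 x.2 := by fun_prop
    exact h
  ofFamily (fun z => ((q z).symm.trans (f z).path).trans (q z))
    (Path.trans_continuous_family _
      (Path.trans_continuous_family _ (Path.symm_continuous_family _ hq) _ (continuous_path f))
      _ hq)

lemma ev_transport (f : C(Z, FreeLoop X)) (p : C(Z, C(I, X))) (h : ∀ z, p z 0 = ev (f z)) (z : Z) :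
    ev (transport f p h z) = p z 1 :=
  (((Path.mk (p z) (h z) rfl : Path (ev (f z)) (p z 1)).symm.trans (f z).path).trans
    (Path.mk (p z) (h z) rfl)).source

end FreeLoop

/-- Looping once a family of paths `X → C(I, Y)` that is constant on the basepoint. -/
def loopPaths (T : C(X, C(I, Y))) {x : X} {y : Y} (h : ∀ s, T x s = y) :
    C(Path x x, C(I, Path y y)) where
  toFun γ :=
    { toFun := fun s =>
        { toFun := fun r => T (γ r) s
          source' := by simp [h]
          target' := by simp [h] }
      continuous_toFun := by
        refine continuous_induced_rng.2 ?_
        exact ContinuousMap.continuous_of_continuous_uncurry _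
          (by show Continuous fun p : I × I => T (γ p.2) p.1; fun_prop) }
  continuous_toFun := by
    refine ContinuousMap.continuous_of_continuous_uncurry _ ?_
    refine continuous_induced_rng.2 ?_
    refine ContinuousMap.continuous_of_continuous_uncurry _ ?_
    show Continuous fun p : (Path x x × I) × I => T (p.1.1 p.2) p.1.2
    fun_prop

end loops

/-! ### The `S•`-construction -/

/-- The data on a category `C` that enter Waldhausen's `S•`-construction when the weak
equivalences are the isomorphisms: a distinguished zero object, and the sequences
`X ↣ Y ↠ Y/X` consisting of a cofibration and of a choice of its quotient. -/
class KCat (C : Type (u + 1)) [Category.{u} C] where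
  zero : C
  isZero : Limits.IsZero zero
  cofSeq : ∀ {X Y Z : C}, (X ⟶ Y) → (Y ⟶ Z) → Prop
  cofSeq_left : ∀ X : C, cofSeq (isZero.to_ X) (𝟙 X)
  cofSeq_right : ∀ X : C, cofSeq (𝟙 X) (isZero.from_ X)

lemma KCat.cofSeq_zero {C : Type (u + 1)} [Category.{u} C] [KCat C] :
    KCat.cofSeq (𝟙 (KCat.zero : C)) (𝟙 (KCat.zero : C)) := by
  have h := KCat.cofSeq_left (KCat.zero : C)
  rwa [KCat.isZero.eq_of_src (KCat.isZero.to_ (KCat.zero : C)) (𝟙 _)] at h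

lemma KCat.cofSeq_of_src {C : Type (u + 1)} [Category.{u} C] [KCat C] {X Y : C}
    {f f' : KCat.zero ⟶ X} {g : X ⟶ Y} (h : KCat.cofSeq f g) : KCat.cofSeq f' g := by
  rwa [KCat.isZero.eq_of_src f' f]

lemma KCat.cofSeq_of_tgt {C : Type (u + 1)} [Category.{u} C] [KCat C] {X Y : C}
    {f : X ⟶ Y} {g g' : Y ⟶ KCat.zero} (h : KCat.cofSeq f g) : KCat.cofSeq f g' := by
  rwa [KCat.isZero.eq_of_tgt g' g]

/-- Functors that preserve the zero object and the sequences `X ↣ Y ↠ Y/X`. -/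
structure ExactFunctor (C D : Type (u + 1)) [Category.{u} C] [KCat C] [Category.{u} D] [KCat D]
    extends C ⥤ D where
  map_zero : obj KCat.zero = KCat.zero
  map_cofSeq : ∀ {X Y Z : C} (f : X ⟶ Y) (g : Y ⟶ Z), KCat.cofSeq f g →
    KCat.cofSeq (map f) (map g)

/-- The composition of exact functors. -/
def ExactFunctor.comp {C D E : Type (u + 1)} [Category.{u} C] [KCat C] [Category.{u} D] [KCat D]
    [Category.{u} E] [KCat E] (F : ExactFunctor C D) (G : ExactFunctor D E) :
    ExactFunctor C E where
  toFunctor := F.toFunctor ⋙ G.toFunctor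
  map_zero := (congr_arg G.obj F.map_zero).trans G.map_zero
  map_cofSeq f g h := G.map_cofSeq _ _ (F.map_cofSeq f g h)

/-- The poset `[n] × Ar[n]`, whose elements are `(p, i, j)` with `i ≤ j`. -/
structure Idx (n : SimplexCategory) where
  p : Fin (n.len + 1)
  i : Fin (n.len + 1)
  j : Fin (n.len + 1)
  le : i ≤ j

instance (n : SimplexCategory) : Preorder (Idx n) where
  le a b := a.p ≤ b.p ∧ a.i ≤ b.i ∧ a.j ≤ b.j
  le_refl _ := ⟨le_rfl, le_rfl, le_rfl⟩
  le_trans _ _ _ h h' := ⟨h.1.trans h'.1, h.2.1.trans h'.2.1, h.2.2.trans h'.2.2⟩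

/-- The morphisms of the poset `[n] × Ar[n]`. -/
def Idx.hom {n : SimplexCategory} {a b : Idx n} (hp : a.p ≤ b.p) (hi : a.i ≤ b.i)
    (hj : a.j ≤ b.j) : a ⟶ b :=
  homOfLE ⟨hp, hi, hj⟩

/-- The functor `[m] × Ar[m] ⥤ [n] × Ar[n]` induced by a monotone map. -/
def idxMap {m n : SimplexCategory} (θ : m ⟶ n) : Idx m ⥤ Idx n where
  obj a := ⟨θ.toOrderHom a.p, θ.toOrderHom a.i, θ.toOrderHom a.j, θ.toOrderHom.monotone a.le⟩
  map f := Idx.hom (θ.toOrderHom.monotone (leOfHom f).1) (θ.toOrderHom.monotone (leOfHom f).2.1)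
    (θ.toOrderHom.monotone (leOfHom f).2.2)

section S

variable {C : Type (u + 1)} [Category.{u} C] [KCat C]

/-- The functors `A : [n] × Ar[n] ⥤ C` that are the `n`-simplices of the nerve of the category
`iSₙC`: for every `p` one has `A p i i = *` and `A p i j ↣ A p i k ↠ A p j k` for `i ≤ j ≤ k`,
and the maps in the direction of `p` are isomorphisms. -/
structure IsSimplex {n : SimplexCategory} (A : Idx n ⥤ C) : Prop where
  zero : ∀ p i, A.obj ⟨p, i, i, le_rfl⟩ = KCat.zero
  cofSeq : ∀ p i j k (hij : i ≤ j) (hjk : j ≤ k),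
    KCat.cofSeq
      (A.map (Idx.hom le_rfl le_rfl hjk : Idx.mk p i j hij ⟶ Idx.mk p i k (hij.trans hjk)))
      (A.map (Idx.hom le_rfl hij le_rfl : Idx.mk p i k (hij.trans hjk) ⟶ Idx.mk p j k hjk))
  iso : ∀ p p' i j (hij : i ≤ j) (h : p ≤ p'),
    IsIso (A.map (Idx.hom h le_rfl le_rfl : Idx.mk p i j hij ⟶ Idx.mk p' i j hij))

lemma IsSimplex.idxMap {m n : SimplexCategory} (θ : m ⟶ n) {A : Idx n ⥤ C} (hA : IsSimplex A) :
    IsSimplex (idxMap θ ⋙ A) where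
  zero _ _ := hA.zero _ _
  cofSeq _ _ _ _ hij hjk := hA.cofSeq _ _ _ _ (θ.toOrderHom.monotone hij)
    (θ.toOrderHom.monotone hjk)
  iso _ _ _ _ hij h := hA.iso _ _ _ _ (θ.toOrderHom.monotone hij) (θ.toOrderHom.monotone h)

end S

variable (C : Type (u + 1)) [Category.{u} C] [KCat C]

/-- The simplicial set `iS•C`: the diagonal of the bisimplicial set `N•(iS•C)`. -/
def iS : SSet.{u + 1} where
  obj n := {A : Idx n.unop ⥤ C // IsSimplex A}
  map θ := TypeCat.ofHom fun A => ⟨idxMap θ.unop ⋙ A.1, A.2.idxMap θ.unop⟩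
  map_id _ := rfl
  map_comp _ _ := rfl

/-- The constant simplex `*`. -/
def iSZero (n : SimplexCategory) : (iS C).obj (op n) :=
  ⟨(Functor.const _).obj KCat.zero,
    { zero := fun _ _ => rfl
      cofSeq := fun _ _ _ _ _ _ => KCat.cofSeq_zero
      iso := fun _ _ _ _ _ _ => by dsimp; infer_instance }⟩

/-- The basepoint of `|iS•C|`. -/
noncomputable def iSBase : SSet.toTop.obj (iS C) := pt (iSZero C (.mk 0)) default

/-- The algebraic `K`-theory space `K(C) = Ω|iS•C|`. -/
abbrev K : Type (u + 1) := Path (iSBase C) (iSBase C)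

variable {C} {D : Type (u + 1)} [Category.{u} D] [KCat D]

lemma IsSimplex.comp {n : SimplexCategory} {A : Idx n ⥤ C} (hA : IsSimplex A)
    (F : ExactFunctor C D) : IsSimplex (A ⋙ F.toFunctor) where
  zero p i := (congr_arg F.obj (hA.zero p i)).trans F.map_zero
  cofSeq p i j k hij hjk := F.map_cofSeq _ _ (hA.cofSeq p i j k hij hjk)
  iso p p' i j hij h := by
    have := hA.iso p p' i j hij h
    dsimp
    infer_instance

/-- The simplicial map induced by an exact functor. -/
def iSMap (F : ExactFunctor C D) : iS C ⟶ iS D where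
  app n := TypeCat.ofHom fun A => ⟨A.1 ⋙ F.toFunctor, A.2.comp F⟩

lemma iSMap_zero (F : ExactFunctor C D) (n : SimplexCategory) :
    (iSMap F).app (op n) (iSZero C n) = iSZero D n :=
  Subtype.ext (CategoryTheory.Functor.ext (fun _ => F.map_zero) (fun _ _ _ => by
    show F.map (𝟙 _) = eqToHom _ ≫ 𝟙 _ ≫ eqToHom _
    have h : 𝟙 (F.obj KCat.zero) = eqToHom F.map_zero ≫ eqToHom F.map_zero.symm := by simp
    rw [F.map_id, Category.id_comp]
    exact h))

lemma iSMap_base (F : ExactFunctor C D) : SSet.toTop.map (iSMap F) (iSBase C) = iSBase D := by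
  unfold iSBase
  rw [map_pt, iSMap_zero]

/-- The map of `K`-theory spaces induced by an exact functor. -/
noncomputable def kMap (F : ExactFunctor C D) : C(K C, K D) :=
  loopMap (SSet.toTop.map (iSMap F)).hom (iSMap_base F)

lemma kMap_comp {E : Type (u + 1)} [Category.{u} E] [KCat E] (F : ExactFunctor C D)
    (G : ExactFunctor D E) (γ : K C) : kMap G (kMap F γ) = kMap (F.comp G) γ := by
  ext s
  have h : SSet.toTop.map (iSMap (F.comp G)) =
      SSet.toTop.map (iSMap F) ≫ SSet.toTop.map (iSMap G) := by
    rw [← SSet.toTop.map_comp]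
    rfl
  show SSet.toTop.map (iSMap G) (SSet.toTop.map (iSMap F) (γ s)) =
    SSet.toTop.map (iSMap (F.comp G)) (γ s)
  rw [h]
  rfl

end construction

/-! ### Isomorphisms, automorphisms and the coassembly map -/

section iso

/-- The category of isomorphisms of `C`. -/
structure IsoArr (C : Type (u + 1)) [Category.{u} C] where
  src : C
  tgt : C
  iso : src ≅ tgt

namespace IsoArr

variable {C : Type (u + 1)} [Category.{u} C]

/-- Commutative squares. -/
@[ext]
structure Hom (a b : IsoArr C) where
  l : a.src ⟶ b.src
  r : a.tgt ⟶ b.tgt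
  w : l ≫ b.iso.hom = a.iso.hom ≫ r

instance : Category (IsoArr C) where
  Hom := Hom
  id a := ⟨𝟙 _, 𝟙 _, by simp⟩
  comp f g := ⟨f.l ≫ g.l, f.r ≫ g.r, by
    rw [Category.assoc, g.w, ← Category.assoc, f.w, Category.assoc]⟩
  id_comp _ := Hom.ext (Category.id_comp _) (Category.id_comp _)
  comp_id _ := Hom.ext (Category.comp_id _) (Category.comp_id _)
  assoc _ _ _ := Hom.ext (Category.assoc _ _ _) (Category.assoc _ _ _)

lemma isZero_mk {X Y : C} (e : X ≅ Y) (hX : Limits.IsZero X) (hY : Limits.IsZero Y) :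
    Limits.IsZero (⟨X, Y, e⟩ : IsoArr C) where
  unique_to _ := ⟨⟨⟨⟨hX.to_ _, hY.to_ _, hX.eq_of_src _ _⟩⟩,
    fun _ => Hom.ext (hX.eq_of_src _ _) (hY.eq_of_src _ _)⟩⟩
  unique_from _ := ⟨⟨⟨⟨hX.from_ _, hY.from_ _, hY.eq_of_tgt _ _⟩⟩,
    fun _ => Hom.ext (hX.eq_of_tgt _ _) (hY.eq_of_tgt _ _)⟩⟩

instance [KCat C] : KCat (IsoArr C) where
  zero := ⟨KCat.zero, KCat.zero, Iso.refl _⟩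
  isZero := isZero_mk _ KCat.isZero KCat.isZero
  cofSeq f g := KCat.cofSeq f.l g.l ∧ KCat.cofSeq f.r g.r
  cofSeq_left X := ⟨KCat.cofSeq_of_src (KCat.cofSeq_left X.src),
    KCat.cofSeq_of_src (KCat.cofSeq_left X.tgt)⟩
  cofSeq_right X := ⟨KCat.cofSeq_of_tgt (KCat.cofSeq_right X.src),
    KCat.cofSeq_of_tgt (KCat.cofSeq_right X.tgt)⟩

lemma eq_zero [KCat C] {X Y : C} (hX : X = KCat.zero) (hY : Y = KCat.zero) (e : X ≅ Y) :
    (⟨X, Y, e⟩ : IsoArr C) = KCat.zero := by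
  subst hX hY
  have : e = Iso.refl _ := Iso.ext (KCat.isZero.eq_of_src _ _)
  rw [this]
  rfl

instance isIso_l {a b : IsoArr C} (f : a ⟶ b) [IsIso f] : IsIso f.l :=
  ⟨(inv f).l, congr_arg Hom.l (IsIso.hom_inv_id f), congr_arg Hom.l (IsIso.inv_hom_id f)⟩

instance isIso_r {a b : IsoArr C} (f : a ⟶ b) [IsIso f] : IsIso f.r :=
  ⟨(inv f).r, congr_arg Hom.r (IsIso.hom_inv_id f), congr_arg Hom.r (IsIso.inv_hom_id f)⟩

/-- The source (`0`) or the target (`1`) of an isomorphism. -/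
def pick (a : IsoArr C) : Fin 2 → C
  | 0 => a.src
  | 1 => a.tgt

/-- The isomorphism as a functor `{0 < 1} ⥤ C`. -/
def step (a : IsoArr C) : ∀ {b b' : Fin 2}, b ≤ b' → (a.pick b ⟶ a.pick b')
  | 0, 0, _ => 𝟙 a.src
  | 0, 1, _ => a.iso.hom
  | 1, 0, h => absurd h (by decide)
  | 1, 1, _ => 𝟙 a.tgt

/-- The components of a square at `0` and at `1`. -/
def side {a a' : IsoArr C} (f : a ⟶ a') : ∀ b : Fin 2, a.pick b ⟶ a'.pick b
  | 0 => f.l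
  | 1 => f.r

lemma step_self (a : IsoArr C) : ∀ (b : Fin 2) (h : b ≤ b), a.step h = 𝟙 (a.pick b)
  | 0, _ => rfl
  | 1, _ => rfl

lemma step_step (a : IsoArr C) : ∀ {b b' b'' : Fin 2} (h : b ≤ b') (h' : b' ≤ b''),
    a.step h ≫ a.step h' = a.step (h.trans h')
  | 0, 0, _, _, _ => Category.id_comp _
  | 0, 1, 1, _, _ => Category.comp_id _
  | 0, 1, 0, _, h' => absurd h' (by decide)
  | 1, 0, _, h, _ => absurd h (by decide)
  | 1, 1, _, _, _ => Category.id_comp _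

lemma side_step {a a' : IsoArr C} (f : a ⟶ a') : ∀ {b b' : Fin 2} (h : b ≤ b'),
    side f b ≫ a'.step h = a.step h ≫ side f b'
  | 0, 0, _ => (Category.comp_id _).trans (Category.id_comp _).symm
  | 0, 1, _ => f.w
  | 1, 0, h => absurd h (by decide)
  | 1, 1, _ => (Category.comp_id _).trans (Category.id_comp _).symm

lemma pick_zero [KCat C] : ∀ b, (KCat.zero : IsoArr C).pick b = KCat.zero
  | 0 => rfl
  | 1 => rfl

lemma side_id (a : IsoArr C) : ∀ b, side (𝟙 a) b = 𝟙 (a.pick b)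
  | 0 => rfl
  | 1 => rfl

lemma side_step_zero [KCat C] : ∀ (b b' : Fin 2) (h : b ≤ b'),
    side (𝟙 (KCat.zero : IsoArr C)) b ≫ (KCat.zero : IsoArr C).step h =
      eqToHom (pick_zero b) ≫ 𝟙 (KCat.zero : C) ≫ eqToHom (pick_zero b').symm
  | 0, 0, _ => (Category.id_comp _).trans (by simp [step]; rfl)
  | 0, 1, _ => (Category.id_comp _).trans (by simp [step]; rfl)
  | 1, 0, h => absurd h (by decide)
  | 1, 1, _ => (Category.id_comp _).trans (by simp [step]; rfl)

lemma side_comp {a a' a'' : IsoArr C} (f : a ⟶ a') (g : a' ⟶ a'') :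
    ∀ b, side (f ≫ g) b = side f b ≫ side g b
  | 0 => rfl
  | 1 => rfl

instance isIso_step (a : IsoArr C) : ∀ {b b' : Fin 2} (h : b ≤ b'), IsIso (a.step h)
  | 0, 0, _ => inferInstanceAs (IsIso (𝟙 a.src))
  | 0, 1, _ => inferInstanceAs (IsIso a.iso.hom)
  | 1, 0, h => absurd h (by decide)
  | 1, 1, _ => inferInstanceAs (IsIso (𝟙 a.tgt))

instance isIso_side {a a' : IsoArr C} (f : a ⟶ a') [IsIso f] : ∀ b, IsIso (side f b)
  | 0 => isIso_l f
  | 1 => isIso_r f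

/-- The functor `(p, i, j) ↦ (A p i j)_{χ p}`, where `(–)₀` and `(–)₁` are the source and the
target of an isomorphism. -/
def cylinder {n : SimplexCategory} (A : Idx n ⥤ IsoArr C) (χ : n ⟶ SimplexCategory.mk 1) : Idx n ⥤ C where
  obj a := (A.obj a).pick (χ.toOrderHom a.p)
  map {a b} f := side (A.map f) (χ.toOrderHom a.p) ≫
    (A.obj b).step (χ.toOrderHom.monotone (leOfHom f).1)
  map_id a := by rw [A.map_id, side_id, step_self, Category.id_comp]
  map_comp {a b c} f g := by
    rw [A.map_comp, side_comp]
    simp only [Category.assoc]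
    rw [← step_step _ (χ.toOrderHom.monotone (leOfHom f).1) (χ.toOrderHom.monotone (leOfHom g).1),
      ← Category.assoc (side (A.map g) _), side_step (A.map g)]
    simp only [Category.assoc]

variable [KCat C]

lemma cylinder_isSimplex {n : SimplexCategory} {A : Idx n ⥤ IsoArr C} (hA : IsSimplex A)
    (χ : n ⟶ SimplexCategory.mk 1) : IsSimplex (cylinder A χ) where
  zero p i := by
    show (A.obj ⟨p, i, i, le_rfl⟩).pick (χ.toOrderHom p) = KCat.zero
    rw [hA.zero p i]
    generalize χ.toOrderHom p = b
    match b with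
    | 0 => rfl
    | 1 => rfl
  cofSeq p i j k hij hjk := by
    have h := hA.cofSeq p i j k hij hjk
    simp only [cylinder, step_self, Category.comp_id]
    generalize χ.toOrderHom p = b
    match b with
    | 0 => exact h.1
    | 1 => exact h.2
  iso p p' i j hij h := by
    have := hA.iso p p' i j hij h
    dsimp only [cylinder]
    infer_instance

variable (C) in
/-- The simplicial homotopy that moves the source of an isomorphism along it to its target. -/
def homotopy : SHomotopy (iS (IsoArr C)) (iS C) where
  app _ A χ := ⟨cylinder A.1 χ, cylinder_isSimplex A.2 χ⟩
  nat _ _ _ _ _ := rfl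

/-- The family of paths in `K(C)` from the source to the target, over `K` of the category of
isomorphisms. -/
noncomputable def paths : C(K (IsoArr C), C(I, K C)) :=
  loopPaths (homotopy C).toPaths (x := iSBase (IsoArr C)) (y := iSBase C) fun s =>
    (homotopy C).toPaths_vertex _ (iSZero C (.mk 0)) (fun χ => by
      refine Subtype.ext (CategoryTheory.Functor.ext (fun a => ?_) (fun a b f => ?_))
      · exact pick_zero _
      · exact side_step_zero _ _ _) _ s

/-- The source functor. -/
def srcF : ExactFunctor (IsoArr C) C where
  obj a := a.src
  map f := f.l
  map_zero := rfl
  map_cofSeq _ _ h := h.1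

/-- The target functor. -/
def tgtF : ExactFunctor (IsoArr C) C where
  obj a := a.tgt
  map f := f.r
  map_zero := rfl
  map_cofSeq _ _ h := h.2

lemma toPaths_zero : (ContinuousMap.mk (fun x => (homotopy C).toPaths x 0)) =
    (SSet.toTop.map (iSMap (srcF (C := C)))).hom :=
  realization_ext fun n x v => by
    refine ((homotopy C).toPaths_zero x v).trans ?_
    refine Eq.trans ?_ (map_pt (iSMap srcF) x v).symm
    refine congr_arg (fun y => pt y v) (Subtype.ext ?_)
    refine CategoryTheory.Functor.ext (fun a => rfl) (fun a b f => ?_)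
    refine Eq.trans (Category.comp_id _) ?_
    exact ((Category.id_comp _).trans (Category.comp_id _)).symm

lemma paths_zero (γ : K (IsoArr C)) : paths γ 0 = kMap srcF γ := by
  ext s
  exact congr_arg (fun f => f (γ s)) toPaths_zero

lemma toPaths_one : (ContinuousMap.mk (fun x => (homotopy C).toPaths x 1)) =
    (SSet.toTop.map (iSMap (tgtF (C := C)))).hom :=
  realization_ext fun n x v => by
    refine ((homotopy C).toPaths_one x v).trans ?_
    refine Eq.trans ?_ (map_pt (iSMap tgtF) x v).symm
    refine congr_arg (fun y => pt y v) (Subtype.ext ?_)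
    refine CategoryTheory.Functor.ext (fun a => rfl) (fun a b f => ?_)
    refine Eq.trans (Category.comp_id _) ?_
    exact ((Category.id_comp _).trans (Category.comp_id _)).symm

lemma paths_one (γ : K (IsoArr C)) : paths γ 1 = kMap tgtF γ := by
  ext s
  exact congr_arg (fun f => f (γ s)) toPaths_one

end IsoArr

/-- The category of automorphisms `Aut_C` of `C`. -/
structure AutCat (C : Type (u + 1)) [Category.{u} C] where
  base : C
  aut : base ≅ base

namespace AutCat

variable {C : Type (u + 1)} [Category.{u} C]

/-- The morphisms of `C` that commute with the automorphisms. -/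
@[ext]
structure Hom (a b : AutCat C) where
  f : a.base ⟶ b.base
  w : f ≫ b.aut.hom = a.aut.hom ≫ f

instance : Category (AutCat C) where
  Hom := Hom
  id a := ⟨𝟙 _, by simp⟩
  comp f g := ⟨f.f ≫ g.f, by
    rw [Category.assoc, g.w, ← Category.assoc, f.w, Category.assoc]⟩
  id_comp _ := Hom.ext (Category.id_comp _)
  comp_id _ := Hom.ext (Category.comp_id _)
  assoc _ _ _ := Hom.ext (Category.assoc _ _ _)

variable [KCat C]

instance : KCat (AutCat C) where
  zero := ⟨KCat.zero, Iso.refl _⟩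
  isZero :=
    { unique_to := fun _ => ⟨⟨⟨⟨KCat.isZero.to_ _, KCat.isZero.eq_of_src _ _⟩⟩,
        fun _ => Hom.ext (KCat.isZero.eq_of_src _ _)⟩⟩
      unique_from := fun _ => ⟨⟨⟨⟨KCat.isZero.from_ _, KCat.isZero.eq_of_tgt _ _⟩⟩,
        fun _ => Hom.ext (KCat.isZero.eq_of_tgt _ _)⟩⟩ }
  cofSeq f g := KCat.cofSeq f.f g.f
  cofSeq_left X := KCat.cofSeq_of_src (KCat.cofSeq_left X.base)
  cofSeq_right X := KCat.cofSeq_of_tgt (KCat.cofSeq_right X.base)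

lemma eq_zero {X : C} (hX : X = KCat.zero) (e : X ≅ X) : (⟨X, e⟩ : AutCat C) = KCat.zero := by
  subst hX
  have : e = Iso.refl _ := Iso.ext (KCat.isZero.eq_of_src _ _)
  rw [this]
  rfl

variable (C) in
/-- The inclusion of the automorphisms into the isomorphisms. -/
def toIsoArr : ExactFunctor (AutCat C) (IsoArr C) where
  obj a := ⟨a.base, a.base, a.aut⟩
  map f := ⟨f.f, f.f, f.w⟩
  map_zero := rfl
  map_cofSeq _ _ h := ⟨h, h⟩

variable (C) in
/-- The forgetful functor. -/
def forget : ExactFunctor (AutCat C) C where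
  obj a := a.base
  map f := f.f
  map_zero := rfl
  map_cofSeq _ _ h := h

variable (C) in
/-- The coassembly map `c : K(Aut_C) → LK(C)`. -/
noncomputable def coassembly : C(K (AutCat C), FreeLoop (K C)) where
  toFun γ := ⟨IsoArr.paths (kMap (toIsoArr C) γ), by
    rw [IsoArr.paths_zero, IsoArr.paths_one, kMap_comp, kMap_comp]
    rfl⟩
  continuous_toFun := by
    refine Continuous.subtype_mk ?_ _
    exact (IsoArr.paths.comp (kMap (toIsoArr C))).continuous

end AutCat

end iso

section modules

/-! ### Finitely generated projective right modules -/

open scoped TensorProduct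

/-- Finitely generated projective right `R`-modules. -/
structure FGP (R : Type u) [Ring R] where
  carrier : Type u
  [addCommGroup : AddCommGroup carrier]
  [module : Module Rᵐᵒᵖ carrier]
  [finite : Module.Finite Rᵐᵒᵖ carrier]
  [projective : Module.Projective Rᵐᵒᵖ carrier]

attribute [instance] FGP.addCommGroup FGP.module FGP.finite FGP.projective

namespace FGP

variable {R : Type u} [Ring R]

instance : CoeSort (FGP R) (Type u) := ⟨FGP.carrier⟩

/-- The category `P(R)`; its morphisms are the linear maps. -/
instance : Category (FGP R) where
  Hom P Q := P →ₗ[Rᵐᵒᵖ] Q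
  id _ := LinearMap.id
  comp f g := g.comp f

/-- A morphism of `P(R)` as a linear map. -/
def lin {P Q : FGP R} (f : P ⟶ Q) : P →ₗ[Rᵐᵒᵖ] Q := f

/-- The distinguished zero object is the module with one element. A cofibration `P ↣ Q` is an
injective map with projective cokernel; so `P ⟶ Q ⟶ P'` is a cofibration followed by its quotient
if and only if `0 → P → Q → P' → 0` is exact (`P'` is projective as an object of `P(R)`). -/
instance : KCat (FGP R) where
  zero := ⟨PUnit⟩
  isZero :=
    { unique_to := fun P => ⟨⟨⟨(0 : PUnit.{u + 1} →ₗ[Rᵐᵒᵖ] P)⟩, fun f =>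
        LinearMap.ext fun x => (map_zero (lin f))⟩⟩
      unique_from := fun P => ⟨⟨⟨(0 : P →ₗ[Rᵐᵒᵖ] PUnit.{u + 1})⟩, fun f => LinearMap.ext fun x => rfl⟩⟩ }
  cofSeq f g := Function.Injective (lin f) ∧ Function.Exact (lin f) (lin g) ∧
    Function.Surjective (lin g)
  cofSeq_left P := ⟨fun _ _ _ => rfl, fun y =>
    ⟨fun h => ⟨PUnit.unit, (map_zero (lin _)).trans (Eq.symm h)⟩,
      fun ⟨x, h⟩ => h.symm.trans (map_zero (lin _))⟩, fun y => ⟨y, rfl⟩⟩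
  cofSeq_right P := ⟨fun _ _ h => h, fun y => ⟨fun _ => ⟨y, rfl⟩, fun _ => rfl⟩,
    fun _ => ⟨0, rfl⟩⟩

/-- An invertible endomorphism as an automorphism in `P(R)`. -/
def unitIso {P : FGP R} (e : (Module.End Rᵐᵒᵖ P)ˣ) : P ≅ P where
  hom := e.val
  inv := e.inv
  hom_inv_id := e.inv_val
  inv_hom_id := e.val_inv

end FGP

/-! ### Extension of scalars -/

section Ext

variable {A B C : Type u} [Ring A] [Ring B] [Ring C] (φ : A →+* B)

section module

variable (P : Type u) [AddCommGroup P] [Module Aᵐᵒᵖ P]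

/-- The relations `p a ⊗ b = p ⊗ φ(a) b`, where `p ⊗ b` is written with the factors exchanged. -/
def tensorRel : Submodule Bᵐᵒᵖ (B ⊗[ℤ] P) :=
  Submodule.span Bᵐᵒᵖ (Set.range fun x : A × B × P =>
    (φ x.1 * x.2.1) ⊗ₜ[ℤ] x.2.2 - x.2.1 ⊗ₜ[ℤ] (MulOpposite.op x.1 • x.2.2))

/-- The right `B`-module `P ⊗_A B`. -/
abbrev Tensor : Type u := (B ⊗[ℤ] P) ⧸ tensorRel φ P

namespace Tensor

/-- The map `p ↦ p ⊗ 1`. -/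
def ι : P →+ Tensor φ P :=
  (tensorRel φ P).mkQ.toAddMonoidHom.comp (TensorProduct.mk ℤ B P 1).toAddMonoidHom

variable {P}

lemma mk_tmul (b : B) (p : P) :
    (tensorRel φ P).mkQ (b ⊗ₜ[ℤ] p) = MulOpposite.op b • ι φ P p := by
  show _ = MulOpposite.op b • (tensorRel φ P).mkQ (1 ⊗ₜ[ℤ] p)
  rw [← map_smul, TensorProduct.smul_tmul']
  simp

lemma ι_smul (a : A) (p : P) :
    ι φ P (MulOpposite.op a • p) = MulOpposite.op (φ a) • ι φ P p := by
  rw [← mk_tmul]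
  have h : (φ a * 1) ⊗ₜ[ℤ] p - (1 : B) ⊗ₜ[ℤ] (MulOpposite.op a • p) ∈ tensorRel φ P :=
    Submodule.subset_span ⟨(a, 1, p), rfl⟩
  have h2 := (Submodule.Quotient.eq (tensorRel φ P)).2 h
  rw [mul_one] at h2
  exact h2.symm

variable {N : Type*} [AddCommGroup N] [Module Bᵐᵒᵖ N]

variable {φ} in
/-- The universal property of `P ⊗_A B`. -/
def lift (g : P →+ N) (hg : ∀ (a : A) p, g (MulOpposite.op a • p) = MulOpposite.op (φ a) • g p) :
    Tensor φ P →ₗ[Bᵐᵒᵖ] N :=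
  (tensorRel φ P).liftQ
    (TensorProduct.AlgebraTensorModule.lift
      { toFun := fun b => MulOpposite.op b • g.toIntLinearMap
        map_add' := fun b c => by rw [MulOpposite.op_add, add_smul]
        map_smul' := fun c b => by
          rw [RingHom.id_apply, smul_smul]
          rfl })
    (by
      rw [tensorRel, Submodule.span_le]
      rintro _ ⟨⟨a, b, p⟩, rfl⟩
      simp [hg, smul_smul])

variable {φ} in
lemma lift_ι (g : P →+ N) (hg) (p : P) : lift (φ := φ) g hg (ι φ P p) = g p := by
  show (MulOpposite.op (1 : B) • g.toIntLinearMap) p = g p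
  simp

variable {φ} in
lemma hom_ext {f g : Tensor φ P →ₗ[Bᵐᵒᵖ] N} (h : ∀ p, f (ι φ P p) = g (ι φ P p)) : f = g := by
  refine LinearMap.ext fun x => ?_
  obtain ⟨x, rfl⟩ := (tensorRel φ P).mkQ_surjective x
  induction x using TensorProduct.induction_on with
  | zero => simp
  | tmul b p => rw [mk_tmul, map_smul, map_smul, h]
  | add x y hx hy => rw [map_add, map_add, map_add, hx, hy]

variable (P) in
lemma span_ι : Submodule.span Bᵐᵒᵖ (Set.range (ι φ P)) = ⊤ := by
  rw [eq_top_iff]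
  rintro x -
  obtain ⟨x, rfl⟩ := (tensorRel φ P).mkQ_surjective x
  induction x using TensorProduct.induction_on with
  | zero => simp
  | tmul b p => rw [mk_tmul]; exact Submodule.smul_mem _ _ (Submodule.subset_span ⟨p, rfl⟩)
  | add x y hx hy => rw [map_add]; exact Submodule.add_mem _ hx hy

instance [Module.Finite Aᵐᵒᵖ P] : Module.Finite Bᵐᵒᵖ (Tensor φ P) := by
  classical
  obtain ⟨s, hs⟩ := (Module.Finite.fg_top : (⊤ : Submodule Aᵐᵒᵖ P).FG)
  refine ⟨⟨s.image (ι φ P), ?_⟩⟩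
  rw [eq_top_iff, ← span_ι φ P, Submodule.span_le]
  rintro _ ⟨p, rfl⟩
  have hp : p ∈ Submodule.span Aᵐᵒᵖ (s : Set P) := by rw [hs]; trivial
  induction hp using Submodule.span_induction with
  | mem x hx => exact Submodule.subset_span (by simpa using ⟨x, hx, rfl⟩)
  | zero => simp
  | add x y _ _ hx hy => rw [map_add]; exact Submodule.add_mem _ hx hy
  | smul a x _ hx =>
    have : ι φ P (a • x) = MulOpposite.op (φ a.unop) • ι φ P x := ι_smul φ a.unop x
    rw [this]
    exact Submodule.smul_mem _ _ hx

instance [Module.Projective Aᵐᵒᵖ P] : Module.Projective Bᵐᵒᵖ (Tensor φ P) := by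
  classical
  refine Module.Projective.of_lifting_property'' fun f hf => ?_
  let _ : Module Aᵐᵒᵖ (Tensor φ P →₀ Bᵐᵒᵖ) := Module.compHom _ (RingHom.op φ)
  let _ : Module Aᵐᵒᵖ (Tensor φ P) := Module.compHom _ (RingHom.op φ)
  let f' : (Tensor φ P →₀ Bᵐᵒᵖ) →ₗ[Aᵐᵒᵖ] Tensor φ P :=
    { toFun := f, map_add' := map_add f, map_smul' := fun a x => map_smul f (RingHom.op φ a) x }
  let i' : P →ₗ[Aᵐᵒᵖ] Tensor φ P :=
    { toFun := ι φ P, map_add' := map_add _, map_smul' := fun a x => ι_smul φ a.unop x }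
  obtain ⟨h, hh⟩ := Module.projective_lifting_property f' i' hf
  refine ⟨lift h.toAddMonoidHom fun a p => h.map_smul (MulOpposite.op a) p, hom_ext fun p => ?_⟩
  exact (congr_arg f (lift_ι _ _ p)).trans (LinearMap.congr_fun hh p)

/-- The functoriality of `P ⊗_A B` in `P`. -/
def map {Q : Type u} [AddCommGroup Q] [Module Aᵐᵒᵖ Q] (f : P →ₗ[Aᵐᵒᵖ] Q) :
    Tensor φ P →ₗ[Bᵐᵒᵖ] Tensor φ Q :=
  lift ((ι φ Q).comp f.toAddMonoidHom) fun a p => by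
    show ι φ Q (f (MulOpposite.op a • p)) = MulOpposite.op (φ a) • ι φ Q (f p)
    rw [map_smul, ι_smul]

lemma map_ι {Q : Type u} [AddCommGroup Q] [Module Aᵐᵒᵖ Q] (f : P →ₗ[Aᵐᵒᵖ] Q) (p : P) :
    map φ f (ι φ P p) = ι φ Q (f p) :=
  lift_ι _ _ _

end Tensor

end module

instance (R : Type u) [Ring R] : Preadditive (FGP R) where
  homGroup P Q := inferInstanceAs (AddCommGroup (P →ₗ[Rᵐᵒᵖ] Q))
  add_comp _ _ _ f f' g := LinearMap.comp_add f f' g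
  comp_add _ _ _ f g g' := LinearMap.add_comp f g' g

lemma FGP.cofSeq_iff_split {R : Type u} [Ring R] {P Q N : FGP R} (f : P ⟶ Q) (g : Q ⟶ N) :
    KCat.cofSeq f g ↔ ∃ (r : Q ⟶ P) (s : N ⟶ Q),
      f ≫ r = 𝟙 P ∧ s ≫ g = 𝟙 N ∧ f ≫ g = 0 ∧ r ≫ f + g ≫ s = 𝟙 Q := by
  constructor
  · rintro ⟨hf, hfg, hg⟩
    obtain ⟨s, hs⟩ := Module.projective_lifting_property (lin g) LinearMap.id hg
    have hs' : ∀ x, lin g (s x) = x := fun x => LinearMap.congr_fun hs x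
    have hk : ∀ y : Q, ∃ x, lin f x = y - s (lin g y) := fun y =>
      (hfg _).1 (by rw [map_sub, hs', sub_self])
    choose r hr using hk
    let r' : Q →ₗ[Rᵐᵒᵖ] P :=
      { toFun := r
        map_add' := fun x y => hf (by rw [map_add, hr, hr, hr, map_add, map_add]; abel)
        map_smul' := fun c x => hf (by
          rw [map_smul, hr, hr, map_smul, map_smul, RingHom.id_apply, smul_sub]) }
    refine ⟨r', s, ?_, hs, ?_, ?_⟩
    · refine LinearMap.ext fun x => hf ?_
      show lin f (r (lin f x)) = lin f x
      rw [hr, (hfg _).2 ⟨x, rfl⟩, map_zero, sub_zero]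
    · exact LinearMap.ext fun x => (hfg _).2 ⟨x, rfl⟩
    · refine LinearMap.ext fun y => ?_
      show lin f (r y) + s (lin g y) = y
      rw [hr, sub_add_cancel]
  · rintro ⟨r, s, h1, h2, h3, h4⟩
    have h1' : ∀ x, lin r (lin f x) = x := fun x => LinearMap.congr_fun h1 x
    have h2' : ∀ x, lin g (lin s x) = x := fun x => LinearMap.congr_fun h2 x
    have h3' : ∀ x, lin g (lin f x) = 0 := fun x => LinearMap.congr_fun h3 x
    have h4' : ∀ x, lin f (lin r x) + lin s (lin g x) = x := fun x => LinearMap.congr_fun h4 x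
    refine ⟨fun x y h => by rw [← h1' x, h, h1'], fun y => ⟨fun h => ⟨lin r y, ?_⟩, ?_⟩,
      fun z => ⟨_, h2' z⟩⟩
    · have := h4' y
      rwa [h, map_zero, add_zero] at this
    · rintro ⟨x, rfl⟩
      exact h3' x

/-- The functor `P ↦ P ⊗_A B`, before it is normalized to preserve the zero object on the nose. -/
def extPre : FGP A ⥤ FGP B where
  obj P := ⟨Tensor φ P⟩
  map f := Tensor.map φ (FGP.lin f)
  map_id P := Tensor.hom_ext fun p => Tensor.map_ι φ _ p
  map_comp f g := Tensor.hom_ext fun p => by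
    refine (Tensor.map_ι φ _ p).trans (Eq.symm ?_)
    refine (congr_arg (Tensor.map φ (FGP.lin g)) (Tensor.map_ι φ _ p)).trans ?_
    exact Tensor.map_ι φ _ _

instance : (extPre φ).Additive where
  map_add {P Q f g} := Tensor.hom_ext fun p => by
    refine (Tensor.map_ι φ _ p).trans (Eq.symm ?_)
    refine (congr_arg₂ (· + ·) (Tensor.map_ι φ (FGP.lin f) p)
      (Tensor.map_ι φ (FGP.lin g) p)).trans ?_
    exact (map_add (Tensor.ι φ Q) _ _).symm

lemma extPre_zero : Limits.IsZero ((extPre φ).obj KCat.zero) := by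
  rw [Limits.IsZero.iff_id_eq_zero]
  exact Tensor.hom_ext fun p => map_zero (Tensor.ι φ _)

open Classical in
/-- The module `P ⊗_A B`, normalized so that the chosen zero object goes to the chosen one. -/
noncomputable def extObj (P : FGP A) : FGP B :=
  if P = KCat.zero then KCat.zero else (extPre φ).obj P

open Classical in
/-- The normalization does not change the isomorphism class. -/
noncomputable def extObjIso (P : FGP A) : (extPre φ).obj P ≅ extObj φ P :=
  if h : P = KCat.zero then
    (h ▸ extPre_zero φ : Limits.IsZero ((extPre φ).obj P)).iso
      (by rw [extObj, if_pos h]; exact KCat.isZero)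
  else eqToIso (if_neg h).symm

/-- Extension of scalars `P ↦ P ⊗_A B` as a functor. -/
noncomputable def extFunctor : FGP A ⥤ FGP B := (extPre φ).copyObj (extObj φ) (extObjIso φ)

/-- The comparison with `P ⊗_A B`. -/
noncomputable def extComp : extPre φ ≅ extFunctor φ := (extPre φ).isoCopyObj _ _

instance : (extFunctor φ).Additive := Functor.additive_of_iso (extComp φ)

/-- Extension of scalars as an exact functor. -/
noncomputable def ext : ExactFunctor (FGP A) (FGP B) where
  toFunctor := extFunctor φ
  map_zero := if_pos rfl
  map_cofSeq f g h := by
    rw [FGP.cofSeq_iff_split] at h ⊢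
    obtain ⟨r, s, h1, h2, h3, h4⟩ := h
    refine ⟨(extFunctor φ).map r, (extFunctor φ).map s, ?_, ?_, ?_, ?_⟩
    · rw [← Functor.map_comp, h1, CategoryTheory.Functor.map_id]
    · rw [← Functor.map_comp, h2, CategoryTheory.Functor.map_id]
    · rw [← Functor.map_comp, h3, Functor.map_zero]
    · rw [← Functor.map_comp, ← Functor.map_comp, ← Functor.map_add, h4, CategoryTheory.Functor.map_id]

section trans

variable {φ} {ψ : B →+* C} {χ : A →+* C} (h : ψ.comp φ = χ) (P : FGP A)

/-- The map `(p ⊗ b) ⊗ c ↦ p ⊗ ψ(b) c`. -/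
def transHom : Tensor ψ (Tensor φ P) →ₗ[Cᵐᵒᵖ] Tensor χ P :=
  let _ : Module Bᵐᵒᵖ (Tensor χ P) := Module.compHom _ (RingHom.op ψ)
  let f₀ : Tensor φ P →ₗ[Bᵐᵒᵖ] Tensor χ P := Tensor.lift (Tensor.ι χ P) fun a p => by
    have hs : ψ (φ a) = χ a := RingHom.congr_fun h a
    rw [Tensor.ι_smul, ← hs]; rfl
  Tensor.lift f₀.toAddMonoidHom fun b x => f₀.map_smul (MulOpposite.op b) x

/-- The map `p ⊗ c ↦ (p ⊗ 1) ⊗ c`. -/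
def transInv : Tensor χ P →ₗ[Cᵐᵒᵖ] Tensor ψ (Tensor φ P) :=
  Tensor.lift ((Tensor.ι ψ _).comp (Tensor.ι φ P)) fun a p => by
    have hs : ψ (φ a) = χ a := RingHom.congr_fun h a
    show Tensor.ι ψ _ (Tensor.ι φ P _) = _ • Tensor.ι ψ _ (Tensor.ι φ P p)
    rw [Tensor.ι_smul, Tensor.ι_smul, hs]

lemma transHom_ι (p : P) : transHom h P (Tensor.ι ψ _ (Tensor.ι φ P p)) = Tensor.ι χ P p := by
  let _ : Module Bᵐᵒᵖ (Tensor χ P) := Module.compHom _ (RingHom.op ψ)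
  unfold transHom
  refine (Tensor.lift_ι _ _ _).trans ?_
  exact Tensor.lift_ι (φ := φ) (N := Tensor χ P) (Tensor.ι χ P) (fun a p => by
    have hs : ψ (φ a) = χ a := RingHom.congr_fun h a
    rw [Tensor.ι_smul, ← hs]; rfl) p

lemma transInv_ι (p : P) : transInv h P (Tensor.ι χ P p) = Tensor.ι ψ _ (Tensor.ι φ P p) :=
  Tensor.lift_ι _ _ _

variable (φ ψ) in
lemma trans_hom_ext {P : FGP A} {N : Type u} [AddCommGroup N] [Module Cᵐᵒᵖ N]
    {f g : Tensor ψ (Tensor φ P) →ₗ[Cᵐᵒᵖ] N}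
    (h : ∀ p, f (Tensor.ι ψ _ (Tensor.ι φ P p)) = g (Tensor.ι ψ _ (Tensor.ι φ P p))) : f = g := by
  refine Tensor.hom_ext fun x => ?_
  have hx : x ∈ Submodule.span Bᵐᵒᵖ (Set.range (Tensor.ι φ P)) := by
    rw [Tensor.span_ι]; trivial
  induction hx using Submodule.span_induction with
  | mem x hx => obtain ⟨p, rfl⟩ := hx; exact h p
  | zero => simp
  | add x y _ _ hx hy => rw [map_add, map_add, map_add, hx, hy]
  | smul b x _ hx =>
    have : Tensor.ι ψ (Tensor φ P) (b • x) = MulOpposite.op (ψ b.unop) • Tensor.ι ψ _ x :=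
      Tensor.ι_smul ψ b.unop x
    rw [this, map_smul, map_smul, hx]

/-- The canonical isomorphism `(P ⊗_A B) ⊗_B C ≅ P ⊗_A C`. -/
def tensorTrans : (extPre φ ⋙ extPre ψ).obj P ≅ (extPre χ).obj P where
  hom := transHom h P
  inv := transInv h P
  hom_inv_id := trans_hom_ext φ ψ fun p => by
    refine (congr_arg (transInv h P) (transHom_ι h P p)).trans ?_
    exact transInv_ι h P p
  inv_hom_id := Tensor.hom_ext fun p => by
    refine (congr_arg (transHom h P) (transInv_ι h P p)).trans ?_
    exact transHom_ι h P p

/-- The canonical isomorphism `(P ⊗_A B) ⊗_B C ≅ P ⊗_A C` is natural in `P`. -/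
def tensorTransNat : extPre φ ⋙ extPre ψ ≅ extPre χ :=
  NatIso.ofComponents (tensorTrans h) fun {P Q} f => trans_hom_ext φ ψ fun p => by
    have h1 : (extPre ψ).map ((extPre φ).map f) = Tensor.map ψ (Tensor.map φ (FGP.lin f)) := rfl
    have h2 : Tensor.map ψ (Tensor.map φ (FGP.lin f)) (Tensor.ι ψ _ (Tensor.ι φ P p)) =
        Tensor.ι ψ _ (Tensor.ι φ Q (FGP.lin f p)) := by
      rw [Tensor.map_ι, Tensor.map_ι]
    refine (congr_arg (transHom h Q) h2).trans ((transHom_ι h Q _).trans (Eq.symm ?_))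
    refine (congr_arg (Tensor.map χ (FGP.lin f)) (transHom_ι h P p)).trans ?_
    exact Tensor.map_ι χ _ p

/-- The canonical isomorphism `(P ⊗_A B) ⊗_B C ≅ P ⊗_A C` for the normalized functors. -/
noncomputable def extTrans : extFunctor φ ⋙ extFunctor ψ ≅ extFunctor χ :=
  (NatIso.hcomp (extComp φ) (extComp ψ)).symm ≪≫ tensorTransNat h ≪≫ extComp χ

end trans

end Ext

/-- Two exact functors that are naturally isomorphic, as one functor to the category of
isomorphisms. -/
def isoFunctor {C D : Type (u + 1)} [Category.{u} C] [KCat C] [Category.{u} D] [KCat D]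
    (F G : ExactFunctor C D) (e : F.toFunctor ≅ G.toFunctor) : ExactFunctor C (IsoArr D) where
  obj X := ⟨F.obj X, G.obj X, e.app X⟩
  map f := ⟨F.map f, G.map f, e.hom.naturality f⟩
  map_id X := IsoArr.Hom.ext (F.map_id X) (G.map_id X)
  map_comp f g := IsoArr.Hom.ext (F.map_comp f g) (G.map_comp f g)
  map_zero := IsoArr.eq_zero F.map_zero G.map_zero _
  map_cofSeq f g h := ⟨F.map_cofSeq f g h, G.map_cofSeq f g h⟩

end modules

section localization

open scoped Polynomial

/-! ### Localizations at central elements -/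

/-- A multiplicative set of central elements. -/
structure CentralSubmonoid (R : Type u) [Ring R] extends Submonoid R where
  central : ∀ p ∈ carrier, p ∈ Subring.center R

namespace CentralSubmonoid

variable {R : Type u} [Ring R] (M : CentralSubmonoid R)

instance : OreLocalization.OreSet M.toSubmonoid where
  ore_right_cancel r₁ r₂ s h := ⟨s, by
    have hs := Subring.mem_center_iff.1 (M.central s s.2)
    rw [← hs, ← hs, h]⟩
  oreNum r _ := r
  oreDenom _ s := s
  ore_eq r s := (Subring.mem_center_iff.1 (M.central s s.2) r).symm

/-- The localization `R_M`, as a ring of left fractions. -/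
abbrev Loc : Type u := OreLocalization M.toSubmonoid R

/-- The canonical map `R → R_M`. -/
abbrev toLoc : R →+* M.Loc := OreLocalization.numeratorRingHom

lemma toLoc_isUnit {p : R} (hp : p ∈ M.toSubmonoid) : IsUnit (M.toLoc p) :=
  OreLocalization.numerator_isUnit (⟨p, hp⟩ : M.toSubmonoid)

lemma exists_frac (x : M.Loc) : ∃ (r : R) (s : M.toSubmonoid),
    M.toLoc s * x = M.toLoc r := by
  induction x using OreLocalization.ind with
  | _ r s =>
    refine ⟨r, s, ?_⟩
    show ((s : R) /ₒ (1 : M.toSubmonoid)) * (r /ₒ s) = r /ₒ 1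
    rw [OreLocalization.oreDiv_mul_char (s : R) r 1 s (1 : R) 1 (by simp)]
    simp

lemma toLoc_central {p : R} (hp : p ∈ Subring.center R) : M.toLoc p ∈ Subring.center M.Loc := by
  rw [Subring.mem_center_iff] at hp ⊢
  intro x
  obtain ⟨r, s, h⟩ := M.exists_frac x
  apply (M.toLoc_isUnit s.2).mul_left_cancel
  rw [← mul_assoc, h, ← mul_assoc, ← map_mul, ← map_mul, hp r, hp (s : R), map_mul, map_mul,
    mul_assoc, h]

end CentralSubmonoid

/-- A multiplicative set `S ⊂ A[t]` of monic central polynomials that contains `t`. -/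
structure LocSet (A : Type u) [Ring A] extends CentralSubmonoid A[X] where
  monic : ∀ p ∈ carrier, p.Monic
  X_mem : Polynomial.X ∈ carrier

section poly

open Polynomial

variable {A : Type u} [Ring A]

lemma coeff_central {p : A[X]} (hp : p ∈ Subring.center A[X]) (n : ℕ) :
    p.coeff n ∈ Subring.center A := by
  rw [Subring.mem_center_iff] at hp ⊢
  intro a
  rw [← coeff_C_mul, hp, coeff_mul_C]

lemma central_of_coeff {p : A[X]} (hp : ∀ n, p.coeff n ∈ Subring.center A) :
    p ∈ Subring.center A[X] := by
  rw [Subring.mem_center_iff]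
  intro q
  ext n
  rw [coeff_mul, coeff_mul, ← Finset.Nat.sum_antidiagonal_swap]
  exact Finset.sum_congr rfl fun x _ => Subring.mem_center_iff.1 (hp _) _

lemma reverse_central {p : A[X]} (hp : p ∈ Subring.center A[X]) :
    p.reverse ∈ Subring.center A[X] :=
  central_of_coeff fun n => by rw [coeff_reverse]; exact coeff_central hp _

lemma X_central : (X : A[X]) ∈ Subring.center A[X] :=
  Subring.mem_center_iff.2 fun q => (X_mul (p := q)).symm

/-- For a central unit `t` with inverse `t'`, `p̃(t') tᵈ = p(t)`, where `d` is the degree of `p`. -/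
lemma eval₂_reverse_mul {B : Type u} [Ring B] (φ : A →+* B) {t t' : B} (ht : t * t' = 1)
    (hc : Commute t t') (p : A[X]) :
    eval₂ φ t' p.reverse * t ^ p.natDegree = eval₂ φ t p := by
  rw [eval₂_eq_sum_range' φ (Nat.lt_succ_of_le (reverse_natDegree_le p)), eval₂_eq_sum_range,
    Finset.sum_mul, ← Finset.sum_range_reflect]
  refine Finset.sum_congr rfl fun i hi => ?_
  have hi' : i ≤ p.natDegree := Nat.le_of_lt_succ (Finset.mem_range.1 hi)
  have h1 : p.natDegree + 1 - 1 - i = p.natDegree - i := by omega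
  have h2 : p.natDegree - (p.natDegree - i) = i := by omega
  have h3 : t' ^ (p.natDegree - i) * t ^ p.natDegree = t ^ i := by
    obtain ⟨k, hk⟩ := Nat.exists_eq_add_of_le hi'
    have : p.natDegree - i = k := by omega
    rw [this, hk, add_comm i k, pow_add, ← mul_assoc, ← hc.symm.mul_pow, hc.symm.eq, ht, one_pow,
      one_mul]
  rw [h1, coeff_reverse, revAt_le (by omega), h2, mul_assoc, h3]

end poly

namespace LocSet

open Polynomial

variable {A : Type u} [Ring A] (S : LocSet A)

/-- The multiplicative set `T = {p̃ | p ∈ S}`, where `p̃(t) = t^{deg p} p(t⁻¹)`. -/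
def T : CentralSubmonoid A[X] where
  carrier := reverse '' S.carrier
  one_mem' := ⟨1, S.one_mem', by rw [← C_1, reverse_C]⟩
  mul_mem' := by
    rintro _ _ ⟨p, hp, rfl⟩ ⟨q, hq, rfl⟩
    refine ⟨p * q, S.mul_mem' hp hq, ?_⟩
    rcases subsingleton_or_nontrivial A with h | h
    · exact Subsingleton.elim _ _
    · refine reverse_mul ?_
      rw [(S.monic p hp).leadingCoeff, (S.monic q hq).leadingCoeff, mul_one]
      exact one_ne_zero
  central := by
    rintro _ ⟨p, hp, rfl⟩
    exact reverse_central (S.central p hp)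

/-- The map `A → A[t]_S`. -/
noncomputable def toS : A →+* S.Loc := S.toLoc.comp C

/-- The map `A → A[t]_T`. -/
noncomputable def toT : A →+* S.T.Loc := S.T.toLoc.comp C

/-- The element `t` of `A[t]_S`. -/
noncomputable def tS : S.Locˣ := OreLocalization.numeratorUnit (⟨X, S.X_mem⟩ : S.toSubmonoid)

/-- The element `t` of `A[t]_T`. -/
noncomputable def tT : S.T.Loc := S.T.toLoc X

lemma tS_val : (S.tS : S.Loc) = S.toLoc X := rfl

lemma tS_central : (S.tS : S.Loc) ∈ Subring.center S.Loc := S.toLoc_central X_central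

lemma tS_inv_central : (↑S.tS⁻¹ : S.Loc) ∈ Subring.center S.Loc := by
  rw [Subring.mem_center_iff]
  intro x
  have h := Subring.mem_center_iff.1 S.tS_central x
  rw [Units.mul_inv_eq_iff_eq_mul, mul_assoc, h, ← mul_assoc, Units.inv_mul, one_mul]

lemma tT_central : S.tT ∈ Subring.center S.T.Loc := S.T.toLoc_central X_central

/-- The ring map `A[t] → A[t]_S` with `t ↦ t⁻¹`. -/
noncomputable def evalInv : A[X] →+* S.Loc :=
  eval₂RingHom' S.toS (↑S.tS⁻¹ : S.Loc) fun _ => Subring.mem_center_iff.1 S.tS_inv_central _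

lemma eval₂_tS (p : A[X]) : eval₂ S.toS (S.tS : S.Loc) p = S.toLoc p := by
  rw [tS_val, toS, ← hom_eval₂ p C S.toLoc X, eval₂_C_X]

lemma evalInv_isUnit {p : A[X]} (hp : p ∈ S.T.toSubmonoid) : IsUnit (S.evalInv p) := by
  obtain ⟨q, hq, rfl⟩ := hp
  have h := eval₂_reverse_mul S.toS (S.tS.mul_inv) (Subring.mem_center_iff.1 S.tS_inv_central _) q
  rw [eval₂_tS] at h
  have h2 : S.evalInv q.reverse = S.toLoc q * ↑(S.tS ^ q.natDegree)⁻¹ := by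
    rw [Units.eq_mul_inv_iff_mul_eq, Units.val_pow_eq_pow_val]
    exact h
  rw [h2]
  exact (S.toLoc_isUnit hq).mul (Units.isUnit _)

/-- The ring map `A[t]_T → A[t]_S` with `t ↦ t⁻¹`. -/
noncomputable def inversion : S.T.Loc →+* S.Loc :=
  OreLocalization.universalHom S.evalInv
    (IsUnit.liftRight (S.evalInv.toMonoidHom.comp S.T.toSubmonoid.subtype)
      fun p => S.evalInv_isUnit p.2)
    fun _ => rfl

lemma inversion_toLoc (p : A[X]) : S.inversion (S.T.toLoc p) = S.evalInv p :=
  OreLocalization.universalHom_commutes _ _ _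

lemma inversion_tT : S.inversion S.tT = (↑S.tS⁻¹ : S.Loc) := by
  rw [tT, inversion_toLoc]
  exact eval₂_X _ _

lemma inversion_comp_toT : S.inversion.comp S.toT = S.toS := by
  refine RingHom.ext fun a => ?_
  show S.inversion (S.T.toLoc (C a)) = _
  rw [inversion_toLoc]
  exact eval₂_C _ _

end LocSet

/-! ### Endomorphisms and automorphisms of modules -/

section central

variable {R : Type u} [Ring R]

variable (P : Type u) [AddCommGroup P] [Module Rᵐᵒᵖ P] in
/-- Multiplication by a central element, as an endomorphism of a right module. -/
def cmul : Subring.center R →+* Module.End Rᵐᵒᵖ P where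
  toFun c :=
    { toFun := fun x => MulOpposite.op (c : R) • x
      map_add' := smul_add _
      map_smul' := fun r x => by
        have h := Subring.mem_center_iff.1 c.2 r.unop
        rw [RingHom.id_apply, smul_smul, smul_smul]
        exact congr_arg (fun y => MulOpposite.op y • x) h }
  map_one' := LinearMap.ext fun x => one_smul _ x
  map_mul' c d := LinearMap.ext fun x => by
    show MulOpposite.op ((c * d : Subring.center R) : R) • x = _
    rw [mul_comm, Subring.coe_mul, MulOpposite.op_mul, mul_smul]
    rfl
  map_zero' := LinearMap.ext fun x => zero_smul _ x
  map_add' c d := LinearMap.ext fun x => add_smul (MulOpposite.op (c : R)) (MulOpposite.op (d : R)) x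

lemma cmul_natural {P Q : Type u} [AddCommGroup P] [Module Rᵐᵒᵖ P] [AddCommGroup Q]
    [Module Rᵐᵒᵖ Q] (c : Subring.center R) (f : P →ₗ[Rᵐᵒᵖ] Q) :
    f ∘ₗ cmul P c = cmul Q c ∘ₗ f :=
  LinearMap.ext fun x => f.map_smul (MulOpposite.op (c : R)) x

lemma isUnit_center {c : Subring.center R} (h : IsUnit (c : R)) : IsUnit c := by
  obtain ⟨v, hv⟩ := h
  refine isUnit_iff_exists_inv.2 ⟨⟨↑v⁻¹, Subring.mem_center_iff.2 fun x => ?_⟩, Subtype.ext ?_⟩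
  · have hc := Subring.mem_center_iff.1 c.2 x
    rw [← hv] at hc
    rw [Units.mul_inv_eq_iff_eq_mul, mul_assoc, hc, ← mul_assoc, Units.inv_mul, one_mul]
  · show (c : R) * ↑v⁻¹ = 1
    rw [← hv, Units.mul_inv]

lemma exists_pow_sub {E : Type u} [Ring E] {x y : E} (h : Commute x y) (n : ℕ) :
    ∃ k, Commute x k ∧ Commute y k ∧ x ^ n - y ^ n = (x - y) * k :=
  ⟨∑ i ∈ Finset.range n, x ^ i * y ^ (n - 1 - i),
    Commute.sum_right _ _ _ fun _ _ =>
      ((Commute.refl x).pow_right _).mul_right (h.pow_right _),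
    Commute.sum_right _ _ _ fun _ _ =>
      (h.symm.pow_right _).mul_right ((Commute.refl y).pow_right _),
    (h.mul_geom_sum₂ n).symm⟩

variable {E : Type u} [Ring E] {d : ℕ} {α : ℕ → E} {G F : E}

lemma isUnit_sub_of_sum (hα : ∀ i x, Commute (α i) x) (hG : ∀ x, Commute G x)
    (h0 : ∑ i ∈ Finset.range (d + 1), α i * F ^ i = 0)
    (hu : IsUnit (∑ i ∈ Finset.range (d + 1), α i * G ^ i)) : IsUnit (G - F) := by
  choose k hk1 hk2 hk3 using fun n => exists_pow_sub (hG F) n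
  have h : (G - F) * ∑ i ∈ Finset.range (d + 1), α i * k i =
      ∑ i ∈ Finset.range (d + 1), α i * G ^ i := by
    rw [← sub_zero (∑ i ∈ Finset.range (d + 1), α i * G ^ i), ← h0, ← Finset.sum_sub_distrib,
      Finset.mul_sum]
    refine Finset.sum_congr rfl fun i _ => ?_
    rw [← mul_sub, hk3, ← mul_assoc, ← mul_assoc, (hα i _).eq]
  have hc : Commute (G - F) (∑ i ∈ Finset.range (d + 1), α i * k i) :=
    Commute.sum_right _ _ _ fun i _ => ((hα i _).symm).mul_right ((hk1 i).sub_left (hk2 i))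
  rw [← h] at hu
  exact (hc.isUnit_mul_iff.1 hu).1

lemma isUnit_one_sub_of_sum (hα : ∀ i x, Commute (α i) x) (hG : ∀ x, Commute G x)
    (h0 : ∑ i ∈ Finset.range (d + 1), α i * F ^ i = 0)
    (hu : IsUnit (∑ i ∈ Finset.range (d + 1), α i * G ^ (d - i))) : IsUnit (1 - G * F) := by
  choose k hk1 hk2 hk3 using fun n => exists_pow_sub (Commute.one_left (G * F)) n
  have h : (1 - G * F) * ∑ i ∈ Finset.range (d + 1), α i * G ^ (d - i) * k i =
      ∑ i ∈ Finset.range (d + 1), α i * G ^ (d - i) := by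
    rw [← sub_zero (∑ i ∈ Finset.range (d + 1), α i * G ^ (d - i)), ← mul_zero (G ^ d), ← h0,
      Finset.mul_sum, Finset.mul_sum, ← Finset.sum_sub_distrib]
    refine Finset.sum_congr rfl fun i hi => ?_
    have hi' : i ≤ d := Nat.le_of_lt_succ (Finset.mem_range.1 hi)
    have h1 : G ^ d * (α i * F ^ i) = α i * G ^ (d - i) * (G * F) ^ i := by
      rw [(hG F).mul_pow, ← mul_assoc, ← (hα i (G ^ d)).eq, mul_assoc, mul_assoc,
        ← mul_assoc (G ^ (d - i)), ← pow_add, Nat.sub_add_cancel hi']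
    have h2 : α i * G ^ (d - i) - α i * G ^ (d - i) * (G * F) ^ i =
        α i * G ^ (d - i) * ((1 - G * F) * k i) := by
      rw [← hk3, one_pow, mul_sub, mul_one]
    have h3 : Commute (α i * G ^ (d - i)) (1 - G * F) :=
      (hα i _).mul_left ((hG _).pow_left _)
    rw [h1, h2, ← mul_assoc, ← h3.eq, mul_assoc]
  have hc : Commute (1 - G * F) (∑ i ∈ Finset.range (d + 1), α i * G ^ (d - i) * k i) :=
    Commute.sum_right _ _ _ fun i _ =>
      (((hα i _).mul_left ((hG _).pow_left _)).symm).mul_right ((hk1 i).sub_left (hk2 i))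
  rw [← h] at hu
  exact (hc.isUnit_mul_iff.1 hu).1

end central

section extEnd

variable {A B : Type u} [Ring A] [Ring B] (φ : A →+* B)

/-- Extension of scalars on endomorphisms, `f ↦ f ⊗ 1`. -/
noncomputable def extEnd (P : FGP A) : Module.End Aᵐᵒᵖ P →+* Module.End Bᵐᵒᵖ ((ext φ).obj P) where
  toFun f := FGP.lin ((ext φ).map (X := P) (Y := P) f)
  map_one' := (ext φ).map_id P
  map_mul' f g := (ext φ).map_comp (X := P) (Y := P) (Z := P) g f
  map_zero' := (extFunctor φ).map_zero P P
  map_add' _ _ := (extFunctor φ).map_add (X := P) (Y := P)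

lemma extEnd_natural {P Q : FGP A} (g : P ⟶ Q) (f : Module.End Aᵐᵒᵖ P) (f' : Module.End Aᵐᵒᵖ Q)
    (h : FGP.lin g ∘ₗ f = f' ∘ₗ FGP.lin g) :
    FGP.lin ((ext φ).map g) ∘ₗ extEnd φ P f = extEnd φ Q f' ∘ₗ FGP.lin ((ext φ).map g) := by
  exact ((ext φ).map_comp (X := P) (Y := P) (Z := Q) f g).symm.trans
    ((congr_arg (fun k : P ⟶ Q => (ext φ).map k) h).trans
      ((ext φ).map_comp (X := P) (Y := Q) (Z := Q) g f'))

/-- Extension of scalars takes multiplication by `a` to multiplication by `φ(a)`. -/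
lemma extEnd_cmul (P : FGP A) (a : Subring.center A) (b : Subring.center B)
    (h : φ a = (b : B)) : extEnd φ P (cmul P a) = cmul ((ext φ).obj P) b := by
  have h1 : (extPre φ).map (X := P) (Y := P) (cmul P a) = cmul (Tensor φ P) b :=
    Tensor.hom_ext fun p => by
      refine (Tensor.map_ι φ (cmul P a) p).trans ?_
      refine (Tensor.ι_smul φ (a : A) p).trans ?_
      rw [h]
      rfl
  have h2 := (extComp φ).hom.naturality (X := P) (Y := P) (cmul P a)
  rw [h1] at h2
  have h3 := cmul_natural b (FGP.lin ((extComp φ).hom.app P))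
  have h4 : (extComp φ).hom.app P ≫ (extFunctor φ).map (X := P) (Y := P) (cmul P a) =
      (extComp φ).hom.app P ≫ (cmul ((ext φ).obj P) b : (ext φ).obj P →ₗ[Bᵐᵒᵖ] (ext φ).obj P) :=
    h2.symm.trans h3
  exact (cancel_epi _).1 h4

end extEnd

section EndS

open Polynomial

variable {A : Type u} [Ring A]

/-- The element `p(f) x = ∑ fⁱ(x) aᵢ`, for `p = ∑ aᵢ tⁱ`. -/
def polyAct {P : Type u} [AddCommGroup P] [Module Aᵐᵒᵖ P] (p : A[X]) (f : Module.End Aᵐᵒᵖ P)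
    (x : P) : P :=
  p.sum fun i a => MulOpposite.op a • (f ^ i) x

/-- The category `End_A^S`: its objects are the pairs `(P, f)` of a finitely generated projective
module and an endomorphism with `p(f) = 0` for some `p ∈ S`. -/
structure EndS (S : LocSet A) where
  base : FGP A
  endo : Module.End Aᵐᵒᵖ base
  torsion : ∃ p ∈ S.carrier, ∀ x, polyAct p endo x = 0

namespace EndS

variable {S : LocSet A}

/-- The morphisms of modules that commute with the endomorphisms. -/
@[ext]
structure Hom (a b : EndS S) where
  f : a.base ⟶ b.base
  w : FGP.lin f ∘ₗ a.endo = b.endo ∘ₗ FGP.lin f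

instance : Category (EndS S) where
  Hom := Hom
  id a := ⟨𝟙 _, rfl⟩
  comp f g := ⟨f.f ≫ g.f, by
    show FGP.lin g.f ∘ₗ (FGP.lin f.f ∘ₗ _) = _
    rw [f.w, ← LinearMap.comp_assoc, g.w]
    rfl⟩
  id_comp _ := Hom.ext (Category.id_comp _)
  comp_id _ := Hom.ext (Category.comp_id _)
  assoc _ _ _ := Hom.ext (Category.assoc _ _ _)

instance : KCat (EndS S) where
  zero := ⟨KCat.zero, 0, X, S.X_mem, fun _ => rfl⟩
  isZero :=
    { unique_to := fun X => ⟨⟨⟨⟨KCat.isZero.to_ _, KCat.isZero.eq_of_src (Y := X.base) _ _⟩⟩,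
        fun _ => Hom.ext (KCat.isZero.eq_of_src _ _)⟩⟩
      unique_from := fun X => ⟨⟨⟨⟨KCat.isZero.from_ X.base, LinearMap.ext fun _ => rfl⟩⟩,
        fun _ => Hom.ext (KCat.isZero.eq_of_tgt _ _)⟩⟩ }
  cofSeq f g := KCat.cofSeq f.f g.f
  cofSeq_left X := KCat.cofSeq_of_src (KCat.cofSeq_left X.base)
  cofSeq_right X := KCat.cofSeq_of_tgt (KCat.cofSeq_right X.base)

variable (S) in
/-- The forgetful functor `End_A^S → P(A)`. -/
def forget : ExactFunctor (EndS S) (FGP A) where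
  obj a := a.base
  map f := f.f
  map_zero := rfl
  map_cofSeq _ _ h := h

variable {B : Type u} [Ring B] (φ : A →+* B)

/-- The endomorphism `f ⊗ 1` of `P ⊗_A B`. -/
noncomputable def extEndo (E : EndS S) : Module.End Bᵐᵒᵖ ((ext φ).obj E.base) :=
  extEnd φ E.base E.endo

lemma extEndo_natural {E E' : EndS S} (g : E ⟶ E') :
    FGP.lin ((ext φ).map g.f) ∘ₗ E.extEndo φ = E'.extEndo φ ∘ₗ FGP.lin ((ext φ).map g.f) :=
  extEnd_natural φ g.f _ _ g.w

variable {φ}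

lemma extEndo_torsion (hφ : ∀ a ∈ Subring.center A, φ a ∈ Subring.center B) (E : EndS S) :
    ∃ (p : A[X]) (b : ℕ → Subring.center B), p ∈ S.carrier ∧ (∀ i, (b i : B) = φ (p.coeff i)) ∧
      ∑ i ∈ Finset.range (p.natDegree + 1), cmul _ (b i) * E.extEndo φ ^ i = 0 := by
  obtain ⟨p, hp, h⟩ := E.torsion
  have hc := coeff_central (S.central p hp)
  refine ⟨p, fun i => ⟨φ (p.coeff i), hφ _ (hc i)⟩, hp, fun _ => rfl, ?_⟩
  have h1 : ∑ i ∈ Finset.range (p.natDegree + 1),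
      cmul E.base ⟨p.coeff i, hc i⟩ * E.endo ^ i = 0 := by
    refine LinearMap.ext fun x => ?_
    rw [LinearMap.sum_apply]
    refine Eq.trans ?_ (h x)
    rw [polyAct, sum_over_range _ (fun n => by simp)]
    rfl
  have h2 := congr_arg (extEnd φ E.base) h1
  rw [map_sum, map_zero] at h2
  rw [← h2]
  refine Finset.sum_congr rfl fun i _ => ?_
  rw [map_mul, map_pow, extEnd_cmul φ E.base ⟨p.coeff i, hc i⟩ ⟨φ (p.coeff i), hφ _ (hc i)⟩ rfl]
  rfl

lemma commute_cmul {M : Type u} [AddCommGroup M] [Module Bᵐᵒᵖ M] (c : Subring.center B)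
    (f : Module.End Bᵐᵒᵖ M) : Commute (cmul M c) f :=
  (cmul_natural c f).symm

/-- If the values `p(c)` are invertible for `p ∈ S` then so is `c - f`. -/
lemma isUnit_sub (hφ : ∀ a ∈ Subring.center A, φ a ∈ Subring.center B) (c : Subring.center B)
    (hc : ∀ p ∈ S.carrier, IsUnit (eval₂ φ (c : B) p)) (E : EndS S) :
    IsUnit (cmul _ c - E.extEndo φ) := by
  obtain ⟨p, b, hp, hb, h⟩ := extEndo_torsion hφ E
  refine isUnit_sub_of_sum (d := p.natDegree) (fun i => commute_cmul (b i)) (commute_cmul c) h ?_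
  have h1 : IsUnit (∑ i ∈ Finset.range (p.natDegree + 1), b i * c ^ i) := by
    refine isUnit_center ?_
    have h2 := hc p hp
    rw [eval₂_eq_sum_range] at h2
    push_cast
    simpa only [hb] using h2
  have h3 := h1.map (cmul ((ext φ).obj E.base))
  simpa only [map_sum, map_mul, map_pow] using h3

/-- If the values `p̃(c)` are invertible for `p ∈ S` then so is `1 - f c`. -/
lemma isUnit_one_sub (hφ : ∀ a ∈ Subring.center A, φ a ∈ Subring.center B) (c : Subring.center B)
    (hc : ∀ p ∈ S.carrier, IsUnit (eval₂ φ (c : B) p.reverse)) (E : EndS S) :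
    IsUnit (1 - cmul _ c * E.extEndo φ) := by
  obtain ⟨p, b, hp, hb, h⟩ := extEndo_torsion hφ E
  refine isUnit_one_sub_of_sum (d := p.natDegree) (fun i => commute_cmul (b i)) (commute_cmul c)
    h ?_
  have h1 : IsUnit (∑ i ∈ Finset.range (p.natDegree + 1), b i * c ^ (p.natDegree - i)) := by
    refine isUnit_center ?_
    have h2 := hc p hp
    rw [eval₂_eq_sum_range' φ (Nat.lt_succ_of_le (reverse_natDegree_le p)),
      ← Finset.sum_range_reflect] at h2
    push_cast
    convert h2 using 1
    refine Finset.sum_congr rfl fun i hi => ?_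
    have hi' : i ≤ p.natDegree := Nat.le_of_lt_succ (Finset.mem_range.1 hi)
    have h3 : p.natDegree + 1 - 1 - i = p.natDegree - i := by omega
    have h4 : p.natDegree - (p.natDegree - i) = i := by omega
    rw [h3, coeff_reverse, revAt_le (by omega), h4, hb]
  have h3 := h1.map (cmul ((ext φ).obj E.base))
  simpa only [map_sum, map_mul, map_pow] using h3

end EndS

/-- The exact functor to automorphisms that is given by a natural family of units. -/
def autFunctor {D : Type (u + 1)} [Category.{u} D] [KCat D] {B : Type u} [Ring B]
    (G : ExactFunctor D (FGP B)) (e : ∀ X : D, (Module.End Bᵐᵒᵖ (G.obj X))ˣ)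
    (he : ∀ (X Y : D) (f : X ⟶ Y), FGP.lin (G.map f) ∘ₗ (e X : Module.End Bᵐᵒᵖ (G.obj X)) =
      (e Y : Module.End Bᵐᵒᵖ (G.obj Y)) ∘ₗ FGP.lin (G.map f)) :
    ExactFunctor D (AutCat (FGP B)) where
  obj X := ⟨G.obj X, FGP.unitIso (e X)⟩
  map {X Y} f := ⟨G.map f, (he X Y f).symm⟩
  map_id X := AutCat.Hom.ext (G.map_id X)
  map_comp f g := AutCat.Hom.ext (G.map_comp f g)
  map_zero := AutCat.eq_zero G.map_zero _
  map_cofSeq f g h := G.map_cofSeq f g h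

lemma inv_natural {B : Type u} [Ring B] {P Q : FGP B} (g : P →ₗ[Bᵐᵒᵖ] Q)
    (e : (Module.End Bᵐᵒᵖ P)ˣ) (e' : (Module.End Bᵐᵒᵖ Q)ˣ)
    (h : g ∘ₗ (e : Module.End Bᵐᵒᵖ P) = (e' : Module.End Bᵐᵒᵖ Q) ∘ₗ g) :
    g ∘ₗ (↑e⁻¹ : Module.End Bᵐᵒᵖ P) = (↑e'⁻¹ : Module.End Bᵐᵒᵖ Q) ∘ₗ g := by
  have h1 : (e : Module.End Bᵐᵒᵖ P) ∘ₗ (↑e⁻¹ : Module.End Bᵐᵒᵖ P) = LinearMap.id := e.mul_inv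
  have h2 : (↑e'⁻¹ : Module.End Bᵐᵒᵖ Q) ∘ₗ (e' : Module.End Bᵐᵒᵖ Q) = LinearMap.id := e'.inv_mul
  calc g ∘ₗ (↑e⁻¹ : Module.End Bᵐᵒᵖ P)
      = (↑e'⁻¹ : Module.End Bᵐᵒᵖ Q) ∘ₗ ((e' : Module.End Bᵐᵒᵖ Q) ∘ₗ g) ∘ₗ
          (↑e⁻¹ : Module.End Bᵐᵒᵖ P) := by
        rw [← LinearMap.comp_assoc, ← LinearMap.comp_assoc, h2, LinearMap.id_comp]
    _ = _ := by rw [← h, LinearMap.comp_assoc, h1, LinearMap.comp_id]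

end EndS

namespace LocSet

open Polynomial

variable {A : Type u} [Ring A] (S : LocSet A)

lemma toS_central : ∀ a ∈ Subring.center A, S.toS a ∈ Subring.center S.Loc := fun a ha =>
  S.toLoc_central (central_of_coeff fun n => by
    rw [coeff_C]
    split_ifs
    · exact ha
    · exact Subring.zero_mem _)

lemma toT_central : ∀ a ∈ Subring.center A, S.toT a ∈ Subring.center S.T.Loc := fun a ha =>
  S.T.toLoc_central (central_of_coeff fun n => by
    rw [coeff_C]
    split_ifs
    · exact ha
    · exact Subring.zero_mem _)

lemma eval₂_tT (p : A[X]) : eval₂ S.toT S.tT p = S.T.toLoc p := by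
  rw [tT, toT, ← hom_eval₂ p C S.T.toLoc X, eval₂_C_X]

/-- The element `t` of the center of `A[t]_S`. -/
noncomputable def tc : Subring.center S.Loc := ⟨(S.tS : S.Loc), S.tS_central⟩

/-- The element `t⁻¹` of the center of `A[t]_S`. -/
noncomputable def tic : Subring.center S.Loc := ⟨(↑S.tS⁻¹ : S.Loc), S.tS_inv_central⟩

/-- The element `t` of the center of `A[t]_T`. -/
noncomputable def tTc : Subring.center S.T.Loc := ⟨S.tT, S.tT_central⟩

variable {S}

/-- The automorphism `t - f` of `P[t]_S`. -/
noncomputable def tauUnit (E : EndS S) :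
    (Module.End S.Locᵐᵒᵖ ((ext S.toS).obj E.base))ˣ :=
  (E.isUnit_sub S.toS_central S.tc fun p hp => by
    rw [tc, S.eval₂_tS]
    exact S.toLoc_isUnit hp).unit

/-- The automorphism `(1 - f t)⁻¹` of `P[t]_T`. -/
noncomputable def zetaUnit (E : EndS S) :
    (Module.End S.T.Locᵐᵒᵖ ((ext S.toT).obj E.base))ˣ :=
  (E.isUnit_one_sub S.toT_central S.tTc fun p hp => by
    rw [tTc, S.eval₂_tT]
    exact S.T.toLoc_isUnit ⟨p, hp, rfl⟩).unit⁻¹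

/-- The automorphism `(1 - f t⁻¹)⁻¹` of `P[t]_S`. -/
noncomputable def zetaInvUnit (E : EndS S) :
    (Module.End S.Locᵐᵒᵖ ((ext S.toS).obj E.base))ˣ :=
  (E.isUnit_one_sub S.toS_central S.tic fun p hp =>
    S.evalInv_isUnit ⟨p, hp, rfl⟩).unit⁻¹

/-- The automorphism `t` of `P[t]_S`. -/
noncomputable def tUnit (S : LocSet A) (P : FGP A) : (Module.End S.Locᵐᵒᵖ ((ext S.toS).obj P))ˣ :=
  ((isUnit_center (c := S.tc) S.tS.isUnit).map (cmul _)).unit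

lemma tauUnit_val (E : EndS S) : (tauUnit E : Module.End S.Locᵐᵒᵖ ((ext S.toS).obj E.base)) =
    cmul _ S.tc - E.extEndo S.toS := rfl

lemma zetaUnit_inv (E : EndS S) :
    (↑(zetaUnit E)⁻¹ : Module.End S.T.Locᵐᵒᵖ ((ext S.toT).obj E.base)) =
      1 - cmul _ S.tTc * E.extEndo S.toT := by
  rw [zetaUnit, inv_inv]
  rfl

lemma zetaInvUnit_inv (E : EndS S) :
    (↑(zetaInvUnit E)⁻¹ : Module.End S.Locᵐᵒᵖ ((ext S.toS).obj E.base)) =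
      1 - cmul _ S.tic * E.extEndo S.toS := by
  rw [zetaInvUnit, inv_inv]
  rfl

lemma tUnit_val (P : FGP A) : (tUnit S P : Module.End S.Locᵐᵒᵖ ((ext S.toS).obj P)) =
    cmul _ S.tc := rfl

variable (S)

/-- The functor `(P, f) ↦ (P[t]_S, t - f)`. -/
noncomputable def tauF : ExactFunctor (EndS S) (AutCat (FGP S.Loc)) :=
  autFunctor ((EndS.forget S).comp (ext S.toS)) tauUnit fun X Y f => by
    rw [tauUnit_val, tauUnit_val]
    refine Eq.trans ?_ (LinearMap.sub_comp _ _ _).symm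
    refine (LinearMap.comp_sub _ _ _).trans (congr_arg₂ (· - ·) ?_ ?_)
    · exact cmul_natural S.tc (FGP.lin ((ext S.toS).map f.f))
    · exact EndS.extEndo_natural _ f

/-- The functor `(P, f) ↦ (P[t]_T, (1 - f t)⁻¹)`. -/
noncomputable def zetaF : ExactFunctor (EndS S) (AutCat (FGP S.T.Loc)) :=
  autFunctor ((EndS.forget S).comp (ext S.toT)) zetaUnit fun X Y f => by
    have h : FGP.lin ((ext S.toT).map f.f) ∘ₗ
          (↑(zetaUnit X)⁻¹ : Module.End S.T.Locᵐᵒᵖ ((ext S.toT).obj X.base)) =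
        (↑(zetaUnit Y)⁻¹ : Module.End S.T.Locᵐᵒᵖ ((ext S.toT).obj Y.base)) ∘ₗ
          FGP.lin ((ext S.toT).map f.f) := by
      rw [zetaUnit_inv, zetaUnit_inv]
      refine Eq.trans ?_ (LinearMap.sub_comp _ _ _).symm
      refine (LinearMap.comp_sub _ _ _).trans (congr_arg₂ (· - ·) ?_ ?_)
      · rfl
      · refine (congr_arg (fun k => k ∘ₗ X.extEndo S.toT) (cmul_natural S.tTc (FGP.lin ((ext S.toT).map f.f)))).trans ?_
        refine (LinearMap.comp_assoc _ _ _).trans ?_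
        refine (congr_arg (fun k => cmul _ S.tTc ∘ₗ k) (EndS.extEndo_natural S.toT f)).trans ?_
        exact (LinearMap.comp_assoc _ _ _).symm
    have h2 := inv_natural _ _ _ h
    rw [inv_inv, inv_inv] at h2
    exact h2

/-- The functor `P ↦ (P[t]_S, t)`. -/
noncomputable def tF : ExactFunctor (FGP A) (AutCat (FGP S.Loc)) :=
  autFunctor (ext S.toS) (tUnit S) fun _ _ f =>
    cmul_natural S.tc (FGP.lin ((ext S.toS).map f))

end LocSet

/-! ### The group `K₁` and the classes of objects and of automorphisms -/

section K1

variable (C : Type (u + 1)) [Category.{u} C] [KCat C]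

/-- The group `K₁(C) = π₁(K(C))`. -/
abbrev K1 : Type (u + 1) := FundamentalGroup (K C) (Path.refl (iSBase C))

variable {C}

/-- Translation by the inverse of `x` in the loop space `K(C)`. -/
noncomputable def translate (x : K C) : C(K C, K C) where
  toFun y := y.trans x.symm
  continuous_toFun := Path.continuous_trans.comp (continuous_id.prodMk continuous_const)

lemma translate_self (x : K C) : translate x x = x.trans x.symm := rfl

/-- The standard path from the basepoint of `K(C)` to `x · x⁻¹`. -/
noncomputable def cancelPath (x : K C) : Path (Path.refl (iSBase C)) (translate x x) where
  toFun s := (Path.Homotopy.reflTransSymm x).eval s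
  source' := (Path.Homotopy.reflTransSymm x).eval_zero
  target' := (Path.Homotopy.eval_one _).trans (translate_self x).symm
  continuous_toFun := by
    refine Path.continuous_uncurry_iff.1 ?_
    exact (Path.Homotopy.reflTransSymm x).continuous

/-- The projection from free loops in `K(C)` to based loops, up to homotopy: a loop with
basepoint `x` is translated to the component of the basepoint of `K(C)`. -/
noncomputable def toK1 (γ : FreeLoop (K C)) : K1 C :=
  let x := FreeLoop.ev γ
  FundamentalGroup.fromPath ⟦((cancelPath x).trans (γ.path.map (translate x).continuous)).trans
    (cancelPath x).symm⟧

open Classical in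
/-- The `1`-simplex of `iS•C` with `A p 0 1 = X`. -/
noncomputable def objFunctor (X : C) : Idx (.mk 1) ⥤ C where
  obj a := if a.i < a.j then X else KCat.zero
  map {a b} _ :=
    if h : a.i < a.j ∧ b.i < b.j then eqToHom ((if_pos h.1).trans (if_pos h.2).symm)
    else if ha : a.i < a.j then
      Limits.IsZero.from_ (by rw [if_neg fun hb => h ⟨ha, hb⟩]; exact KCat.isZero) _
    else Limits.IsZero.to_ (by rw [if_neg ha]; exact KCat.isZero) _
  map_id a := by
    by_cases ha : a.i < a.j
    · simp [ha]
    · refine Limits.IsZero.eq_of_src ?_ _ _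
      rw [if_neg ha]; exact KCat.isZero
  map_comp {a b c} f g := by
    by_cases ha : a.i < a.j
    · by_cases hc : c.i < c.j
      · have hb : b.i < b.j := by
          obtain ⟨-, h1, h2⟩ := leOfHom f
          obtain ⟨-, h3, h4⟩ := leOfHom g
          have h5 : c.j.val < 2 := c.j.isLt
          rw [Fin.lt_def] at ha hc ⊢
          rw [Fin.le_def] at h2 h3
          omega
        simp [ha, hb, hc]
      · refine Limits.IsZero.eq_of_tgt ?_ _ _
        rw [if_neg hc]; exact KCat.isZero
    · refine Limits.IsZero.eq_of_src ?_ _ _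
      rw [if_neg ha]; exact KCat.isZero

lemma cofSeq_left_of {X Y Z : C} (hX : X = KCat.zero) (f : X ⟶ Y) (h : Y = Z) :
    KCat.cofSeq f (eqToHom h) := by
  subst hX h
  exact KCat.cofSeq_of_src (KCat.cofSeq_left Y)

lemma cofSeq_right_of {X Y Z : C} (hZ : Z = KCat.zero) (g : Y ⟶ Z) (h : X = Y) :
    KCat.cofSeq (eqToHom h) g := by
  subst hZ h
  exact KCat.cofSeq_of_tgt (KCat.cofSeq_right X)

lemma objFunctor_map (X : C) {a b : Idx (.mk 1)} (f : a ⟶ b) (h : a.i < a.j ↔ b.i < b.j) :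
    ∃ e, (objFunctor X).map f = eqToHom e := by
  by_cases ha : a.i < a.j
  · exact ⟨_, dif_pos ⟨ha, h.1 ha⟩⟩
  · have hb : ¬ b.i < b.j := fun hb => ha (h.2 hb)
    refine ⟨(if_neg ha).trans (if_neg hb).symm, Limits.IsZero.eq_of_src ?_ _ _⟩
    show Limits.IsZero (if a.i < a.j then X else KCat.zero)
    rw [if_neg ha]
    exact KCat.isZero

lemma objFunctor_isSimplex (X : C) : IsSimplex (objFunctor X) where
  zero p i := if_neg (lt_irrefl i)
  cofSeq p i j k hij hjk := by
    rcases hij.lt_or_eq with h | rfl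
    · obtain rfl : j = k := by
        have h1 : k.val < 2 := k.isLt
        rw [Fin.lt_def] at h
        rw [Fin.le_def] at hjk
        exact Fin.ext (by omega)
      obtain ⟨e, he⟩ := objFunctor_map X (Idx.hom le_rfl le_rfl hjk :
        Idx.mk p i j hij ⟶ Idx.mk p i j (hij.trans hjk)) Iff.rfl
      rw [he]
      exact cofSeq_right_of (if_neg (lt_irrefl j)) _ _
    · obtain ⟨e, he⟩ := objFunctor_map X (Idx.hom le_rfl hij le_rfl :
        Idx.mk p i k (hij.trans hjk) ⟶ Idx.mk p i k hjk) Iff.rfl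
      rw [he]
      exact cofSeq_left_of (if_neg (lt_irrefl i)) _ _
  iso p p' i j hij h := by
    obtain ⟨e, he⟩ := objFunctor_map X (Idx.hom h le_rfl le_rfl :
      Idx.mk p i j hij ⟶ Idx.mk p' i j hij) Iff.rfl
    rw [he]
    infer_instance

lemma eq_iSZero (A : (iS C).obj (op (.mk 0))) : A = iSZero C (.mk 0) := by
  have h : ∀ a : Idx (.mk 0), A.1.obj a = KCat.zero := by
    rintro ⟨p, i, j, h⟩
    obtain rfl : i = j := Subsingleton.elim (α := Fin 1) i j
    exact A.2.zero p i
  refine Subtype.ext (CategoryTheory.Functor.ext h fun a b f => ?_)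
  refine Limits.IsZero.eq_of_src ?_ _ _
  rw [h]; exact KCat.isZero

/-- The point with coordinates `(1 - s, s)` of the `1`-simplex. -/
noncomputable def edgePt : C(I, stdSimplex ℝ (Fin 2)) :=
  ⟨stdSimplexHomeomorphUnitInterval.symm, stdSimplexHomeomorphUnitInterval.symm.continuous⟩

lemma edgePt_zero : edgePt 0 = stdSimplex.vertex 0 :=
  stdSimplexHomeomorphUnitInterval.symm_apply_eq.2 stdSimplexHomeomorphUnitInterval_zero.symm

lemma edgePt_one : edgePt 1 = stdSimplex.vertex 1 :=
  stdSimplexHomeomorphUnitInterval.symm_apply_eq.2 stdSimplexHomeomorphUnitInterval_one.symm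

lemma pt_vertex (A : (iS C).obj (op (.mk 1))) (i : Fin 2) :
    pt A (stdSimplex.vertex i) = iSBase C := by
  let θ : SimplexCategory.mk 0 ⟶ SimplexCategory.mk 1 := SimplexCategory.const _ _ i
  have h : stdSimplex.map θ (default : stdSimplex ℝ (Fin 1)) = stdSimplex.vertex i := by
    rw [Subsingleton.elim (default : stdSimplex ℝ (Fin 1)) (stdSimplex.vertex 0)]
    exact stdSimplex.map_vertex _ _
  have h2 := pt_map θ A default
  rw [eq_iSZero ((iS C).map θ.op A)] at h2
  refine Eq.trans ?_ h2.symm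
  exact congr_arg (pt A) h.symm

/-- The point of `K(C) = Ω|iS•C|` that is given by an object: the corresponding edge. -/
noncomputable def objPt (X : C) : K C where
  toFun s := pt (n := .mk 1)
    (⟨objFunctor X, objFunctor_isSimplex X⟩ : (iS C).obj (op (.mk 1))) (edgePt s)
  continuous_toFun := (map_continuous _).comp (map_continuous _)
  source' := by rw [edgePt_zero]; exact pt_vertex _ 0
  target' := by rw [edgePt_one]; exact pt_vertex _ 1

/-- The class `[X, α] ∈ K₁(C)` of an automorphism `α` of `X`. -/
noncomputable def autClass (a : AutCat C) : K1 C := toK1 (AutCat.coassembly C (objPt a))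

end K1

/-! ### Higher torsion and the higher zeta function -/

section maps

open Polynomial

variable {A : Type u} [Ring A]

/-- `c` is a map over `K(C)`: the free loop `c(γ)` is based at the underlying point of `γ`. -/
lemma AutCat.ev_coassembly {C : Type (u + 1)} [Category.{u} C] [KCat C] (γ : K (AutCat C)) :
    FreeLoop.ev (coassembly C γ) = kMap (forget C) γ := by
  refine (IsoArr.paths_zero _).trans ?_
  rw [kMap_comp]
  rfl

namespace LocSet

variable (S : LocSet A)

/-- The map `K(End_A^S) → K(A) → K(A[t]_S)`, `(P, f) ↦ P[t]_S`. -/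
noncomputable def baseMap : C(K (EndS S), K (FGP S.Loc)) :=
  (kMap (ext S.toS)).comp (kMap (EndS.forget S))

/-- The higher endomorphism torsion `τ(t) : K(End_A^S) → LK(A[t]_S)`. -/
noncomputable def tau : C(K (EndS S), FreeLoop (K (FGP S.Loc))) :=
  (AutCat.coassembly _).comp (kMap (tauF S))

/-- The higher zeta function `ζ(t) : K(End_A^S) → LK(A[t]_T)`. -/
noncomputable def zeta : C(K (EndS S), FreeLoop (K (FGP S.T.Loc))) :=
  (AutCat.coassembly _).comp (kMap (zetaF S))

/-- The composition of `ζ(t)` with the map `LK(A[t]_T) → LK(A[t]_S)` induced by `t ↦ t⁻¹`. -/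
noncomputable def zetaInvRaw : C(K (EndS S), FreeLoop (K (FGP S.Loc))) :=
  (FreeLoop.map (kMap (ext S.inversion))).comp S.zeta

/-- The canonical isomorphism `P[t]_T ⊗ A[t]_S ≅ P[t]_S`, where `A[t]_T` acts on `A[t]_S` by
`t ↦ t⁻¹`, as a functor of `P`. -/
noncomputable def canonF : ExactFunctor (FGP A) (IsoArr (FGP S.Loc)) :=
  isoFunctor ((ext S.toT).comp (ext S.inversion)) (ext S.toS) (extTrans S.inversion_comp_toT)

/-- The paths in `K(A[t]_S)` from `P[t]_T ⊗ A[t]_S` to `P[t]_S` along the canonical isomorphism. -/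
noncomputable def canonPaths : C(K (EndS S), C(I, K (FGP S.Loc))) :=
  IsoArr.paths.comp ((kMap S.canonF).comp (kMap (EndS.forget S)))

lemma canonPaths_zero (z : K (EndS S)) :
    S.canonPaths z 0 = FreeLoop.ev (S.zetaInvRaw z) := by
  have h : FreeLoop.ev (S.zetaInvRaw z) =
      kMap (ext S.inversion) (FreeLoop.ev (S.zeta z)) := rfl
  have h2 : FreeLoop.ev (S.zeta z) = kMap (AutCat.forget _) (kMap (zetaF S) z) :=
    AutCat.ev_coassembly _
  have h3 : S.canonPaths z 0 = kMap IsoArr.srcF (kMap S.canonF (kMap (EndS.forget S) z)) :=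
    IsoArr.paths_zero (kMap S.canonF (kMap (EndS.forget S) z))
  rw [h, h2, h3, kMap_comp, kMap_comp, kMap_comp, kMap_comp]
  rfl

lemma canonPaths_one (z : K (EndS S)) : S.canonPaths z 1 = S.baseMap z := by
  have h : S.canonPaths z 1 = kMap IsoArr.tgtF (kMap S.canonF (kMap (EndS.forget S) z)) :=
    IsoArr.paths_one (kMap S.canonF (kMap (EndS.forget S) z))
  rw [h, kMap_comp]
  rfl

/-- The map `ζ(t⁻¹) : K(End_A^S) → LK(A[t]_S)`, with basepoints identified along the canonical
isomorphism `P[t]_T ⊗ A[t]_S ≅ P[t]_S`. -/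
noncomputable def zetaInv : C(K (EndS S), FreeLoop (K (FGP S.Loc))) :=
  FreeLoop.transport S.zetaInvRaw S.canonPaths S.canonPaths_zero

/-- The map `t : K(End_A^S) → K(A) → LK(A[t]_S)`. -/
noncomputable def tMap : C(K (EndS S), FreeLoop (K (FGP S.Loc))) :=
  ((AutCat.coassembly _).comp (kMap (tF S))).comp (kMap (EndS.forget S))

lemma ev_tau (z : K (EndS S)) : FreeLoop.ev (S.tau z) = S.baseMap z := by
  have h : FreeLoop.ev (S.tau z) = kMap (AutCat.forget _) (kMap (tauF S) z) :=
    AutCat.ev_coassembly _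
  have h2 : S.baseMap z = kMap ((EndS.forget S).comp (ext S.toS)) z := kMap_comp _ _ z
  rw [h, h2, kMap_comp]
  rfl

lemma ev_zetaInv (z : K (EndS S)) : FreeLoop.ev (S.zetaInv z) = S.baseMap z :=
  (FreeLoop.ev_transport _ _ _ z).trans (S.canonPaths_one z)

lemma ev_tMap (z : K (EndS S)) : FreeLoop.ev (S.tMap z) = S.baseMap z := by
  have h : FreeLoop.ev (S.tMap z) =
      kMap (AutCat.forget _) (kMap (tF S) (kMap (EndS.forget S) z)) := AutCat.ev_coassembly _
  rw [h, kMap_comp]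
  rfl

/-- The loop product `ζ(t⁻¹) ∗ τ(t) : K(End_A^S) → LK(A[t]_S)`. -/
noncomputable def zetaMulTau : C(K (EndS S), FreeLoop (K (FGP S.Loc))) :=
  FreeLoop.mul S.zetaInv S.tau fun z => (S.ev_zetaInv z).trans (S.ev_tau z).symm

variable {S}

/-- The object `(P[t]_S, (1 - f t⁻¹)⁻¹)`. -/
noncomputable def zetaInvAut (E : EndS S) : AutCat (FGP S.Loc) :=
  ⟨(ext S.toS).obj E.base, FGP.unitIso (zetaInvUnit E)⟩

/-- The object `(P[t]_S, t - f)`. -/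
noncomputable def tauAut (E : EndS S) : AutCat (FGP S.Loc) :=
  ⟨(ext S.toS).obj E.base, FGP.unitIso (tauUnit E)⟩

/-- The object `(P[t]_S, t)`. -/
noncomputable def tAut (E : EndS S) : AutCat (FGP S.Loc) :=
  ⟨(ext S.toS).obj E.base, FGP.unitIso (tUnit S E.base)⟩

end LocSet

end maps

/-- The determinant of an endomorphism of a module over a commutative ring. -/
noncomputable def FGP.det {R : Type u} [CommRing R] {P : FGP R} (f : Module.End Rᵐᵒᵖ P) : R :=
  (LinearMap.det f).unop

end localization

end KT

/-!
The three natural automorphisms `(1 - f t⁻¹)⁻¹`, `t - f` and `t` of `P[t]_S` satisfy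
`(1 - f t⁻¹)⁻¹ (t - f) = t = (t - f) (1 - f t⁻¹)⁻¹` (`tauUnit_mul_zetaInvUnit`,
`zetaInvUnit_mul_tauUnit`), and everything follows from the fact that coassembly turns commutative
squares of isomorphisms into squares of paths.

An object of `IsoArr (IsoArr C)` is a commutative square of isomorphisms, so the map `IsoArr.paths`
applied twice gives a continuous family of maps `I × I → K(C)` over `K(IsoArr (IsoArr C))`
(`IsoArr.square`). Since `IsoArr.paths` is natural for exact functors (`IsoArr.paths_mapF`), the four
sides of such a map are the paths along the four sides of the square of isomorphisms; and the path
along an identity is constant (`IsoArr.paths_reflF`). As `I × I` is convex, any two ways around the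
square are related by a linear homotopy, continuously in the parameter. This is used twice:

* The square with horizontal sides the canonical isomorphism `P[t]_T ⊗ A[t]_S ≅ P[t]_S` and
  vertical sides `(1 - f t)⁻¹ ⊗ 1` and `(1 - f t⁻¹)⁻¹` identifies the transported map `ζ(t⁻¹)` with
  the coassembly of `(P[t]_S, (1 - f t⁻¹)⁻¹)` (`exists_homotopy_zetaInv`).
* The square with sides `1`, `(1 - f t⁻¹)⁻¹`, `t - f` and `t` is a homotopy from the loop product to
  `t` (`exists_homotopy_zetaInvDirect_mul_tau`).

Both homotopies fix basepoints, so they descend to `K₁`. The values on objects follow because the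
edge of an object is natural for exact functors (`kMap_objPt`). Milnor's identity is the
determinant of `(1 - f t⁻¹)⁻¹ (t - f) = t`, where a basis of `P` over `A` gives one of `P[t]_S`
(`Tensor.basis`).
-/

namespace KT

section families

/-! ### Homotopies of families of loops that are read off from squares -/

variable {X Z : Type w} [TopologicalSpace X] [TopologicalSpace Z]

/-- The point `(1 - v) a + v b` of the unit interval. The projection to the interval does not
change the number; it makes membership and continuity automatic. -/
noncomputable def interp (v a b : I) : I :=
  Set.projIcc (0 : ℝ) 1 zero_le_one ((1 - v) * a + v * b)

lemma continuous_interp : Continuous fun p : I × I × I => interp p.1 p.2.1 p.2.2 :=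
  continuous_projIcc.comp (by fun_prop)

lemma interp_zero (a b : I) : interp 0 a b = a := by
  simp [interp]

lemma interp_one (a b : I) : interp 1 a b = b := by
  simp [interp]

lemma interp_self (v a : I) : interp v a a = a := by
  have h : (1 - (v : ℝ)) * a + v * a = a := by ring
  simp [interp, h]

/-- The path `r ↦ (s, r)` in the square. -/
def verticalPath (s : I) : Path ((s, 0) : I × I) (s, 1) where
  toFun r := (s, r)
  source' := rfl
  target' := rfl

/-- The path `s ↦ (s, r)` in the square. -/
def horizontalPath (r : I) : Path ((0, r) : I × I) (1, r) where
  toFun s := (s, r)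
  source' := rfl
  target' := rfl

/-- Two families of loops that are obtained from two paths in the square by one family of maps
from the square are homotopic, by linear homotopy in the square. -/
lemma exists_homotopy_of_square {f g : C(Z, FreeLoop X)} {b : Z → X} (Q : Z → I × I → X)
    (hQ : Continuous fun p : Z × I × I => Q p.1 p.2) (γ δ : C(I, I × I))
    (hf : ∀ z t, (f z).1 t = Q z (γ t)) (hg : ∀ z t, (g z).1 t = Q z (δ t))
    (h0 : ∀ z v, Q z (interp v (γ 0).1 (δ 0).1, interp v (γ 0).2 (δ 0).2) = b z)
    (h1 : ∀ z v, Q z (interp v (γ 1).1 (δ 1).1, interp v (γ 1).2 (δ 1).2) = b z) :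
    ∃ H : ContinuousMap.Homotopy f g, ∀ s z, FreeLoop.ev (H (s, z)) = b z := by
  let q : I × Z → I → X := fun y t =>
    Q y.2 (interp y.1 (γ t).1 (δ t).1, interp y.1 (γ t).2 (δ t).2)
  have hq : Continuous fun p : (I × Z) × I => q p.1 p.2 := by
    refine hQ.comp (Continuous.prodMk (by fun_prop) (Continuous.prodMk ?_ ?_))
    · exact continuous_interp.comp (f := fun p : (I × Z) × I => (p.1.1, (γ p.2).1, (δ p.2).1))
        (by fun_prop)
    · exact continuous_interp.comp (f := fun p : (I × Z) × I => (p.1.1, (γ p.2).2, (δ p.2).2))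
        (by fun_prop)
  let p : ∀ y : I × Z, Path (b y.2) (b y.2) := fun y =>
    { toFun := q y
      continuous_toFun := by fun_prop
      source' := h0 y.2 y.1
      target' := h1 y.2 y.1 }
  refine ⟨⟨FreeLoop.ofFamily p hq, fun z => ?_, fun z => ?_⟩, fun s z => h0 z s⟩
  · refine Subtype.ext (ContinuousMap.ext fun t => ?_)
    show q (0, z) t = (f z).1 t
    simp only [q, interp_zero, hf]
  · refine Subtype.ext (ContinuousMap.ext fun t => ?_)
    show q (1, z) t = (g z).1 t
    simp only [q, interp_one, hg]

/-- If the side `s ↦ (s, 0)` of a square is constant then the product of the sides `(0, –)` and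
`(–, 1)` is homotopic to the side `(1, –)`. -/
lemma exists_homotopy_mul_of_square {f g k : C(Z, FreeLoop X)}
    (h : ∀ z, FreeLoop.ev (f z) = FreeLoop.ev (g z)) {b : Z → X} (Q : Z → I × I → X)
    (hQ : Continuous fun p : Z × I × I => Q p.1 p.2)
    (hf : ∀ z t, Q z (0, t) = (f z).1 t) (hg : ∀ z t, Q z (t, 1) = (g z).1 t)
    (hk : ∀ z t, Q z (1, t) = (k z).1 t) (hb : ∀ z t, Q z (t, 0) = b z) :
    ∃ H : ContinuousMap.Homotopy (FreeLoop.mul f g h) k, ∀ s z, FreeLoop.ev (H (s, z)) = b z := by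
  refine exists_homotopy_of_square Q hQ
    ((verticalPath 0).trans (horizontalPath 1)).toContinuousMap (verticalPath 1).toContinuousMap
    (fun z t => ?_) (fun z t => (hk z t).symm) (fun z v => ?_) fun z v => ?_
  · show ((f z).path.trans ((g z).path.cast (h z) (h z))) t =
      Q z (((verticalPath 0).trans (horizontalPath 1)) t)
    rw [Path.trans_apply, Path.trans_apply]
    split_ifs
    · exact (hf z _).symm
    · exact (hg z _).symm
  · have e0 : ((verticalPath 0).trans (horizontalPath 1)).toContinuousMap 0 = (0, 0) :=
      ((verticalPath 0).trans (horizontalPath 1)).source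
    have e1 : (verticalPath 1).toContinuousMap 0 = (1, 0) := rfl
    rw [e0, e1, interp_self]
    exact hb z _
  · have e0 : ((verticalPath 0).trans (horizontalPath 1)).toContinuousMap 1 = (1, 1) :=
      ((verticalPath 0).trans (horizontalPath 1)).target
    have e1 : (verticalPath 1).toContinuousMap 1 = (1, 1) := rfl
    rw [e0, e1, interp_self, ← hb z 1]
    exact (hk z 1).trans ((k z).2.symm.trans (hk z 0).symm)

/-- A square whose sides `(–, 0)` and `(–, 1)` agree is a homotopy from the transport of the side
`(0, –)` along them to the side `(1, –)`. -/
lemma exists_homotopy_transport_of_square {f k : C(Z, FreeLoop X)} (p : C(Z, C(I, X)))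
    (h : ∀ z, p z 0 = FreeLoop.ev (f z)) (Q : Z → I × I → X)
    (hQ : Continuous fun p : Z × I × I => Q p.1 p.2)
    (hf : ∀ z t, Q z (0, t) = (f z).1 t) (hk : ∀ z t, Q z (1, t) = (k z).1 t)
    (hp : ∀ z t, Q z (t, 0) = p z t) (hp' : ∀ z t, Q z (t, 1) = p z t) :
    ∃ H : ContinuousMap.Homotopy (FreeLoop.transport f p h) k,
      ∀ s z, FreeLoop.ev (H (s, z)) = p z 1 := by
  let γ := ((horizontalPath 0).symm.trans (verticalPath 0)).trans (horizontalPath 1)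
  have e0 : γ.toContinuousMap 0 = (1, 0) := γ.source
  have e1 : γ.toContinuousMap 1 = (1, 1) := γ.target
  have d0 : (verticalPath 1).toContinuousMap 0 = (1, 0) := rfl
  have d1 : (verticalPath 1).toContinuousMap 1 = (1, 1) := rfl
  refine exists_homotopy_of_square Q hQ γ.toContinuousMap (verticalPath 1).toContinuousMap
    (fun z t => ?_) (fun z t => (hk z t).symm) (fun z v => ?_) fun z v => ?_
  · let q : Path (FreeLoop.ev (f z)) (p z 1) := ⟨p z, h z, rfl⟩
    show ((q.symm.trans (f z).path).trans q) t = Q z (γ t)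
    simp only [γ]
    rw [Path.trans_apply, Path.trans_apply]
    split_ifs
    · rw [Path.trans_apply, Path.trans_apply]
      split_ifs
      · exact (hp z _).symm
      · exact (hf z _).symm
    · exact (hp' z _).symm
  · rw [e0, d0, interp_self, interp_self]
    exact hp z 1
  · rw [e1, d1, interp_self]
    exact hp' z 1

/-- Multiplication by a fixed family of loops preserves homotopies over the base. -/
lemma exists_homotopy_mul_right {f f' g : C(Z, FreeLoop X)} {b : C(Z, X)}
    (hg : ∀ z, FreeLoop.ev (g z) = b z) (hf : ∀ z, FreeLoop.ev (f z) = FreeLoop.ev (g z))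
    (hf' : ∀ z, FreeLoop.ev (f' z) = FreeLoop.ev (g z)) (H : ContinuousMap.Homotopy f f')
    (hH : ∀ s z, FreeLoop.ev (H (s, z)) = b z) :
    ∃ H' : ContinuousMap.Homotopy (FreeLoop.mul f g hf) (FreeLoop.mul f' g hf'),
      ∀ s z, FreeLoop.ev (H' (s, z)) = b z := by
  let G : C(I × Z, FreeLoop X) := g.comp ContinuousMap.snd
  have hG : ∀ y, FreeLoop.ev (H.toContinuousMap y) = FreeLoop.ev (G y) := fun y =>
    (hH y.1 y.2).trans (hg y.2).symm
  have key : ∀ (a a' c : FreeLoop X) (h : FreeLoop.ev a = FreeLoop.ev c)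
      (h' : FreeLoop.ev a' = FreeLoop.ev c) (_ : a = a') (t : I),
      (a.path.trans (c.path.cast h h)) t = (a'.path.trans (c.path.cast h' h')) t := by
    rintro a _ c h h' rfl t
    rfl
  refine ⟨⟨FreeLoop.mul H.toContinuousMap G hG, fun z => ?_, fun z => ?_⟩, fun s z => ?_⟩
  · exact Subtype.ext (ContinuousMap.ext fun t => key _ _ _ _ _ (H.apply_zero z) t)
  · exact Subtype.ext (ContinuousMap.ext fun t => key _ _ _ _ _ (H.apply_one z) t)
  · exact ((FreeLoop.path (H.toContinuousMap (s, z))).trans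
      ((FreeLoop.path (G (s, z))).cast (hG (s, z)) (hG (s, z)))).source.trans (hH s z)

/-- Homotopies over the base can be concatenated. -/
lemma exists_homotopy_trans {f g k : C(Z, FreeLoop X)} {b : Z → X}
    (h₁ : ∃ H : ContinuousMap.Homotopy f g, ∀ s z, FreeLoop.ev (H (s, z)) = b z)
    (h₂ : ∃ H : ContinuousMap.Homotopy g k, ∀ s z, FreeLoop.ev (H (s, z)) = b z) :
    ∃ H : ContinuousMap.Homotopy f k, ∀ s z, FreeLoop.ev (H (s, z)) = b z := by
  obtain ⟨H₁, e₁⟩ := h₁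
  obtain ⟨H₂, e₂⟩ := h₂
  refine ⟨H₁.trans H₂, fun s z => ?_⟩
  rw [ContinuousMap.Homotopy.trans_apply]
  split_ifs
  · exact e₁ _ _
  · exact e₂ _ _

end families


/-! ### Naturality of the paths along isomorphisms -/

section prism

variable {k : ℕ}

/-- The projection `Δᵏ × I → Δᵏ` on the `i`-th simplex of the prism. -/
lemma map_predAbove_prism (u : stdSimplex ℝ (Fin (k + 1))) (s : I) {i : Fin (k + 1)}
    (hi : InPrism u s i) : stdSimplex.map i.predAbove (prism u s) = u := by
  apply stdSimplex.ext
  funext l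
  rw [map_apply]
  have hL : ∀ a, prism u s a = ∑ j : Fin (k + 1),
      ((if a = j.castSucc then low u (1 - s) j else 0) +
      (if a = j.succ then u j - low u (1 - s) j else 0)) := fun _ => rfl
  have e : ∀ a, (if i.predAbove a = l then prism u s a else 0) = ∑ j : Fin (k + 1),
      ((if i.predAbove a = l then (if a = j.castSucc then low u (1 - s) j else 0) else 0) +
      (if i.predAbove a = l then (if a = j.succ then u j - low u (1 - s) j else 0) else 0)) := by
    intro a
    by_cases h : i.predAbove a = l <;> simp [h, hL]
  rw [Finset.sum_congr rfl fun a _ => e a, Finset.sum_comm]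
  have e2 : ∀ j : Fin (k + 1), (∑ a,
      ((if i.predAbove a = l then (if a = j.castSucc then low u (1 - s) j else 0) else 0) +
      (if i.predAbove a = l then (if a = j.succ then u j - low u (1 - s) j else 0) else 0))) =
      if j = l then u j else 0 := by
    intro j
    rw [Finset.sum_add_distrib, sum_single_ite, sum_single_ite]
    rcases lt_trichotomy j i with h | h | h
    · rw [low_eq_self ((cum_mono u (by rw [Fin.lt_def] at h; omega)).trans hi.1),
        Fin.predAbove_castSucc_of_le _ _ h.le]
      simp
    · subst h
      rw [Fin.predAbove_castSucc_self, Fin.predAbove_succ_self]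
      by_cases h : j = l <;> simp [h]
    · rw [low_eq_zero (hi.2.trans (cum_mono u (by rw [Fin.lt_def] at h; omega))),
        Fin.predAbove_succ_of_le _ _ h.le]
      simp
  rw [Finset.sum_congr rfl fun j _ => e2 j]
  simp

end prism

lemma eqToHom_conj_self {C : Type*} [Category* C] {X Y : C} (f : X ⟶ Y) (hX : X = X)
    (hY : Y = Y) : f = eqToHom hX ≫ f ≫ eqToHom hY := by simp

namespace IsoArr

variable {C D : Type (u + 1)} [Category.{u} C] [KCat C] [Category.{u} D] [KCat D]

/-- The functor on categories of isomorphisms that is induced by an exact functor. -/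
def mapF (F : ExactFunctor C D) : ExactFunctor (IsoArr C) (IsoArr D) where
  obj a := ⟨F.obj a.src, F.obj a.tgt, F.mapIso a.iso⟩
  map {a b} f := ⟨F.map f.l, F.map f.r, by
    show F.map f.l ≫ F.map b.iso.hom = F.map a.iso.hom ≫ F.map f.r
    rw [← F.map_comp, ← F.map_comp, f.w]⟩
  map_id _ := Hom.ext (F.map_id _) (F.map_id _)
  map_comp _ _ := Hom.ext (F.map_comp _ _) (F.map_comp _ _)
  map_zero := eq_zero F.map_zero F.map_zero _
  map_cofSeq _ _ h := ⟨F.map_cofSeq _ _ h.1, F.map_cofSeq _ _ h.2⟩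

lemma pick_mapF (F : ExactFunctor C D) (a : IsoArr C) :
    ∀ b, F.obj (a.pick b) = ((mapF F).obj a).pick b
  | 0 => rfl
  | 1 => rfl

lemma side_step_mapF (F : ExactFunctor C D) {a a' : IsoArr C} (f : a ⟶ a') :
    ∀ (b b' : Fin 2) (h : b ≤ b'), F.map (side f b ≫ a'.step h) =
      eqToHom (pick_mapF F a b) ≫ (side ((mapF F).map f) b ≫ ((mapF F).obj a').step h) ≫
        eqToHom (pick_mapF F a' b').symm
  | 0, 0, _ => (congr_arg F.map (Category.comp_id f.l)).trans
      ((Category.comp_id (F.map f.l)).symm.trans (eqToHom_conj_self _ _ _))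
  | 0, 1, _ => (F.map_comp f.l a'.iso.hom).trans (eqToHom_conj_self _ _ _)
  | 1, 0, h => absurd h (by decide)
  | 1, 1, _ => (congr_arg F.map (Category.comp_id f.r)).trans
      ((Category.comp_id (F.map f.r)).symm.trans (eqToHom_conj_self _ _ _))

lemma cylinder_mapF (F : ExactFunctor C D) {n : SimplexCategory} (A : Idx n ⥤ IsoArr C)
    (χ : n ⟶ SimplexCategory.mk 1) :
    cylinder A χ ⋙ F.toFunctor = cylinder (A ⋙ (mapF F).toFunctor) χ :=
  CategoryTheory.Functor.ext (fun _ => pick_mapF F _ _) fun _ _ _ => side_step_mapF F _ _ _ _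

lemma toPaths_mapF (F : ExactFunctor C D) (s : I) :
    (SSet.toTop.map (iSMap F)).hom.comp (ContinuousMap.mk fun x => (homotopy C).toPaths x s) =
      (ContinuousMap.mk fun x => (homotopy D).toPaths x s).comp
        (SSet.toTop.map (iSMap (mapF F))).hom :=
  realization_ext fun n x v => by
    show SSet.toTop.map (iSMap F) ((homotopy C).toPaths (pt x v) s) =
      (homotopy D).toPaths (SSet.toTop.map (iSMap (mapF F)) (pt x v)) s
    rw [map_pt, SHomotopy.toPaths_pt, SHomotopy.toPaths_pt]
    obtain ⟨i, hi⟩ := exists_inPrism v s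
    rw [SHomotopy.cell_eq (n := n.len) _ _ hi, SHomotopy.cell_eq (n := n.len) _ _ hi]
    unfold SHomotopy.piece
    rw [map_pt]
    exact congr_arg (fun y => pt y _) (Subtype.ext (cylinder_mapF F _ _))

/-- The path along an isomorphism is natural for exact functors. -/
lemma paths_mapF (F : ExactFunctor C D) (γ : K (IsoArr C)) (s : I) :
    paths (kMap (mapF F) γ) s = kMap F (paths γ s) := by
  ext r
  exact (congr_arg (fun f => f (γ r)) (toPaths_mapF F s)).symm

variable (C) in
/-- The identity isomorphisms. -/
def reflF : ExactFunctor C (IsoArr C) where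
  obj X := ⟨X, X, Iso.refl X⟩
  map f := ⟨f, f, (Category.comp_id f).trans (Category.id_comp f).symm⟩
  map_zero := rfl
  map_cofSeq _ _ h := ⟨h, h⟩

lemma pick_reflF (X : C) : ∀ b, ((reflF C).obj X).pick b = X
  | 0 => rfl
  | 1 => rfl

lemma side_step_reflF {X Y : C} (f : X ⟶ Y) : ∀ (b b' : Fin 2) (h : b ≤ b'),
    side ((reflF C).map f) b ≫ ((reflF C).obj Y).step h =
      eqToHom (pick_reflF X b) ≫ f ≫ eqToHom (pick_reflF Y b').symm
  | 0, 0, _ => (Category.comp_id f).trans (eqToHom_conj_self f _ _)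
  | 0, 1, _ => (Category.comp_id f).trans (eqToHom_conj_self f _ _)
  | 1, 0, h => absurd h (by decide)
  | 1, 1, _ => (Category.comp_id f).trans (eqToHom_conj_self f _ _)

lemma cylinder_reflF {n : SimplexCategory} (A : Idx n ⥤ C) (χ : n ⟶ SimplexCategory.mk 1) :
    cylinder (A ⋙ (reflF C).toFunctor) χ = A :=
  CategoryTheory.Functor.ext (fun _ => pick_reflF _ _) fun _ _ _ => side_step_reflF _ _ _ _

lemma toPaths_reflF (s : I) :
    (ContinuousMap.mk fun x => (homotopy C).toPaths x s).comp
        (SSet.toTop.map (iSMap (reflF C))).hom = ContinuousMap.id _ :=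
  realization_ext fun n x v => by
    show (homotopy C).toPaths (SSet.toTop.map (iSMap (reflF C)) (pt x v)) s = pt x v
    rw [map_pt, SHomotopy.toPaths_pt]
    obtain ⟨i, hi⟩ := exists_inPrism v s
    rw [SHomotopy.cell_eq (n := n.len) _ _ hi]
    unfold SHomotopy.piece
    have h : (homotopy C).app (.mk (n.len + 1))
        ((iS (IsoArr C)).map (SimplexCategory.σ i).op ((iSMap (reflF C)).app (op n) x))
        (cutHom (n.len + 1) (i.val + 1)) = (iS C).map (SimplexCategory.σ i).op x :=
      Subtype.ext (cylinder_reflF (idxMap (SimplexCategory.σ i) ⋙ x.1) _)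
    rw [h, pt_map]
    exact congr_arg (pt x) (map_predAbove_prism v s hi)

/-- The path along an identity is constant. -/
lemma paths_reflF (γ : K C) (s : I) : paths (kMap (reflF C) γ) s = γ := by
  ext r
  exact congr_arg (fun f => f (γ r)) (toPaths_reflF s)

/-! ### Commutative squares of natural isomorphisms -/

/-- The square in `K(C)` that is given by a commutative square of isomorphisms. The first coordinate
moves in the direction of the outer isomorphisms, the second along the inner ones. -/
noncomputable def square (γ : K (IsoArr (IsoArr C))) (p : I × I) : K C :=
  paths (paths γ p.1) p.2

lemma continuous_square {Z : Type*} [TopologicalSpace Z] (f : C(Z, K (IsoArr (IsoArr C)))) :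
    Continuous fun p : Z × I × I => square (f p.1) p.2 := by
  unfold square
  fun_prop

variable {F₀₀ F₀₁ F₁₀ F₁₁ : ExactFunctor D C}

/-- A commutative square of natural isomorphisms as one functor: `a` and `b` are the inner
isomorphisms, `l` and `r` the components of the outer one. -/
def squareFunctor (a : F₀₀.toFunctor ≅ F₀₁.toFunctor) (b : F₁₀.toFunctor ≅ F₁₁.toFunctor)
    (l : F₀₀.toFunctor ≅ F₁₀.toFunctor) (r : F₀₁.toFunctor ≅ F₁₁.toFunctor)
    (h : ∀ X, l.hom.app X ≫ b.hom.app X = a.hom.app X ≫ r.hom.app X) :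
    ExactFunctor D (IsoArr (IsoArr C)) :=
  isoFunctor (isoFunctor F₀₀ F₀₁ a) (isoFunctor F₁₀ F₁₁ b)
    (NatIso.ofComponents (fun X =>
      { hom := ⟨l.hom.app X, r.hom.app X, h X⟩
        inv := ⟨l.inv.app X, r.inv.app X, by
          show l.inv.app X ≫ a.hom.app X = b.hom.app X ≫ r.inv.app X
          rw [← cancel_epi (l.hom.app X), ← cancel_mono (r.hom.app X)]
          simp [h]⟩
        hom_inv_id := Hom.ext (l.hom_inv_id_app X) (r.hom_inv_id_app X)
        inv_hom_id := Hom.ext (l.inv_hom_id_app X) (r.inv_hom_id_app X) })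
      fun f => Hom.ext (l.hom.naturality f) (r.hom.naturality f))

variable (a : F₀₀.toFunctor ≅ F₀₁.toFunctor) (b : F₁₀.toFunctor ≅ F₁₁.toFunctor)
    (l : F₀₀.toFunctor ≅ F₁₀.toFunctor) (r : F₀₁.toFunctor ≅ F₁₁.toFunctor)
    (h : ∀ X, l.hom.app X ≫ b.hom.app X = a.hom.app X ≫ r.hom.app X) (z : K D) (t : I)

lemma square_zero_left : square (kMap (squareFunctor a b l r h) z) (0, t) =
    paths (kMap (isoFunctor F₀₀ F₀₁ a) z) t := by
  rw [square, paths_zero, kMap_comp]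
  rfl

lemma square_one_left : square (kMap (squareFunctor a b l r h) z) (1, t) =
    paths (kMap (isoFunctor F₁₀ F₁₁ b) z) t := by
  rw [square, paths_one, kMap_comp]
  rfl

lemma square_zero_right : square (kMap (squareFunctor a b l r h) z) (t, 0) =
    paths (kMap (isoFunctor F₀₀ F₁₀ l) z) t := by
  rw [square, paths_zero, ← paths_mapF, kMap_comp]
  rfl

lemma square_one_right : square (kMap (squareFunctor a b l r h) z) (t, 1) =
    paths (kMap (isoFunctor F₀₁ F₁₁ r) z) t := by
  rw [square, paths_one, ← paths_mapF, kMap_comp]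
  rfl

lemma paths_isoFunctor_refl (F : ExactFunctor D C) :
    paths (kMap (isoFunctor F F (Iso.refl _)) z) t = kMap F z := by
  rw [← paths_reflF (kMap F z) t, kMap_comp]
  rfl

end IsoArr


/-! ### Torsion, zeta function and multiplication by `t` as natural automorphisms -/

section functors

variable {A : Type u} [Ring A]

/-- A natural family of units as a natural automorphism. -/
def unitNatIso {D : Type (u + 1)} [Category.{u} D] [KCat D] {B : Type u} [Ring B]
    (G : ExactFunctor D (FGP B)) (e : ∀ X : D, (Module.End Bᵐᵒᵖ (G.obj X))ˣ)
    (he : ∀ (X Y : D) (f : X ⟶ Y), FGP.lin (G.map f) ∘ₗ (e X : Module.End Bᵐᵒᵖ (G.obj X)) =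
      (e Y : Module.End Bᵐᵒᵖ (G.obj Y)) ∘ₗ FGP.lin (G.map f)) :
    G.toFunctor ≅ G.toFunctor :=
  NatIso.ofComponents (fun X => FGP.unitIso (e X)) fun {X Y} f => (he X Y f).symm

lemma hom_comp_of_inv_comp {C : Type*} [Category* C] {X Y : C} (a : X ≅ X) (b : Y ≅ Y) (c : X ≅ Y)
    (h : a.inv ≫ c.hom = c.hom ≫ b.inv) : c.hom ≫ b.hom = a.hom ≫ c.hom := by
  rw [← Iso.inv_comp_eq, reassoc_of% h, b.inv_hom_id, Category.comp_id]

lemma comp_one_sub_cmul {R : Type u} [Ring R] {P Q : Type u} [AddCommGroup P] [Module Rᵐᵒᵖ P]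
    [AddCommGroup Q] [Module Rᵐᵒᵖ Q] (g : P →ₗ[Rᵐᵒᵖ] Q) (c : Subring.center R)
    {f : Module.End Rᵐᵒᵖ P} {f' : Module.End Rᵐᵒᵖ Q} (h : g ∘ₗ f = f' ∘ₗ g) :
    g ∘ₗ (1 - cmul P c * f) = (1 - cmul Q c * f') ∘ₗ g := by
  have h1 : g ∘ₗ (cmul P c * f) = (cmul Q c * f') ∘ₗ g := by
    rw [Module.End.mul_eq_comp, Module.End.mul_eq_comp, ← LinearMap.comp_assoc, cmul_natural,
      LinearMap.comp_assoc, h, LinearMap.comp_assoc]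
  rw [LinearMap.comp_sub, LinearMap.sub_comp, h1]
  rfl

namespace LocSet

variable (S : LocSet A)

/-- The functor `(P, f) ↦ P[t]_S`. -/
noncomputable abbrev baseF : ExactFunctor (EndS S) (FGP S.Loc) :=
  (EndS.forget S).comp (ext S.toS)

/-- The functor `(P, f) ↦ P[t]_T ⊗ A[t]_S`. -/
noncomputable abbrev rawBaseF : ExactFunctor (EndS S) (FGP S.Loc) :=
  (EndS.forget S).comp ((ext S.toT).comp (ext S.inversion))

variable {S}

lemma tauUnit_natural {X Y : EndS S} (f : X ⟶ Y) :
    FGP.lin (S.baseF.map f) ∘ₗ (tauUnit X).val =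
      (tauUnit Y).val ∘ₗ FGP.lin (S.baseF.map f) :=
  ((tauF S).map f).w.symm

lemma zetaUnit_natural {X Y : EndS S} (f : X ⟶ Y) :
    FGP.lin (((EndS.forget S).comp (ext S.toT)).map f) ∘ₗ
        (zetaUnit X : Module.End S.T.Locᵐᵒᵖ ((ext S.toT).obj X.base)) =
      (zetaUnit Y : Module.End S.T.Locᵐᵒᵖ ((ext S.toT).obj Y.base)) ∘ₗ
        FGP.lin (((EndS.forget S).comp (ext S.toT)).map f) :=
  ((zetaF S).map f).w.symm

lemma tUnit_mul_zetaInvUnit_inv (E : EndS S) :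
    tUnit S E.base * (zetaInvUnit E)⁻¹ = tauUnit E := by
  ext1
  rw [Units.val_mul, tUnit_val, zetaInvUnit_inv, tauUnit_val, mul_sub, mul_one, ← mul_assoc,
    ← map_mul]
  have h : S.tc * S.tic = 1 := Subtype.ext S.tS.mul_inv
  rw [h, map_one, one_mul]

lemma tUnit_commute (E : EndS S) (e : (Module.End S.Locᵐᵒᵖ ((ext S.toS).obj E.base))ˣ) :
    tUnit S E.base * e = e * tUnit S E.base := by
  ext1
  exact (EndS.commute_cmul S.tc (e : Module.End S.Locᵐᵒᵖ ((ext S.toS).obj E.base)))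

/-- `(t - f) (1 - f t⁻¹)⁻¹ = t`. -/
lemma tauUnit_mul_zetaInvUnit (E : EndS S) : tauUnit E * zetaInvUnit E = tUnit S E.base := by
  rw [← tUnit_mul_zetaInvUnit_inv, inv_mul_cancel_right]

/-- `(1 - f t⁻¹)⁻¹ (t - f) = t`. -/
lemma zetaInvUnit_mul_tauUnit (E : EndS S) : zetaInvUnit E * tauUnit E = tUnit S E.base := by
  rw [← tUnit_mul_zetaInvUnit_inv, tUnit_commute, mul_inv_cancel_left]

lemma zetaInvUnit_natural {X Y : EndS S} (f : X ⟶ Y) :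
    FGP.lin (S.baseF.map f) ∘ₗ (zetaInvUnit X).val =
      (zetaInvUnit Y).val ∘ₗ FGP.lin (S.baseF.map f) := by
  have h1 := inv_natural _ _ _ (tauUnit_natural f)
  have h2 : FGP.lin (S.baseF.map f) ∘ₗ (tUnit S X.base).val =
      (tUnit S Y.base).val ∘ₗ FGP.lin (S.baseF.map f) :=
    cmul_natural S.tc (FGP.lin (S.baseF.map f))
  have h3 : ∀ E : EndS S, zetaInvUnit E = tUnit S E.base * (tauUnit E)⁻¹ := fun E => by
    rw [← zetaInvUnit_mul_tauUnit, mul_inv_cancel_right]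
  rw [h3, h3, Units.val_mul, Units.val_mul]
  refine (LinearMap.comp_assoc _ _ _).symm.trans ?_
  rw [h2]
  refine (LinearMap.comp_assoc _ _ _).trans ?_
  exact congr_arg (fun k => (tUnit S Y.base).val ∘ₗ k) h1

variable (S)

/-- The natural automorphism `t - f` of `P[t]_S`. -/
noncomputable def tauIso : S.baseF.toFunctor ≅ S.baseF.toFunctor :=
  unitNatIso S.baseF tauUnit fun _ _ => tauUnit_natural

/-- The natural automorphism `(1 - f t⁻¹)⁻¹` of `P[t]_S`. -/
noncomputable def zetaInvIso : S.baseF.toFunctor ≅ S.baseF.toFunctor :=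
  unitNatIso S.baseF zetaInvUnit fun _ _ => zetaInvUnit_natural

/-- The natural automorphism `t` of `P[t]_S`. -/
noncomputable def tIso : S.baseF.toFunctor ≅ S.baseF.toFunctor :=
  unitNatIso S.baseF (fun E => tUnit S E.base) fun _ _ f =>
    cmul_natural S.tc (FGP.lin (S.baseF.map f))

/-- The natural automorphism `(1 - f t)⁻¹ ⊗ 1` of `P[t]_T ⊗ A[t]_S`. -/
noncomputable def rawZetaIso : S.rawBaseF.toFunctor ≅ S.rawBaseF.toFunctor :=
  Functor.isoWhiskerRight
    (unitNatIso ((EndS.forget S).comp (ext S.toT)) zetaUnit fun _ _ => zetaUnit_natural)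
    (ext S.inversion).toFunctor

/-- The canonical isomorphism `P[t]_T ⊗ A[t]_S ≅ P[t]_S`. -/
noncomputable def canonIso : S.rawBaseF.toFunctor ≅ S.baseF.toFunctor :=
  Functor.isoWhiskerLeft (EndS.forget S).toFunctor (extTrans S.inversion_comp_toT)

/-- The functor `(P, f) ↦ (P[t]_S, (1 - f t⁻¹)⁻¹)`. -/
noncomputable def zetaInvF : ExactFunctor (EndS S) (AutCat (FGP S.Loc)) :=
  autFunctor S.baseF zetaInvUnit fun _ _ => zetaInvUnit_natural

variable {S}

/-- The ring map `t ↦ t⁻¹` takes `1 - f t` to `1 - f t⁻¹`, under the canonical isomorphism. -/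
lemma canonIso_zetaUnit_inv (E : EndS S) :
    (ext S.inversion).map (X := (ext S.toT).obj E.base) (Y := (ext S.toT).obj E.base)
        (↑(zetaUnit E)⁻¹ : Module.End S.T.Locᵐᵒᵖ ((ext S.toT).obj E.base)) ≫
        S.canonIso.hom.app E =
      S.canonIso.hom.app E ≫ (FGP.unitIso (zetaInvUnit E)).inv := by
  have h1 : (ext S.inversion).map (X := (ext S.toT).obj E.base) (Y := (ext S.toT).obj E.base)
        (↑(zetaUnit E)⁻¹ : Module.End S.T.Locᵐᵒᵖ ((ext S.toT).obj E.base)) =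
      (1 - cmul _ S.tic * extEnd S.inversion _ (E.extEndo S.toT) :
        Module.End S.Locᵐᵒᵖ ((ext S.inversion).obj ((ext S.toT).obj E.base))) := by
    rw [← extEnd_cmul S.inversion _ S.tTc S.tic S.inversion_tT, ← map_mul,
      ← (extEnd S.inversion _).map_one, ← map_sub, ← zetaUnit_inv]
    rfl
  have h2 : (FGP.unitIso (zetaInvUnit E)).inv =
      (1 - cmul _ S.tic * E.extEndo S.toS : Module.End S.Locᵐᵒᵖ ((ext S.toS).obj E.base)) :=
    zetaInvUnit_inv E
  have h3 : FGP.lin (S.canonIso.hom.app E) ∘ₗ extEnd S.inversion _ (E.extEndo S.toT) =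
      E.extEndo S.toS ∘ₗ FGP.lin (S.canonIso.hom.app E) :=
    (extTrans S.inversion_comp_toT).hom.naturality (X := E.base) (Y := E.base) E.endo
  rw [h1, h2]
  exact comp_one_sub_cmul _ S.tic h3

lemma canonIso_zeta (E : EndS S) : S.canonIso.hom.app E ≫ S.zetaInvIso.hom.app E =
    S.rawZetaIso.hom.app E ≫ S.canonIso.hom.app E := by
  have h := canonIso_zetaUnit_inv E
  have h2 : S.rawZetaIso.inv.app E = (ext S.inversion).map (X := (ext S.toT).obj E.base)
        (Y := (ext S.toT).obj E.base)
        (↑(zetaUnit E)⁻¹ : Module.End S.T.Locᵐᵒᵖ ((ext S.toT).obj E.base)) := rfl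
  have h3 : S.zetaInvIso.inv.app E = (FGP.unitIso (zetaInvUnit E)).inv := rfl
  rw [← h2, ← h3] at h
  exact hom_comp_of_inv_comp (S.rawZetaIso.app E) (S.zetaInvIso.app E) (S.canonIso.app E) h

end LocSet

end functors


/-! ### Homotopies between the maps on `K`-theory spaces -/

section maps

variable {A : Type u} [Ring A]

namespace LocSet

variable (S : LocSet A)

/-- The map `(P, f) ↦ (P[t]_S, (1 - f t⁻¹)⁻¹)`, followed by coassembly. -/
noncomputable def zetaInvDirect : C(K (EndS S), FreeLoop (K (FGP S.Loc))) :=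
  (AutCat.coassembly _).comp (kMap S.zetaInvF)

lemma tau_apply (z : K (EndS S)) (t : I) :
    (S.tau z).1 t = IsoArr.paths (kMap (isoFunctor _ _ S.tauIso) z) t := by
  show IsoArr.paths (kMap (AutCat.toIsoArr _) (kMap (tauF S) z)) t = _
  rw [kMap_comp]
  rfl

lemma zetaInvDirect_apply (z : K (EndS S)) (t : I) :
    (S.zetaInvDirect z).1 t = IsoArr.paths (kMap (isoFunctor _ _ S.zetaInvIso) z) t := by
  show IsoArr.paths (kMap (AutCat.toIsoArr _) (kMap (zetaInvF S) z)) t = _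
  rw [kMap_comp]
  rfl

lemma tMap_apply (z : K (EndS S)) (t : I) :
    (S.tMap z).1 t = IsoArr.paths (kMap (isoFunctor _ _ S.tIso) z) t := by
  show IsoArr.paths (kMap (AutCat.toIsoArr _) (kMap (tF S) (kMap (EndS.forget S) z))) t = _
  rw [kMap_comp, kMap_comp]
  rfl

lemma zetaInvRaw_apply (z : K (EndS S)) (t : I) :
    (S.zetaInvRaw z).1 t = IsoArr.paths (kMap (isoFunctor _ _ S.rawZetaIso) z) t := by
  show kMap (ext S.inversion)
    (IsoArr.paths (kMap (AutCat.toIsoArr _) (kMap (zetaF S) z)) t) = _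
  rw [← IsoArr.paths_mapF, kMap_comp, kMap_comp]
  rfl

lemma canonPaths_apply (z : K (EndS S)) (t : I) :
    S.canonPaths z t = IsoArr.paths (kMap (isoFunctor _ _ S.canonIso) z) t := by
  show IsoArr.paths (kMap S.canonF (kMap (EndS.forget S) z)) t = _
  rw [kMap_comp]
  rfl

lemma ev_zetaInvDirect (z : K (EndS S)) : FreeLoop.ev (S.zetaInvDirect z) = S.baseMap z := by
  have h : FreeLoop.ev (S.zetaInvDirect z) = kMap (AutCat.forget _) (kMap (zetaInvF S) z) :=
    AutCat.ev_coassembly _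
  have h2 : S.baseMap z = kMap ((EndS.forget S).comp (ext S.toS)) z := kMap_comp _ _ z
  rw [h, h2, kMap_comp]
  rfl

lemma kMap_baseF (z : K (EndS S)) : kMap S.baseF z = S.baseMap z :=
  (kMap_comp _ _ z).symm

/-- The canonical isomorphism identifies `(P[t]_T, (1 - f t)⁻¹) ⊗ A[t]_S` with
`(P[t]_S, (1 - f t⁻¹)⁻¹)`. -/
lemma exists_homotopy_zetaInv : ∃ H : ContinuousMap.Homotopy S.zetaInv S.zetaInvDirect,
    ∀ s z, FreeLoop.ev (H (s, z)) = S.baseMap z := by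
  let G := IsoArr.squareFunctor S.rawZetaIso S.zetaInvIso S.canonIso S.canonIso canonIso_zeta
  obtain ⟨H, hH⟩ := exists_homotopy_transport_of_square (f := S.zetaInvRaw)
    (k := S.zetaInvDirect) S.canonPaths S.canonPaths_zero
    (fun z p => IsoArr.square (kMap G z) p) (IsoArr.continuous_square (kMap G))
    (fun z t => by rw [zetaInvRaw_apply]; exact IsoArr.square_zero_left _ _ _ _ _ z t)
    (fun z t => by rw [zetaInvDirect_apply]; exact IsoArr.square_one_left _ _ _ _ _ z t)
    (fun z t => by rw [canonPaths_apply]; exact IsoArr.square_zero_right _ _ _ _ _ z t)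
    (fun z t => by rw [canonPaths_apply]; exact IsoArr.square_one_right _ _ _ _ _ z t)
  exact ⟨H, fun s z => (hH s z).trans (S.canonPaths_one z)⟩

/-- The homotopy is read off from the commutative square with sides `(1 - f t⁻¹)⁻¹`, `t - f`,
their composition `t`, and an identity. -/
lemma exists_homotopy_zetaInvDirect_mul_tau
    (h : ∀ z, FreeLoop.ev (S.zetaInvDirect z) = FreeLoop.ev (S.tau z)) :
    ∃ H : ContinuousMap.Homotopy (FreeLoop.mul S.zetaInvDirect S.tau h) S.tMap,
      ∀ s z, FreeLoop.ev (H (s, z)) = S.baseMap z := by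
  let G := IsoArr.squareFunctor S.zetaInvIso S.tIso (Iso.refl S.baseF.toFunctor) S.tauIso
    fun E => by
      refine (Category.id_comp _).trans ?_
      exact congr_arg (fun e => (FGP.unitIso e).hom) (tauUnit_mul_zetaInvUnit E).symm
  refine exists_homotopy_mul_of_square h (fun z p => IsoArr.square (kMap G z) p)
    (IsoArr.continuous_square (kMap G)) (fun z t => ?_) (fun z t => ?_) (fun z t => ?_)
    fun z t => ?_
  · rw [zetaInvDirect_apply]; exact IsoArr.square_zero_left _ _ _ _ _ z t
  · rw [tau_apply]; exact IsoArr.square_one_right _ _ _ _ _ z t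
  · rw [tMap_apply]; exact IsoArr.square_one_left _ _ _ _ _ z t
  · rw [← kMap_baseF, ← IsoArr.paths_isoFunctor_refl z t S.baseF]
    exact IsoArr.square_zero_right _ _ _ _ _ z t

/-- The product with the factors exchanged is homotopic to `t` too, since `t - f` and
`(1 - f t⁻¹)⁻¹` commute. The identity in `K₁` needs this order: in the fundamental group the
second factor of a product is traversed first. -/
lemma exists_homotopy_tau_mul_zetaInvDirect
    (h : ∀ z, FreeLoop.ev (S.tau z) = FreeLoop.ev (S.zetaInvDirect z)) :
    ∃ H : ContinuousMap.Homotopy (FreeLoop.mul S.tau S.zetaInvDirect h) S.tMap,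
      ∀ s z, FreeLoop.ev (H (s, z)) = S.baseMap z := by
  let G := IsoArr.squareFunctor S.tauIso S.tIso (Iso.refl S.baseF.toFunctor) S.zetaInvIso
    fun E => by
      refine (Category.id_comp _).trans ?_
      exact congr_arg (fun e => (FGP.unitIso e).hom) (zetaInvUnit_mul_tauUnit E).symm
  refine exists_homotopy_mul_of_square h (fun z p => IsoArr.square (kMap G z) p)
    (IsoArr.continuous_square (kMap G)) (fun z t => ?_) (fun z t => ?_) (fun z t => ?_)
    fun z t => ?_
  · rw [tau_apply]; exact IsoArr.square_zero_left _ _ _ _ _ z t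
  · rw [zetaInvDirect_apply]; exact IsoArr.square_one_right _ _ _ _ _ z t
  · rw [tMap_apply]; exact IsoArr.square_one_left _ _ _ _ _ z t
  · rw [← kMap_baseF, ← IsoArr.paths_isoFunctor_refl z t S.baseF]
    exact IsoArr.square_zero_right _ _ _ _ _ z t

/-- The loop product of `ζ(t⁻¹)` and `τ(t)` is homotopic to `t` over `K(A[t]_S)`. -/
theorem exists_homotopy_zetaMulTau : ∃ H : ContinuousMap.Homotopy S.zetaMulTau S.tMap,
    ∀ s z, FreeLoop.ev (H (s, z)) = S.baseMap z := by
  obtain ⟨H, hH⟩ := S.exists_homotopy_zetaInv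
  exact exists_homotopy_trans
    (exists_homotopy_mul_right S.ev_tau _
      (fun z => (S.ev_zetaInvDirect z).trans (S.ev_tau z).symm) H hH)
    (S.exists_homotopy_zetaInvDirect_mul_tau _)

end LocSet

end maps

/-! ### Classes in `K₁` -/

section K1

variable {C D : Type (u + 1)} [Category.{u} C] [KCat C] [Category.{u} D] [KCat D]

/-- The class in `K₁(C)` of a loop in `K(C)`, translated to the basepoint. -/
noncomputable def pathK1 {x : K C} (p : Path x x) : K1 C :=
  FundamentalGroup.fromPath ⟦((cancelPath x).trans (p.map (translate x).continuous)).trans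
    (cancelPath x).symm⟧

lemma toK1_eq_pathK1 (γ : FreeLoop (K C)) {x : K C} (p : Path x x) (h : ∀ t, γ.1 t = p t) :
    toK1 γ = pathK1 p := by
  obtain rfl : FreeLoop.ev γ = x := (h 0).trans p.source
  obtain rfl : γ.path = p := Path.ext (funext h)
  rfl

lemma pathK1_congr {x : K C} {p q : Path x x} (h : p.Homotopic q) : pathK1 p = pathK1 q :=
  Quotient.sound (((Path.Homotopic.refl _).hcomp (h.map (translate x))).hcomp (.refl _))

/-- The product of `FundamentalGroup` traverses its second factor first. -/
lemma pathK1_mul {x : K C} (p q : Path x x) : pathK1 p * pathK1 q = pathK1 (q.trans p) := by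
  let c := Path.Homotopic.Quotient.mk (cancelPath x)
  let P := Path.Homotopic.Quotient.mk (p.map (translate x).continuous)
  let Q := Path.Homotopic.Quotient.mk (q.map (translate x).continuous)
  show ((c.trans Q).trans c.symm).trans ((c.trans P).trans c.symm) =
    (c.trans (.mk ((q.trans p).map (translate x).continuous))).trans c.symm
  rw [Path.map_trans]
  show _ = (c.trans (Q.trans P)).trans c.symm
  simp only [Path.Homotopic.Quotient.trans_assoc]
  rw [← Path.Homotopic.Quotient.trans_assoc c.symm, Path.Homotopic.Quotient.symm_trans,
    Path.Homotopic.Quotient.refl_trans]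

lemma toK1_eq_of_homotopy {Z : Type (u + 1)} [TopologicalSpace Z]
    {f g : C(Z, FreeLoop (K C))} {b : Z → K C}
    (h : ∃ H : ContinuousMap.Homotopy f g, ∀ s z, FreeLoop.ev (H (s, z)) = b z) (z : Z) :
    toK1 (f z) = toK1 (g z) := by
  obtain ⟨H, hH⟩ := h
  have hf : FreeLoop.ev (f z) = b z := by rw [← hH 0 z, H.apply_zero]
  have hg : FreeLoop.ev (g z) = b z := by rw [← hH 1 z, H.apply_one]
  rw [toK1_eq_pathK1 (f z) ((f z).path.cast hf.symm hf.symm) fun _ => rfl,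
    toK1_eq_pathK1 (g z) ((g z).path.cast hg.symm hg.symm) fun _ => rfl]
  refine pathK1_congr ⟨⟨⟨⟨fun p => (H (p.1, z)).1 p.2, by fun_prop⟩, fun t => ?_, fun t => ?_⟩,
    fun s t ht => ?_⟩⟩
  · show (H (0, z)).1 t = (f z).1 t
    rw [H.apply_zero]
  · show (H (1, z)).1 t = (g z).1 t
    rw [H.apply_one]
  · rcases ht with rfl | rfl
    · exact (hH s z).trans hf.symm
    · exact (H (s, z)).2.symm.trans (((hH s z).trans hf.symm).trans (f z).2)

lemma toK1_mul {Z : Type (u + 1)} [TopologicalSpace Z] (f g : C(Z, FreeLoop (K C)))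
    (h : ∀ z, FreeLoop.ev (f z) = FreeLoop.ev (g z)) (z : Z) :
    toK1 (g z) * toK1 (f z) = toK1 (FreeLoop.mul f g h z) := by
  rw [toK1_eq_pathK1 (f z) (f z).path fun _ => rfl,
    toK1_eq_pathK1 (g z) ((g z).path.cast (h z) (h z)) fun _ => rfl, pathK1_mul]
  exact (toK1_eq_pathK1 _ _ fun _ => rfl).symm

lemma objFunctor_comp (F : ExactFunctor C D) (X : C) :
    objFunctor X ⋙ F.toFunctor = objFunctor (F.obj X) := by
  have ho : ∀ a : Idx (.mk 1), (objFunctor X ⋙ F.toFunctor).obj a =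
      (objFunctor (F.obj X)).obj a := fun a => by
    show F.obj (if a.i < a.j then X else KCat.zero) = if a.i < a.j then F.obj X else KCat.zero
    split_ifs
    · rfl
    · exact F.map_zero
  refine CategoryTheory.Functor.ext ho fun a b f => ?_
  by_cases ha : a.i < a.j
  · by_cases hb : b.i < b.j
    · obtain ⟨e, he⟩ := objFunctor_map X f (by simp [ha, hb])
      obtain ⟨e', he'⟩ := objFunctor_map (F.obj X) f (by simp [ha, hb])
      rw [he', CategoryTheory.Functor.comp_map, he, eqToHom_map, eqToHom_trans, eqToHom_trans]
    · refine Limits.IsZero.eq_of_tgt ?_ _ _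
      rw [ho]
      show Limits.IsZero (if b.i < b.j then F.obj X else KCat.zero)
      rw [if_neg hb]
      exact KCat.isZero
  · refine Limits.IsZero.eq_of_src ?_ _ _
    rw [ho]
    show Limits.IsZero (if a.i < a.j then F.obj X else KCat.zero)
    rw [if_neg ha]
    exact KCat.isZero

/-- The point of `K(C)` given by an object is natural for exact functors. -/
lemma kMap_objPt (F : ExactFunctor C D) (X : C) : kMap F (objPt X) = objPt (F.obj X) := by
  ext s
  refine (map_pt (iSMap F) _ (edgePt s)).trans ?_
  exact congr_arg (fun y => pt y (edgePt s)) (Subtype.ext (objFunctor_comp F X))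

end K1

namespace LocSet

variable {A : Type u} [Ring A] (S : LocSet A)

lemma toK1_zetaInv (z : K (EndS S)) : toK1 (S.zetaInv z) = toK1 (S.zetaInvDirect z) :=
  toK1_eq_of_homotopy S.exists_homotopy_zetaInv z

theorem toK1_zetaInv_mul_tau (z : K (EndS S)) :
    toK1 (S.zetaInv z) * toK1 (S.tau z) = toK1 (S.tMap z) := by
  rw [toK1_zetaInv, toK1_mul S.tau S.zetaInvDirect fun z =>
    (S.ev_tau z).trans (S.ev_zetaInvDirect z).symm]
  exact toK1_eq_of_homotopy (S.exists_homotopy_tau_mul_zetaInvDirect _) z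

variable {S}

theorem toK1_zetaInv_objPt (E : EndS S) :
    toK1 (S.zetaInv (objPt E)) = autClass (zetaInvAut E) := by
  rw [toK1_zetaInv]
  exact congr_arg (fun γ => toK1 (AutCat.coassembly _ γ)) (kMap_objPt S.zetaInvF E)

theorem toK1_tau_objPt (E : EndS S) : toK1 (S.tau (objPt E)) = autClass (tauAut E) :=
  congr_arg (fun γ => toK1 (AutCat.coassembly _ γ)) (kMap_objPt (tauF S) E)

theorem toK1_tMap_objPt (E : EndS S) : toK1 (S.tMap (objPt E)) = autClass (tAut E) :=
  congr_arg (fun γ => toK1 (AutCat.coassembly _ γ))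
    ((congr_arg (kMap (tF S)) (kMap_objPt (EndS.forget S) E)).trans (kMap_objPt (tF S) _))

end LocSet


/-! ### Determinants over commutative rings -/

section det

namespace Tensor

variable {A B : Type u} [Ring A] [Ring B] (φ : A →+* B) {P : Type u} [AddCommGroup P]
  [Module Aᵐᵒᵖ P] {ι : Type*} (b : Module.Basis ι Aᵐᵒᵖ P)

/-- The coordinates of elements of `P ⊗_A B` with respect to a basis of `P`. -/
noncomputable def coords : Tensor φ P →ₗ[Bᵐᵒᵖ] ι →₀ Bᵐᵒᵖ :=
  lift ((Finsupp.mapRange.addMonoidHom (RingHom.op φ).toAddMonoidHom).comp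
      b.repr.toAddEquiv.toAddMonoidHom) fun a p => by
    ext i
    show RingHom.op φ (b.repr (MulOpposite.op a • p) i) =
      MulOpposite.op (φ a) * RingHom.op φ (b.repr p i)
    rw [map_smul, Finsupp.smul_apply, smul_eq_mul, map_mul]
    rfl

lemma coords_ι (p : P) : coords φ b (Tensor.ι φ P p) =
    Finsupp.mapRange (RingHom.op φ) (map_zero _) (b.repr p) :=
  lift_ι _ _ _

/-- A basis of `P` over `A` is a basis of `P ⊗_A B` over `B`. -/
noncomputable def basis : Module.Basis ι Bᵐᵒᵖ (Tensor φ P) :=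
  .ofRepr <| LinearEquiv.ofLinearMap (coords φ b)
    (Finsupp.linearCombination Bᵐᵒᵖ fun i => Tensor.ι φ P (b i))
    (Finsupp.lhom_ext' fun i => LinearMap.ext_ring <| by
      simp [coords_ι])
    (hom_ext fun p => by
      show Finsupp.linearCombination Bᵐᵒᵖ (fun i => Tensor.ι φ P (b i))
        (coords φ b (Tensor.ι φ P p)) = Tensor.ι φ P p
      conv_rhs => rw [← b.linearCombination_repr p]
      rw [coords_ι, Finsupp.linearCombination_apply, Finsupp.linearCombination_apply,
        Finsupp.sum_mapRange_index (h := fun i a => a • Tensor.ι φ P (b i))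
          fun i => zero_smul Bᵐᵒᵖ (Tensor.ι φ P (b i)), Finsupp.sum, Finsupp.sum, map_sum]
      exact Finset.sum_congr rfl fun i _ => (ι_smul φ (b.repr p i).unop (b i)).symm)

end Tensor

/-- An isomorphism in `P(R)` as a linear equivalence. -/
def FGP.linearEquiv {R : Type u} [Ring R] {P Q : FGP R} (e : P ≅ Q) : P ≃ₗ[Rᵐᵒᵖ] Q :=
  LinearEquiv.ofLinearMap (FGP.lin e.hom) (FGP.lin e.inv) e.inv_hom_id e.hom_inv_id

lemma det_cmul {R : Type u} [CommRing R] (P : FGP R) {ι : Type*} [Fintype ι]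
    (b : Module.Basis ι Rᵐᵒᵖ P) (c : Subring.center R) :
    FGP.det (cmul P c) = (c : R) ^ Fintype.card ι := by
  classical
  have h : cmul P c = MulOpposite.op (c : R) • (1 : Module.End Rᵐᵒᵖ P) := rfl
  rw [FGP.det, ← LinearMap.det_toMatrix b, h, map_smul, LinearMap.toMatrix_one, Matrix.det_smul,
    Matrix.det_one, mul_one]
  rfl

lemma det_mul {R : Type u} [CommRing R] {P : FGP R} (f g : Module.End Rᵐᵒᵖ P) :
    FGP.det (f * g) = FGP.det f * FGP.det g := by
  rw [FGP.det, map_mul, MulOpposite.unop_mul, mul_comm]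
  rfl

/-- Milnor's identity: the determinants of the factors of `t` multiply to the determinant of
`t`. -/
theorem LocSet.det_zetaInvUnit_mul_det_tauUnit {A : Type u} [CommRing A] (S : LocSet A)
    (E : EndS S) [Module.Free Aᵐᵒᵖ E.base] :
    FGP.det (zetaInvUnit E).val * FGP.det (tauUnit E).val =
      (S.tS : S.Loc) ^ Module.finrank Aᵐᵒᵖ E.base := by
  rcases subsingleton_or_nontrivial A with hA | hA
  · have : Subsingleton S.Loc := subsingleton_of_zero_eq_one (by
      rw [← map_zero S.toLoc, ← map_one S.toLoc, Subsingleton.elim (0 : Polynomial A) 1])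
    exact Subsingleton.elim _ _
  · let b := Module.Free.chooseBasis Aᵐᵒᵖ E.base
    rw [← det_mul, ← Units.val_mul, zetaInvUnit_mul_tauUnit, tUnit_val,
      Module.finrank_eq_card_basis b]
    exact det_cmul _ ((Tensor.basis S.toS b).map (FGP.linearEquiv ((extComp S.toS).app E.base)))
      S.tc

end det

end KT

theorem theoremA :
    (∀ (A : Type u) [Ring A] (S : KT.LocSet A),
      (∃ H : ContinuousMap.Homotopy S.zetaMulTau S.tMap,
        ∀ (s : unitInterval) (z : KT.K (KT.EndS S)),
          KT.FreeLoop.ev (H (s, z)) = S.baseMap z) ∧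
      (∀ z : KT.K (KT.EndS S),
        KT.toK1 (S.zetaInv z) * KT.toK1 (S.tau z) = KT.toK1 (S.tMap z)) ∧
      (∀ E : KT.EndS S,
        KT.toK1 (S.zetaInv (KT.objPt E)) = KT.autClass (KT.LocSet.zetaInvAut E) ∧
        KT.toK1 (S.tau (KT.objPt E)) = KT.autClass (KT.LocSet.tauAut E) ∧
        KT.toK1 (S.tMap (KT.objPt E)) = KT.autClass (KT.LocSet.tAut E))) ∧
    (∀ (A : Type u) [CommRing A] (S : KT.LocSet A) (E : KT.EndS S) [Module.Free Aᵐᵒᵖ E.base],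
      KT.FGP.det (KT.LocSet.zetaInvUnit E).val * KT.FGP.det (KT.LocSet.tauUnit E).val =
        (S.tS : S.Loc) ^ Module.finrank Aᵐᵒᵖ E.base) :=
  ⟨fun _ _ S => ⟨S.exists_homotopy_zetaMulTau, S.toK1_zetaInv_mul_tau, fun E =>
    ⟨KT.LocSet.toK1_zetaInv_objPt E, KT.LocSet.toK1_tau_objPt E,
      KT.LocSet.toK1_tMap_objPt E⟩⟩,
    fun _ _ S E _ => S.det_zetaInvUnit_mul_det_tauUnit E⟩
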